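/- Let $n,m,N\ge 0$ be integers. A $\mathfrak{gl}_k$-crystal is a finite set $B$ with maps $\mathrm{wt}:B\to\mathbb Z^k$, $e_i,f_i:B\to B\sqcup\{0\}$, $\varepsilon_i,\varphi_i:B\to\mathbb Z$ ($1\le i\le k-1$) satisfying the usual axioms. Tensor products follow the convention that $e_i(b_1\otimes\cdots\otimes b_d)$ applies $e_i$ to the factor $b_s$ with $s$ smallest such that $\varepsilon_i^s=\max(0,\max_t\varepsilon_i^t)$, where $\varepsilon_i^t=\varepsilon_i(b_t)-\langle\alpha_i^\vee,\mathrm{wt}(b_1)+\cdots+\mathrm{wt}(b_{t-1})\rangle$, and $f_i$ applies $f_i$ to the factor $b_s$ with $s$ largest such that $\varphi_i^s=\max(0,\max_t\varphi_i^t)$, where $\varphi_i^t=\varphi_i(b_t)+\langle\alpha_i^\vee,\mathrm{wt}(b_{t+1})+\cdots+\mathrm{wt}(b_d)\rangle$. Let $V_k=\bigsqcup_{l=0}^k\mathcal B_{\varpi_l}^{\mathfrak{gl}_k}$ be the crystal of $0/1$-vectors of length $k$ ($\mathcal B_{\varpi_l}$ consists of those with $l$ ones; $e_i$ moves a one from position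 $i+1$ to a free position $i$, and $f_i$ does the reverse). For a $\mathfrak{gl}_k$-crystal $B$ and $1\le p<q\le k$ let $\xi_{p,q}:B\to B$ be the Schützenberger involution of the restriction $B_J$ of $B$ to the nodes $J=\{p,\dots,q-1\}$: the map preserving each connected component of $B_J$ with $e_i\xi=\xi f_{p+q-1-i}$ and $f_i\xi=\xi e_{p+q-1-i}$ for $i\in J$ (where $\xi(0)=0$), and $\mathrm{wt}(\xi(b))=w_0^J\,\mathrm{wt}(b)$, where $w_0^J$ reverses the coordinates $p,\dots,q$. Let $\xi=\xi_{1,k}$ be the involution for the whole diagram (the identity if $k\le 1$). Let $\Lambda^NB_{n,m}$ be the set of $n\times m$ matrices with entries in $\{0,1\}$ and exactly $N$ ones. It is a $\mathfrak{gl}_m$-crystal by reading $M$ as $r_1\otimes\cdots\otimes r_n\in V_m^{\otimes n}$ (its rows) and a $\mathfrak{gl}_n$-crystal by reading $M$ as $c_m\otimes\cdots\otimes c_1\in V_n^{\otimes m}$ (its columns from right to left). Let $C_n$ be the cactus group, with generators $s_{p,q}$, $1\le p<q\le n$, and relations $s_{p,q}^2=1$; $s_{p,q}s_{p',q'}=s_{p+q-q',\,p+q-p'}s_{p,q}$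 if $p\le p'<q'\le q$; $s_{p,q}s_{p',q'}=s_{p',q'}s_{p,q}$ if $q<p'$. For $p<q$ define the outer map $$s^{o}_{p,q}(r_1\otimes\cdots\otimes r_n)=r_1\otimes\cdots\otimes r_{p-1}\otimes\xi\bigl(\xi(r_q)\otimes\cdots\otimes\xi(r_p)\bigr)\otimes r_{q+1}\otimes\cdots\otimes r_n,$$ formed with $\mathfrak{gl}_m$-crystals, and the inner map $s^{i}_{p,q}=\xi_{p,q}$ of the $\mathfrak{gl}_n$-crystal $\Lambda^NB_{n,m}$. **Theorem.** Both structures on $\Lambda^NB_{n,m}$ are crystals, and the Schützenberger involutions used here (those of $V_m$ and of all its tensor powers, the $\xi_{p,q}$ of the $\mathfrak{gl}_n$-crystal $\Lambda^NB_{n,m}$, and the $\xi_{p,q}$ of the tableau crystals $\mathcal B^{\mathfrak{gl}_n}_\lambda$ below) exist and are unique. The assignments $s_{p,q}\mapsto s^{o}_{p,q}$ and $s_{p,q}\mapsto s^{i}_{p,q}$ both define actions of $C_n$ on $\Lambda^NB_{n,m}$, and these actions agree: $$s^{o}_{p,q}(M)=s^{i}_{p,q}(M)\qquad\text{for all }1\le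 p<q\le n,\ M\in\Lambda^NB_{n,m}.$$ Moreover, let $\mathcal B^{\mathfrak{gl}_k}_\mu$ be the crystal of semistandard Young tableaux of shape $\mu$ with entries in $\{1,\dots,k\}$, a tableau being read as the tensor product of its columns from right to left. Then there is an isomorphism of $\mathfrak{gl}_n\times\mathfrak{gl}_m$-crystals (crystal skew Howe duality) $$\Lambda^NB_{n,m}\;\cong\bigsqcup_{\lambda\subset n\times m,\ |\lambda|=N}\mathcal B^{\mathfrak{gl}_n}_\lambda\otimes\mathcal B^{\mathfrak{gl}_m}_{\lambda^{\mathrm{tr}}},\qquad M\mapsto T_P\otimes T_Q,$$ where $\mathfrak{gl}_n$ acts on the first and $\mathfrak{gl}_m$ on the second factor, $P$ is the $\mathfrak{gl}_m$-highest weight matrix reached from $M$ by row raising operators, $Q$ is the $\mathfrak{gl}_n$-lowest weight matrix reached from $M$ by column lowering operators, $a$ lies in column $j$ of $T_P$ iff $P_{a,j}=1$, and $a$ lies in column $j$ of $T_Q$ iff $Q_{n+1-j,a}=1$. Under this isomorphism the above action of $s_{p,q}$ becomes $b\otimes c\mapsto\xi_{p,q}(b)\otimes c$. -/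

import Mathlib

/-! ## Crystals for `gl_k`

Nodes of the Dynkin diagram of `gl_k` are numbered `0, …, k-2` (so `Fin (k-1)`), coordinates of
weights `0, …, k-1`; the element `0 ∉ B` of the usual convention is `none`. -/

namespace GLCrystal

/-- First coordinate of the simple root `α_i = ε_i - ε_{i+1}`. -/
def fstIdx {k : ℕ} (i : Fin (k - 1)) : Fin k := ⟨i.1, by omega⟩

/-- Second coordinate of the simple root `α_i = ε_i - ε_{i+1}`. -/
def sndIdx {k : ℕ} (i : Fin (k - 1)) : Fin k := ⟨i.1 + 1, by omega⟩

/-- The simple root `α_i = ε_i - ε_{i+1}`. -/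
def root {k : ℕ} (i : Fin (k - 1)) : Fin k → ℤ :=
  Pi.single (fstIdx i) 1 - Pi.single (sndIdx i) 1

/-- The pairing `⟨w, α_i^∨⟩`. -/
def corootPairing {k : ℕ} (w : Fin k → ℤ) (i : Fin (k - 1)) : ℤ :=
  w (fstIdx i) - w (sndIdx i)

/-- The maps `wt, e_i, f_i, ε_i, φ_i` of a `gl_k`-crystal with underlying set `B`. -/
structure CrystalData (k : ℕ) (B : Type*) where
  wt : B → Fin k → ℤ
  e : Fin (k - 1) → B → Option B
  f : Fin (k - 1) → B → Option B
  eps : Fin (k - 1) → B → ℤ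
  phi : Fin (k - 1) → B → ℤ

variable {k : ℕ} {A B : Type*}

/-- The axioms of a `gl_k`-crystal. -/
structure IsCrystal (C : CrystalData k B) : Prop where
  finite : Finite B
  f_iff_e : ∀ i b c, C.f i b = some c ↔ C.e i c = some b
  wt_e : ∀ i b c, C.e i b = some c → C.wt c = C.wt b + root i
  wt_f : ∀ i b c, C.f i b = some c → C.wt c = C.wt b - root i
  eps_max : ∀ i b,
    IsGreatest {z : ℤ | ∃ j : ℕ, z = j ∧ (fun x => x.bind (C.e i))^[j] (some b) ≠ none} (C.eps i b)
  phi_max : ∀ i b,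
    IsGreatest {z : ℤ | ∃ j : ℕ, z = j ∧ (fun x => x.bind (C.f i))^[j] (some b) ≠ none} (C.phi i b)
  phi_sub_eps : ∀ i b, C.phi i b - C.eps i b = corootPairing (C.wt b) i

/-- A bijection that is an isomorphism of `gl_k`-crystals. -/
structure IsCrystalIso (C : CrystalData k A) (D : CrystalData k B) (F : A ≃ B) : Prop where
  wt : ∀ a, D.wt (F a) = C.wt a
  eps : ∀ i a, D.eps i (F a) = C.eps i a
  phi : ∀ i a, D.phi i (F a) = C.phi i a
  e : ∀ i a, D.e i (F a) = (C.e i a).map F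
  f : ∀ i a, D.f i (F a) = (C.f i a).map F

/-- `b` and `c` lie in the same connected component of the restriction of the crystal to the
nodes `p, …, q-1`. -/
def Connected (C : CrystalData k B) (p q : ℕ) (b c : B) : Prop :=
  Relation.EqvGen (fun x y => ∃ i : Fin (k - 1), p ≤ i.1 ∧ i.1 < q ∧ C.f i x = some y) b c

/-- `ξ` is the Schützenberger involution of the restriction `C_J` of the crystal to the subdiagram
`J = {p, …, q-1}`, whose diagram automorphism is `θ_J(i) = p + q - 1 - i` and whose longest Weyl
group element `w_0^J` reverses the coordinates `p, …, q`: it preserves each connected component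
of `C_J`, and `e_i ξ = ξ f_{θ_J(i)}`, `f_i ξ = ξ e_{θ_J(i)}` for `i ∈ J`, `wt ∘ ξ = w_0^J ∘ wt`. -/
structure IsSchutzenberger (C : CrystalData k B) (p q : ℕ) (ξ : B → B) : Prop where
  connected : ∀ b, Connected C p q b (ξ b)
  e_comm : ∀ i j : Fin (k - 1), p ≤ i.1 → i.1 < q → i.1 + j.1 + 1 = p + q →
    ∀ b, C.e i (ξ b) = (C.f j b).map ξ
  f_comm : ∀ i j : Fin (k - 1), p ≤ i.1 → i.1 < q → i.1 + j.1 + 1 = p + q →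
    ∀ b, C.f i (ξ b) = (C.e j b).map ξ
  wt_inside : ∀ x y : Fin k, p ≤ x.1 → x.1 ≤ q → x.1 + y.1 = p + q →
    ∀ b, C.wt (ξ b) x = C.wt b y
  wt_outside : ∀ x : Fin k, (x.1 < p ∨ q < x.1) → ∀ b, C.wt (ξ b) x = C.wt b x

open Classical in
/-- The Schützenberger involution `ξ_{C_J}`, `J = {p, …, q-1}` (the identity if there is none). -/
noncomputable def partialXi (C : CrystalData k B) (p q : ℕ) : B → B :=
  if h : ∃ ξ, IsSchutzenberger C p q ξ then h.choose else id

/-- The Schützenberger involution `ξ_C` for the whole Dynkin diagram of `gl_k`. -/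
noncomputable def xi (C : CrystalData k B) : B → B := partialXi C 0 (k - 1)

/-- `c` is a highest weight element obtained from `b` by a sequence of raising operators. -/
def IsEMax (C : CrystalData k B) (b c : B) : Prop :=
  Relation.ReflTransGen (fun x y => ∃ i, C.e i x = some y) b c ∧ ∀ i, C.e i c = none

/-- `c` is a lowest weight element obtained from `b` by a sequence of lowering operators. -/
def IsFMax (C : CrystalData k B) (b c : B) : Prop :=
  Relation.ReflTransGen (fun x y => ∃ i, C.f i x = some y) b c ∧ ∀ i, C.f i c = none

/-! ### Tensor products -/

/-- `ε_i^s(b_1 ⊗ ⋯ ⊗ b_d) = ε_i(b_s) - ⟨α_i^∨, wt(b_1) + ⋯ + wt(b_{s-1})⟩`. -/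
def tensorEpsAt (C : CrystalData k B) {d : ℕ} (i : Fin (k - 1)) (b : Fin d → B) (s : Fin d) : ℤ :=
  C.eps i (b s) - corootPairing (∑ t with t < s, C.wt (b t)) i

/-- `φ_i^s(b_1 ⊗ ⋯ ⊗ b_d) = φ_i(b_s) + ⟨α_i^∨, wt(b_{s+1}) + ⋯ + wt(b_d)⟩`. -/
def tensorPhiAt (C : CrystalData k B) {d : ℕ} (i : Fin (k - 1)) (b : Fin d → B) (s : Fin d) : ℤ :=
  C.phi i (b s) + corootPairing (∑ t with s < t, C.wt (b t)) i

/-- `max_s {ε_i^s, 0}`. -/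
def tensorEps (C : CrystalData k B) {d : ℕ} (i : Fin (k - 1)) (b : Fin d → B) : ℤ :=
  Finset.univ.fold max 0 (tensorEpsAt C i b)

/-- `max_s {φ_i^s, 0}`. -/
def tensorPhi (C : CrystalData k B) {d : ℕ} (i : Fin (k - 1)) (b : Fin d → B) : ℤ :=
  Finset.univ.fold max 0 (tensorPhiAt C i b)

/-- The tensor power `C ⊗ ⋯ ⊗ C` (`d` factors): `e_i` acts in the smallest position `s` with
`ε_i^s = ε_i`, and `f_i` in the largest position `s` with `φ_i^s = φ_i`. -/
def tensorPow (C : CrystalData k B) (d : ℕ) : CrystalData k (Fin d → B) where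
  wt b := ∑ s, C.wt (b s)
  e i b := ((List.finRange d).find? fun s => decide (tensorEpsAt C i b s = tensorEps C i b)).bind
    fun s => (C.e i (b s)).map (Function.update b s)
  f i b :=
    ((List.finRange d).reverse.find? fun s => decide (tensorPhiAt C i b s = tensorPhi C i b)).bind
      fun s => (C.f i (b s)).map (Function.update b s)
  eps := tensorEps C
  phi := tensorPhi C

open Classical in
/-- The crystal structure that a set `A` inherits from `C` through an injection `r` of `A` onto a
set of elements of `C` that is stable under the Kashiwara operators. -/
noncomputable def pullback (C : CrystalData k B) (r : A → B) : CrystalData k A where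
  wt a := C.wt (r a)
  e i a := (C.e i (r a)).bind fun x => if h : ∃ a', r a' = x then some h.choose else none
  f i a := (C.f i (r a)).bind fun x => if h : ∃ a', r a' = x then some h.choose else none
  eps i a := C.eps i (r a)
  phi i a := C.phi i (r a)

/-! ### Fundamental crystals -/

/-- The direct sum `⨆_l B_{ϖ_l}`, `0 ≤ l ≤ k`, of the crystals of the fundamental representations
`Λ^l ℂ^k`. The elements of `B_{ϖ_l}` are the 0/1-vectors of length `k` with `l` ones; `e_i` moves
a one from position `i+1` to the free position `i`, and `f_i` moves it back. -/
def vecCrystal (k : ℕ) : CrystalData k (Fin k → Bool) where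
  wt b j := if b j then 1 else 0
  e i b := if b (fstIdx i) = false ∧ b (sndIdx i) = true then
    some (Function.update (Function.update b (fstIdx i) true) (sndIdx i) false) else none
  f i b := if b (fstIdx i) = true ∧ b (sndIdx i) = false then
    some (Function.update (Function.update b (fstIdx i) false) (sndIdx i) true) else none
  eps i b := if b (fstIdx i) = false ∧ b (sndIdx i) = true then 1 else 0
  phi i b := if b (fstIdx i) = true ∧ b (sndIdx i) = false then 1 else 0

/-! ### 0/1-matrices -/

/-- `Λ^N B_{n,m}`: the `n × m` matrices with entries in `{0, 1}` (`false`, `true`) and exactly `N`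
ones. -/
def LambdaB (N n m : ℕ) : Type :=
  {M : Matrix (Fin n) (Fin m) Bool // (Finset.univ.filter fun x : Fin n × Fin m => M x.1 x.2).card = N}

/-- The `gl_m`-crystal structure: `M` is read as `r_1 ⊗ ⋯ ⊗ r_n`, the tensor product of its rows. -/
noncomputable def rowCrystal (N n m : ℕ) : CrystalData m (LambdaB N n m) :=
  pullback (tensorPow (vecCrystal m) n) fun M i => M.1 i

/-- The `gl_n`-crystal structure: `M` is read as `c_m ⊗ ⋯ ⊗ c_1`, the tensor product of its columns
from right to left. -/
noncomputable def colCrystal (N n m : ℕ) : CrystalData n (LambdaB N n m) :=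
  pullback (tensorPow (vecCrystal n) m) fun M j i => M.1 i j.rev

/-! ### The two actions -/

/-- The Henriques–Kamnitzer map
`s^o_{p,q}(b_1 ⊗ ⋯ ⊗ b_n) = b_1 ⊗ ⋯ ⊗ b_{p-1} ⊗ ξ(ξ(b_q) ⊗ ⋯ ⊗ ξ(b_p)) ⊗ b_{q+1} ⊗ ⋯ ⊗ b_n`. -/
noncomputable def tensorOuter (C : CrystalData k B) {n : ℕ} (p q : Fin n) (b : Fin n → B) :
    Fin n → B :=
  fun r => if h : p ≤ r ∧ r ≤ q then
      xi (tensorPow C (q.1 - p.1 + 1)) (fun j => xi C (b ⟨q.1 - j.1, by omega⟩))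
        ⟨r.1 - p.1, by have := h.1; have := h.2; omega⟩
    else b r

/-- The outer map `s^o_{p,q}` on 0/1-matrices, read as tensor products of their rows. -/
noncomputable def sOuter {n m : ℕ} (p q : Fin n) (M : Matrix (Fin n) (Fin m) Bool) :
    Matrix (Fin n) (Fin m) Bool :=
  tensorOuter (vecCrystal m) p q M

/-- The inner map `s^i_{p,q}`: the Schützenberger involution of the `gl_n`-crystal `Λ^N B_{n,m}`
restricted to the nodes `p, …, q-1`. -/
noncomputable def sInner {N n m : ℕ} (p q : Fin n) : LambdaB N n m → LambdaB N n m :=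
  partialXi (colCrystal N n m) p.1 q.1

/-- The generators `s_{p,q}`, `p < q`, of the cactus group; `s_{p,q}` belongs to the connected
subdiagram `{p, …, q-1}` of the Dynkin diagram of `gl_n`. -/
def CactusGen (n : ℕ) : Type := {x : Fin n × Fin n // x.1 < x.2}

/-- The defining relations of the cactus group `C_n`. -/
inductive CactusRel (n : ℕ) : FreeGroup (CactusGen n) → Prop
  /-- `s_J² = 1` -/
  | invol (a : CactusGen n) : CactusRel n (FreeGroup.of a * FreeGroup.of a)
  /-- `s_J s_{J'} = s_{θ_J(J')} s_J` for `J' ⊆ J` -/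
  | nested (a b c : CactusGen n) (h₁ : a.1.1 ≤ b.1.1) (h₂ : b.1.2 ≤ a.1.2)
      (h₃ : b.1.1.1 + c.1.2.1 = a.1.1.1 + a.1.2.1) (h₄ : b.1.2.1 + c.1.1.1 = a.1.1.1 + a.1.2.1) :
      CactusRel n (FreeGroup.of a * FreeGroup.of b * (FreeGroup.of c * FreeGroup.of a)⁻¹)
  /-- `s_J s_{J'} = s_{J'} s_J` if `J ∪ J'` is not connected -/
  | disjoint (a b : CactusGen n) (h : a.1.2 < b.1.1) :
      CactusRel n (FreeGroup.of a * FreeGroup.of b * (FreeGroup.of b * FreeGroup.of a)⁻¹)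

/-- The cactus group `C_n = C_{gl_n}`. -/
abbrev CactusGroup (n : ℕ) : Type := PresentedGroup {r | CactusRel n r}

/-- The element `s_{p,q}` of `C_n`. -/
def cactusS {n : ℕ} (p q : Fin n) (h : p < q) : CactusGroup n :=
  PresentedGroup.of ⟨(p, q), h⟩

/-! ### Tableaux and skew Howe duality -/

/-- Semistandard Young tableaux of shape `μ` with entries in the alphabet `{0, …, k-1}`. -/
def Tableau (k : ℕ) (μ : YoungDiagram) : Type :=
  {T : SemistandardYoungTableau μ // ∀ i j, (i, j) ∈ μ → T i j < k}

/-- The letter `a` occurs in column `j` of `T`. -/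
def Tableau.InCol {k : ℕ} {μ : YoungDiagram} (T : Tableau k μ) (j a : ℕ) : Prop :=
  ∃ i, (i, j) ∈ μ ∧ T.1 i j = a

open Classical in
/-- The crystal `B_μ` of the irreducible `gl_k`-representation with highest weight `μ`:
a tableau is read as the tensor product of its columns from right to left. -/
noncomputable def tabCrystal (k : ℕ) (μ : YoungDiagram) : CrystalData k (Tableau k μ) :=
  pullback (tensorPow (vecCrystal k) (μ.rowLen 0)) fun T j a => decide (T.InCol j.rev.1 a.1)

/-- Partitions `λ ⊆ n × m` (at most `n` rows, at most `m` columns) with `|λ| = N`. -/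
def BoxPartition (N n m : ℕ) : Type :=
  {μ : YoungDiagram // μ.colLen 0 ≤ n ∧ μ.rowLen 0 ≤ m ∧ μ.card = N}

/-- The underlying set of `⨆_λ B^{gl_n}_λ ⊗ B^{gl_m}_{λ^tr}`. -/
def Howe (N n m : ℕ) : Type :=
  Σ μ : BoxPartition N n m, Tableau n μ.1 × Tableau m μ.1.transpose

/-- The `gl_n`-crystal structure on `⨆_λ B^{gl_n}_λ ⊗ B^{gl_m}_{λ^tr}` (on the first factors). -/
noncomputable def howeFst (N n m : ℕ) : CrystalData n (Howe N n m) where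
  wt x := (tabCrystal n x.1.1).wt x.2.1
  e i x := ((tabCrystal n x.1.1).e i x.2.1).map fun T => ⟨x.1, T, x.2.2⟩
  f i x := ((tabCrystal n x.1.1).f i x.2.1).map fun T => ⟨x.1, T, x.2.2⟩
  eps i x := (tabCrystal n x.1.1).eps i x.2.1
  phi i x := (tabCrystal n x.1.1).phi i x.2.1

/-- The `gl_m`-crystal structure on `⨆_λ B^{gl_n}_λ ⊗ B^{gl_m}_{λ^tr}` (on the second factors). -/
noncomputable def howeSnd (N n m : ℕ) : CrystalData m (Howe N n m) where
  wt x := (tabCrystal m x.1.1.transpose).wt x.2.2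
  e i x := ((tabCrystal m x.1.1.transpose).e i x.2.2).map fun T => ⟨x.1, x.2.1, T⟩
  f i x := ((tabCrystal m x.1.1.transpose).f i x.2.2).map fun T => ⟨x.1, x.2.1, T⟩
  eps i x := (tabCrystal m x.1.1.transpose).eps i x.2.2
  phi i x := (tabCrystal m x.1.1.transpose).phi i x.2.2

/-- The inner action on `⨆_λ B^{gl_n}_λ ⊗ B^{gl_m}_{λ^tr}`: `b ⊗ c ↦ ξ_{p,q}(b) ⊗ c`. -/
noncomputable def howeInner {N n m : ℕ} (p q : Fin n) (x : Howe N n m) : Howe N n m :=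
  ⟨x.1, partialXi (tabCrystal n x.1.1) p.1 q.1 x.2.1, x.2.2⟩

/-- `F` is crystal skew Howe duality: an isomorphism of `gl_n × gl_m`-crystals, sending `M` to the
pair of tableaux `(T_P, T_Q)`, where `P` is the `gl_m`-highest weight matrix reached from `M` by row
raising operators and `Q` the `gl_n`-lowest weight matrix reached by column lowering operators;
`a` lies in column `j` of `T_P` iff `P_{a,j} = 1`, and `a` lies in column `j` of `T_Q` iff
`Q_{n+1-j,a} = 1` (in 1-based numbering). -/
structure IsSkewHoweDuality {N n m : ℕ} (F : LambdaB N n m ≃ Howe N n m) : Prop where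
  iso_fst : IsCrystalIso (colCrystal N n m) (howeFst N n m) F
  iso_snd : IsCrystalIso (rowCrystal N n m) (howeSnd N n m) F
  exists_P : ∀ M, ∃ P, IsEMax (rowCrystal N n m) M P ∧
    ∀ (a : Fin n) (j : Fin m), P.1 a j = true ↔ (F M).2.1.InCol j.1 a.1
  exists_Q : ∀ M, ∃ Q, IsFMax (colCrystal N n m) M Q ∧
    ∀ (a : Fin m) (j : Fin n), Q.1 j.rev a = true ↔ (F M).2.2.InCol j.1 a.1

end GLCrystal

/-! A quarter turn of a 0/1-matrix exchanges its row structure with its column structure. The row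
operators commute with the column operators, and a matrix which is highest for the rows and lowest
for the columns is a Young diagram justified to a corner, so it is determined by either of its two
weights. Commutation reduces everything to these extremal matrices: a matrix is determined by its
row component together with its column component, a row and a column component meet exactly when
their extremal matrices agree, and the pair of components is the pair `(P, Q)` of skew Howe duality.

A half turn reverses the arrows of both structures and fixes, up to components, the extremal
matrix. Hence the component of `M` in the row structure meets that of its half turn in the column
structure in a single matrix, and sending `M` to it is the Schützenberger involution of the row
structure; interchanging the two structures shows that the half turn composed with it is the
involution of the column structure. As `ξ` reverses each row, `ξ(r_q) ⊗ ⋯ ⊗ ξ(r_p)` is the half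
turn of the rows `p, …, q`, which turns the outer map into the inner one. -/

namespace GLCrystal

/-! ## Crystals and Schützenberger involutions -/

section Iterates

variable {A B : Type*}

theorem iterate_bind_none (g : B → Option B) (j : ℕ) :
    (fun x : Option B => x.bind g)^[j] none = none :=
  Function.iterate_fixed rfl j

theorem iterate_bind_ne_none_iff {g : B → Option B} {ε : B → ℤ} (h₀ : ∀ b, 0 ≤ ε b)
    (hnone : ∀ b, g b = none → ε b = 0) (hsome : ∀ b c, g b = some c → ε c = ε b - 1)
    (j : ℕ) (b : B) :
    (fun x : Option B => x.bind g)^[j] (some b) ≠ none ↔ (j : ℤ) ≤ ε b := by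
  induction j generalizing b with
  | zero => simpa using h₀ b
  | succ j ih =>
    rw [Function.iterate_succ_apply]
    rcases hg : g b with _ | c
    · have := hnone b hg
      simp only [Option.bind_some, hg, iterate_bind_none, ne_eq, not_true_eq_false, false_iff]
      omega
    · have := hsome b c hg
      simp only [Option.bind_some, hg]
      rw [ih c]
      omega

theorem isGreatest_iterate_bind_ne_none {g : B → Option B} {ε : B → ℤ} (h₀ : ∀ b, 0 ≤ ε b)
    (hnone : ∀ b, g b = none → ε b = 0) (hsome : ∀ b c, g b = some c → ε c = ε b - 1) (b : B) :
    IsGreatest {z : ℤ | ∃ j : ℕ, z = j ∧ (fun x : Option B => x.bind g)^[j] (some b) ≠ none}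
      (ε b) := by
  simp only [iterate_bind_ne_none_iff h₀ hnone hsome]
  refine ⟨⟨(ε b).toNat, ?_, ?_⟩, ?_⟩
  · exact (Int.toNat_of_nonneg (h₀ b)).symm
  · exact (Int.toNat_of_nonneg (h₀ b)).le
  · rintro z ⟨j, rfl, hj⟩
    exact hj

theorem iterate_bind_apply_eq_map {g : A → Option A} {g' : B → Option B} {r : A → B}
    (h : ∀ a, g' (r a) = (g a).map r) (j : ℕ) (a : A) :
    (fun x : Option B => x.bind g')^[j] (some (r a)) =
      ((fun x : Option A => x.bind g)^[j] (some a)).map r := by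
  have hsemi : Function.Semiconj (Option.map r)
      (fun x : Option A => x.bind g) (fun x : Option B => x.bind g') := by
    rintro (_ | a)
    · rfl
    · exact (h a).symm
  exact ((hsemi.iterate_right j).eq (some a)).symm

theorem iterate_bind_apply_ne_none_iff {g : A → Option A} {g' : B → Option B} {r : A → B}
    (h : ∀ a, g' (r a) = (g a).map r) (j : ℕ) (a : A) :
    (fun x : Option B => x.bind g')^[j] (some (r a)) ≠ none ↔
      (fun x : Option A => x.bind g)^[j] (some a) ≠ none := by
  rw [iterate_bind_apply_eq_map h, ne_eq, Option.map_eq_none_iff]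

end Iterates

section Relations

variable {A B : Type*}

theorem wellFounded_of_forall_lt [Finite B] {α : Type*} [Preorder α] (g : B → α)
    {r : B → B → Prop} (h : ∀ b c, r b c → g b < g c) : WellFounded r := by
  have : IsTrans B (InvImage (· < ·) g) := ⟨fun _ _ _ h₁ h₂ => lt_trans h₁ h₂⟩
  have : Std.Irrefl (InvImage (· < ·) g) := ⟨fun _ h => lt_irrefl _ h⟩
  exact Subrelation.wf (h _ _) (Finite.wellFounded_of_trans_of_irrefl (InvImage (· < ·) g))

theorem eqvGen_lift {r : A → A → Prop} {s : B → B → Prop} {g : A → B}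
    (h : ∀ a a', r a a' → Relation.EqvGen s (g a) (g a')) {a a' : A}
    (ha : Relation.EqvGen r a a') : Relation.EqvGen s (g a) (g a') :=
  ha.rec (fun _ _ => h _ _) (fun _ => .refl _) (fun _ _ _ => .symm _ _)
    (fun _ _ _ _ _ => .trans _ _ _)

end Relations

section Crystals

variable {k : ℕ} {A B : Type*} {C : CrystalData k B} {p q : ℕ}

/-- The linear form `∑ₓ x wₓ` on weights. Simple roots have value `-1`, so it strictly decreases
along raising operators. -/
def weightMoment (w : Fin k → ℤ) : ℤ := ∑ x : Fin k, (x.1 : ℤ) * w x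

theorem weightMoment_add (v w : Fin k → ℤ) :
    weightMoment (v + w) = weightMoment v + weightMoment w := by
  simp [weightMoment, mul_add, Finset.sum_add_distrib]

theorem weightMoment_root (i : Fin (k - 1)) : weightMoment (root i) = -1 := by
  simp [weightMoment, root, mul_sub, Finset.sum_sub_distrib, Pi.single_apply, fstIdx, sndIdx]

theorem IsCrystal.wellFounded_raise (hC : IsCrystal C) :
    WellFounded fun c b => ∃ i, C.e i b = some c := by
  have := hC.finite
  refine wellFounded_of_forall_lt (fun b => weightMoment (C.wt b)) ?_
  rintro c b ⟨i, hi⟩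
  simp only [hC.wt_e i b c hi, weightMoment_add, weightMoment_root]
  omega

/-- `b` is a highest weight element of the restriction of the crystal to the nodes
`p, …, q-1`. -/
def IsHighestWeight (C : CrystalData k B) (p q : ℕ) (b : B) : Prop :=
  ∀ i : Fin (k - 1), p ≤ i.1 → i.1 < q → C.e i b = none

/-- Each connected component of the restriction of the crystal to the nodes `p, …, q-1` contains
at most one highest weight element. This rigidity is what makes Schützenberger involutions
unique. -/
def UniqueHighest (C : CrystalData k B) (p q : ℕ) : Prop :=
  ∀ b c, Connected C p q b c → IsHighestWeight C p q b → IsHighestWeight C p q c → b = c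

theorem exists_reflected_node (hq : q ≤ k - 1) {i : Fin (k - 1)} (hi₁ : p ≤ i.1)
    (hi₂ : i.1 < q) : ∃ j : Fin (k - 1), p ≤ j.1 ∧ j.1 < q ∧ i.1 + j.1 + 1 = p + q :=
  ⟨⟨p + q - 1 - i.1, by omega⟩, by simp only; omega, by simp only; omega, by simp only; omega⟩

theorem UniqueHighest.eq_self_of_commute (hU : UniqueHighest C p q) (hC : IsCrystal C)
    {g : B → B} (hg : ∀ b, Connected C p q b (g b))
    (he : ∀ i : Fin (k - 1), p ≤ i.1 → i.1 < q → ∀ b, C.e i (g b) = (C.e i b).map g) (b : B) :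
    g b = b := by
  induction b using hC.wellFounded_raise.induction with | _ b ih
  by_cases hb : IsHighestWeight C p q b
  · refine hU _ _ (.symm _ _ (hg b)) (fun i hi₁ hi₂ => ?_) hb
    rw [he i hi₁ hi₂, hb i hi₁ hi₂, Option.map_none]
  · simp only [IsHighestWeight, not_forall] at hb
    obtain ⟨i, hi₁, hi₂, hi⟩ := hb
    obtain ⟨c, hc⟩ := Option.ne_none_iff_exists'.1 hi
    have hgb : C.e i (g b) = some c := by
      rw [he i hi₁ hi₂ b, hc, Option.map_some, ih c ⟨i, hc⟩]
    rw [← hC.f_iff_e] at hc hgb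
    exact Option.some_injective _ (hgb.symm.trans hc)

theorem isSchutzenberger_of_involutive (hC : IsCrystal C) {ξ : B → B}
    (hconn : ∀ b, Connected C p q b (ξ b)) (hinv : Function.Involutive ξ)
    (hf : ∀ i j : Fin (k - 1), p ≤ i.1 → i.1 < q → i.1 + j.1 + 1 = p + q →
      ∀ b c, C.f i b = some c → C.f j (ξ c) = some (ξ b))
    (hwt_inside : ∀ x y : Fin k, p ≤ x.1 → x.1 ≤ q → x.1 + y.1 = p + q →
      ∀ b, C.wt (ξ b) x = C.wt b y)
    (hwt_outside : ∀ x : Fin k, (x.1 < p ∨ q < x.1) → ∀ b, C.wt (ξ b) x = C.wt b x) :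
    IsSchutzenberger C p q ξ := by
  have hf_iff : ∀ i j : Fin (k - 1), p ≤ i.1 → i.1 < q → i.1 + j.1 + 1 = p + q →
      ∀ b c, C.f i b = some c ↔ C.f j (ξ c) = some (ξ b) := fun i j hi₁ hi₂ hij b c =>
    ⟨hf i j hi₁ hi₂ hij b c, fun h => by
      simpa only [hinv b, hinv c] using
        hf j i (by omega) (by omega) (by omega) (ξ c) (ξ b) h⟩
  refine ⟨hconn, fun i j hi₁ hi₂ hij b => ?_, fun i j hi₁ hi₂ hij b => ?_, hwt_inside,
    hwt_outside⟩
  all_goals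
    ext c
    obtain ⟨c, rfl⟩ := hinv.surjective c
    simp only [Option.map_eq_some_iff, hinv.injective.eq_iff, exists_eq_right]
  · rw [← hC.f_iff_e, hf_iff i j hi₁ hi₂ hij, hinv, hinv]
  · rw [hf_iff i j hi₁ hi₂ hij, hinv, hinv, hC.f_iff_e]

namespace IsSchutzenberger

variable {ξ ξ' : B → B}

theorem apply_apply (h : IsSchutzenberger C p q ξ) (h' : IsSchutzenberger C p q ξ')
    (hC : IsCrystal C) (hU : UniqueHighest C p q) (hq : q ≤ k - 1) (b : B) :
    ξ (ξ' b) = b := by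
  refine hU.eq_self_of_commute (g := fun b => ξ (ξ' b)) hC
    (fun b => .trans _ _ _ (h'.connected b) (h.connected _)) (fun i hi₁ hi₂ b => ?_) b
  obtain ⟨j, hj₁, hj₂, hij⟩ := exists_reflected_node hq hi₁ hi₂
  rw [h.e_comm i j hi₁ hi₂ hij, h'.f_comm j i hj₁ hj₂ (by omega), Option.map_map]
  rfl

theorem involutive (h : IsSchutzenberger C p q ξ) (hC : IsCrystal C)
    (hU : UniqueHighest C p q) (hq : q ≤ k - 1) : Function.Involutive ξ :=
  h.apply_apply h hC hU hq

theorem unique (h : IsSchutzenberger C p q ξ) (h' : IsSchutzenberger C p q ξ')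
    (hC : IsCrystal C) (hU : UniqueHighest C p q) (hq : q ≤ k - 1) : ξ = ξ' :=
  funext fun b => by
    rw [← h.apply_apply h' hC hU hq b, h.involutive hC hU hq, h.apply_apply h' hC hU hq]

theorem partialXi_eq (h : IsSchutzenberger C p q ξ) (hC : IsCrystal C)
    (hU : UniqueHighest C p q) (hq : q ≤ k - 1) : partialXi C p q = ξ := by
  have hex : ∃ ξ, IsSchutzenberger C p q ξ := ⟨ξ, h⟩
  rw [partialXi, dif_pos hex]
  exact hex.choose_spec.unique h hC hU hq

theorem partialXi (h : IsSchutzenberger C p q ξ) :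
    IsSchutzenberger C p q (GLCrystal.partialXi C p q) := by
  have hex : ∃ ξ, IsSchutzenberger C p q ξ := ⟨ξ, h⟩
  rw [GLCrystal.partialXi, dif_pos hex]
  exact hex.choose_spec

theorem existsUnique (h : IsSchutzenberger C p q ξ) (hC : IsCrystal C)
    (hU : UniqueHighest C p q) (hq : q ≤ k - 1) : ∃! ξ, IsSchutzenberger C p q ξ :=
  ⟨ξ, h, fun _ h' => h'.unique h hC hU hq⟩

theorem connected_map_map {p' q' p'' q'' : ℕ} (h : IsSchutzenberger C p q ξ) (hC : IsCrystal C)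
    (hq : q ≤ k - 1) (h₁ : p ≤ p') (h₂ : q' ≤ q) (h₃ : p' + q'' = p + q)
    (h₄ : q' + p'' = p + q) {b c : B} (hbc : Connected C p' q' b c) :
    Connected C p'' q'' (ξ b) (ξ c) := by
  refine eqvGen_lift ?_ hbc
  rintro b c ⟨i, hi₁, hi₂, hi⟩
  obtain ⟨j, hj₁, hj₂, hij⟩ := exists_reflected_node hq (h₁.trans hi₁) (hi₂.trans_le h₂)
  refine .symm _ _ (.rel _ _ ⟨j, by omega, by omega, ?_⟩)
  rw [hC.f_iff_e, h.e_comm j i hj₁ hj₂ (by omega), hi, Option.map_some]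

theorem conj {p' q' p'' q'' : ℕ} {η : B → B} (h : IsSchutzenberger C p q ξ)
    (h' : IsSchutzenberger C p' q' η) (hC : IsCrystal C) (hU : UniqueHighest C p q)
    (hq : q ≤ k - 1) (h₁ : p ≤ p') (h₂ : q' ≤ q) (h₃ : p' + q'' = p + q)
    (h₄ : q' + p'' = p + q) (h₅ : p' ≤ q') :
    IsSchutzenberger C p'' q'' (fun b => ξ (η (ξ b))) where
  connected b := by
    have := h.connected_map_map hC hq h₁ h₂ h₃ h₄ (h'.connected (ξ b))
    rwa [h.involutive hC hU hq] at this
  e_comm i j hi₁ hi₂ hij b := by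
    obtain ⟨i', hi'₁, hi'₂, hii'⟩ :=
      exists_reflected_node hq (p := p) (i := i) (by omega) (by omega)
    obtain ⟨j', hj'₁, hj'₂, hjj'⟩ :=
      exists_reflected_node hq (p := p) (i := j) (by omega) (by omega)
    rw [h.e_comm i i' (by omega) (by omega) hii', h'.f_comm i' j' (by omega) (by omega) (by omega),
      h.e_comm j' j (by omega) (by omega) (by omega), Option.map_map, Option.map_map]
    rfl
  f_comm i j hi₁ hi₂ hij b := by
    obtain ⟨i', hi'₁, hi'₂, hii'⟩ :=
      exists_reflected_node hq (p := p) (i := i) (by omega) (by omega)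
    obtain ⟨j', hj'₁, hj'₂, hjj'⟩ :=
      exists_reflected_node hq (p := p) (i := j) (by omega) (by omega)
    rw [h.f_comm i i' (by omega) (by omega) hii', h'.e_comm i' j' (by omega) (by omega) (by omega),
      h.f_comm j' j (by omega) (by omega) (by omega), Option.map_map, Option.map_map]
    rfl
  wt_inside x y hx₁ hx₂ hxy b := by
    rw [h.wt_inside x ⟨p + q - x.1, by omega⟩ (by omega) (by omega) (by simp only; omega),
      h'.wt_inside _ ⟨p + q - y.1, by omega⟩ (by simp only; omega) (by simp only; omega)
        (by simp only; omega),
      h.wt_inside _ y (by simp only; omega) (by simp only; omega) (by simp only; omega)]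
  wt_outside x hx b := by
    by_cases hx' : p ≤ x.1 ∧ x.1 ≤ q
    · rw [h.wt_inside x ⟨p + q - x.1, by omega⟩ (by omega) (by omega) (by simp only; omega),
        h'.wt_outside _ (by simp only; omega),
        h.wt_inside _ x (by simp only; omega) (by simp only; omega) (by simp only; omega)]
    · rw [h.wt_outside x (by omega), h'.wt_outside x (by omega), h.wt_outside x (by omega)]

end IsSchutzenberger

end Crystals

section StrictMorphisms

variable {k : ℕ} {A B : Type*} {C : CrystalData k A} {D : CrystalData k B} {r : A → B} {p q : ℕ}

/-- A strict morphism of crystals: a map commuting with all structure maps, including the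
undefined values of the Kashiwara operators. -/
structure IsStrictMorphism (C : CrystalData k A) (D : CrystalData k B) (r : A → B) : Prop where
  wt : ∀ a, D.wt (r a) = C.wt a
  eps : ∀ i a, D.eps i (r a) = C.eps i a
  phi : ∀ i a, D.phi i (r a) = C.phi i a
  e : ∀ i a, D.e i (r a) = (C.e i a).map r
  f : ∀ i a, D.f i (r a) = (C.f i a).map r

theorem IsCrystalIso.isStrictMorphism {F : A ≃ B} (h : IsCrystalIso C D F) :
    IsStrictMorphism C D F :=
  ⟨h.wt, h.eps, h.phi, h.e, h.f⟩

theorem isCrystalIso_of_e (hC : IsCrystal C) (hD : IsCrystal D) {F : A ≃ B}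
    (hwt : ∀ a, D.wt (F a) = C.wt a) (he : ∀ i a, D.e i (F a) = (C.e i a).map F) :
    IsCrystalIso C D F := by
  have hf : ∀ i a, D.f i (F a) = (C.f i a).map F := by
    intro i a
    ext y
    obtain ⟨c, rfl⟩ := F.surjective y
    rw [hD.f_iff_e, he, Option.map_eq_some_iff, Option.map_eq_some_iff]
    simp only [EmbeddingLike.apply_eq_iff_eq, exists_eq_right, hC.f_iff_e]
  refine ⟨hwt, fun i a => ?_, fun i a => ?_, he, hf⟩
  · have hmax := hD.eps_max i (F a)
    simp only [iterate_bind_apply_ne_none_iff (he i)] at hmax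
    exact hmax.unique (hC.eps_max i a)
  · have hmax := hD.phi_max i (F a)
    simp only [iterate_bind_apply_ne_none_iff (hf i)] at hmax
    exact hmax.unique (hC.phi_max i a)

namespace IsStrictMorphism

theorem connected_map (h : IsStrictMorphism C D r) {a a' : A} (ha : Connected C p q a a') :
    Connected D p q (r a) (r a') := by
  refine eqvGen_lift ?_ ha
  rintro a a' ⟨i, hi₁, hi₂, hi⟩
  exact .rel _ _ ⟨i, hi₁, hi₂, by rw [h.f, hi, Option.map_some]⟩

theorem exists_of_e_eq_some (h : IsStrictMorphism C D r) {i : Fin (k - 1)} {a : A} {y : B}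
    (hy : D.e i (r a) = some y) : ∃ a', C.e i a = some a' ∧ r a' = y := by
  rwa [h.e, Option.map_eq_some_iff] at hy

theorem exists_of_f_eq_some (h : IsStrictMorphism C D r) {i : Fin (k - 1)} {a : A} {y : B}
    (hy : D.f i (r a) = some y) : ∃ a', C.f i a = some a' ∧ r a' = y := by
  rwa [h.f, Option.map_eq_some_iff] at hy

theorem exists_connected_and_of_connected (h : IsStrictMorphism C D r) (hC : IsCrystal C)
    (hD : IsCrystal D) {x y : B} (hxy : Connected D p q x y) :
    (∀ a, r a = x → ∃ a', r a' = y ∧ Connected C p q a a') ∧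
      (∀ a, r a = y → ∃ a', r a' = x ∧ Connected C p q a a') := by
  induction hxy with
  | refl x => exact ⟨fun a ha => ⟨a, ha, .refl _⟩, fun a ha => ⟨a, ha, .refl _⟩⟩
  | symm x y _ ih => exact ih.symm
  | trans x y z _ _ ih₁ ih₂ =>
    constructor
    · intro a ha
      obtain ⟨a', ha', h₁⟩ := ih₁.1 a ha
      obtain ⟨a'', ha'', h₂⟩ := ih₂.1 a' ha'
      exact ⟨a'', ha'', h₁.trans _ _ _ h₂⟩
    · intro a ha
      obtain ⟨a', ha', h₁⟩ := ih₂.2 a ha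
      obtain ⟨a'', ha'', h₂⟩ := ih₁.2 a' ha'
      exact ⟨a'', ha'', h₁.trans _ _ _ h₂⟩
  | rel x y hxy =>
    obtain ⟨i, hi₁, hi₂, hi⟩ := hxy
    constructor
    · rintro a rfl
      obtain ⟨a', ha', rfl⟩ := h.exists_of_f_eq_some hi
      exact ⟨a', rfl, .rel _ _ ⟨i, hi₁, hi₂, ha'⟩⟩
    · rintro a rfl
      obtain ⟨a', ha', rfl⟩ := h.exists_of_e_eq_some ((hD.f_iff_e _ _ _).1 hi)
      exact ⟨a', rfl, .symm _ _ (.rel _ _ ⟨i, hi₁, hi₂, (hC.f_iff_e _ _ _).2 ha'⟩)⟩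

theorem exists_connected (h : IsStrictMorphism C D r) (hC : IsCrystal C) (hD : IsCrystal D)
    {a : A} {y : B} (hay : Connected D p q (r a) y) : ∃ a', r a' = y ∧ Connected C p q a a' :=
  (h.exists_connected_and_of_connected hC hD hay).1 a rfl

theorem isHighestWeight (h : IsStrictMorphism C D r) {a : A} (ha : IsHighestWeight C p q a) :
    IsHighestWeight D p q (r a) := fun i hi₁ hi₂ => by
  rw [h.e, ha i hi₁ hi₂, Option.map_none]

theorem isCrystal_of_injective (h : IsStrictMorphism C D r) (hr : Function.Injective r)
    (hD : IsCrystal D) : IsCrystal C where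
  finite := have := hD.finite; Finite.of_injective r hr
  f_iff_e i a a' := by
    have := hD.f_iff_e i (r a) (r a')
    rwa [h.f, h.e, ← Option.map_some, ← Option.map_some, (Option.map_injective hr).eq_iff,
      (Option.map_injective hr).eq_iff] at this
  wt_e i a a' ha := by rw [← h.wt, ← h.wt, hD.wt_e i (r a) (r a') (by rw [h.e, ha]; rfl)]
  wt_f i a a' ha := by rw [← h.wt, ← h.wt, hD.wt_f i (r a) (r a') (by rw [h.f, ha]; rfl)]
  eps_max i a := by
    have hmax := hD.eps_max i (r a)
    simp only [iterate_bind_apply_ne_none_iff (h.e i)] at hmax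
    rwa [h.eps] at hmax
  phi_max i a := by
    have hmax := hD.phi_max i (r a)
    simp only [iterate_bind_apply_ne_none_iff (h.f i)] at hmax
    rwa [h.phi] at hmax
  phi_sub_eps i a := by rw [← h.phi, ← h.eps, ← h.wt, hD.phi_sub_eps]

theorem uniqueHighest_of_injective (h : IsStrictMorphism C D r) (hr : Function.Injective r)
    (hU : UniqueHighest D p q) : UniqueHighest C p q := fun _ _ hab ha hb =>
  hr (hU _ _ (h.connected_map hab) (h.isHighestWeight ha) (h.isHighestWeight hb))

theorem isSchutzenberger_of_injective (h : IsStrictMorphism C D r) (hr : Function.Injective r)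
    (hD : IsCrystal D) {ζ : B → B} (hζ : IsSchutzenberger D p q ζ) {ξ : A → A}
    (hξ : ∀ a, r (ξ a) = ζ (r a)) : IsSchutzenberger C p q ξ where
  connected a := by
    obtain ⟨a', ha', hc⟩ :=
      h.exists_connected (h.isCrystal_of_injective hr hD) hD (hζ.connected (r a))
    rwa [hr (ha'.trans (hξ a).symm)] at hc
  e_comm i j hi₁ hi₂ hij a := by
    apply Option.map_injective hr
    rw [← h.e, hξ, hζ.e_comm i j hi₁ hi₂ hij, h.f, Option.map_map, Option.map_map]
    exact congrArg (Option.map · _) (funext fun a => (hξ a).symm)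
  f_comm i j hi₁ hi₂ hij a := by
    apply Option.map_injective hr
    rw [← h.f, hξ, hζ.f_comm i j hi₁ hi₂ hij, h.e, Option.map_map, Option.map_map]
    exact congrArg (Option.map · _) (funext fun a => (hξ a).symm)
  wt_inside x y hx₁ hx₂ hxy a := by
    rw [← h.wt, ← h.wt, hξ, hζ.wt_inside x y hx₁ hx₂ hxy]
  wt_outside x hx a := by rw [← h.wt, ← h.wt, hξ, hζ.wt_outside x hx]

theorem exists_isSchutzenberger_of_injective (h : IsStrictMorphism C D r)
    (hr : Function.Injective r) (hD : IsCrystal D) {ζ : B → B} (hζ : IsSchutzenberger D p q ζ) :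
    ∃ ξ : A → A, (∀ a, r (ξ a) = ζ (r a)) ∧ IsSchutzenberger C p q ξ := by
  have hmem : ∀ a, ∃ a', r a' = ζ (r a) := fun a => by
    obtain ⟨a', ha', _⟩ :=
      h.exists_connected (h.isCrystal_of_injective hr hD) hD (hζ.connected (r a))
    exact ⟨a', ha'⟩
  choose ξ hξ using hmem
  exact ⟨ξ, hξ, h.isSchutzenberger_of_injective hr hD hζ hξ⟩

end IsStrictMorphism

end StrictMorphisms

section Covers

variable {k : ℕ} {B ι : Type*} {A : ι → Type*} {C : ∀ s, CrystalData k (A s)}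
  {D : CrystalData k B} {r : ∀ s, A s → B} {p q : ℕ}

theorem isCrystal_of_cover [Finite B] (hC : ∀ s, IsCrystal (C s))
    (hr : ∀ s, IsStrictMorphism (C s) D (r s)) (hcov : ∀ b, ∃ s a, r s a = b) :
    IsCrystal D where
  finite := inferInstance
  f_iff_e i b c := by
    constructor
    · obtain ⟨s, a, rfl⟩ := hcov b
      intro h
      obtain ⟨a', ha', rfl⟩ := (hr s).exists_of_f_eq_some h
      rw [(hr s).e, ((hC s).f_iff_e i a a').1 ha', Option.map_some]
    · obtain ⟨s, a, rfl⟩ := hcov c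
      intro h
      obtain ⟨a', ha', rfl⟩ := (hr s).exists_of_e_eq_some h
      rw [(hr s).f, ((hC s).f_iff_e i a' a).2 ha', Option.map_some]
  wt_e i b c h := by
    obtain ⟨s, a, rfl⟩ := hcov b
    obtain ⟨a', ha', rfl⟩ := (hr s).exists_of_e_eq_some h
    rw [(hr s).wt, (hr s).wt, (hC s).wt_e i a a' ha']
  wt_f i b c h := by
    obtain ⟨s, a, rfl⟩ := hcov b
    obtain ⟨a', ha', rfl⟩ := (hr s).exists_of_f_eq_some h
    rw [(hr s).wt, (hr s).wt, (hC s).wt_f i a a' ha']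
  eps_max i b := by
    obtain ⟨s, a, rfl⟩ := hcov b
    simp only [iterate_bind_apply_ne_none_iff ((hr s).e i), (hr s).eps]
    exact (hC s).eps_max i a
  phi_max i b := by
    obtain ⟨s, a, rfl⟩ := hcov b
    simp only [iterate_bind_apply_ne_none_iff ((hr s).f i), (hr s).phi]
    exact (hC s).phi_max i a
  phi_sub_eps i b := by
    obtain ⟨s, a, rfl⟩ := hcov b
    rw [(hr s).phi, (hr s).eps, (hr s).wt, (hC s).phi_sub_eps]

theorem isSchutzenberger_of_cover (hr : ∀ s, IsStrictMorphism (C s) D (r s))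
    (hcov : ∀ b, ∃ s a, r s a = b) {ξ : ∀ s, A s → A s} {ζ : B → B}
    (hζ : ∀ s a, ζ (r s a) = r s (ξ s a)) (hξ : ∀ s, IsSchutzenberger (C s) p q (ξ s)) :
    IsSchutzenberger D p q ζ where
  connected b := by
    obtain ⟨s, a, rfl⟩ := hcov b
    rw [hζ]
    exact (hr s).connected_map ((hξ s).connected a)
  e_comm i j hi₁ hi₂ hij b := by
    obtain ⟨s, a, rfl⟩ := hcov b
    rw [hζ, (hr s).e, (hξ s).e_comm i j hi₁ hi₂ hij, (hr s).f, Option.map_map, Option.map_map]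
    exact congrArg (Option.map · _) (funext fun a => (hζ s a).symm)
  f_comm i j hi₁ hi₂ hij b := by
    obtain ⟨s, a, rfl⟩ := hcov b
    rw [hζ, (hr s).f, (hξ s).f_comm i j hi₁ hi₂ hij, (hr s).e, Option.map_map, Option.map_map]
    exact congrArg (Option.map · _) (funext fun a => (hζ s a).symm)
  wt_inside x y hx₁ hx₂ hxy b := by
    obtain ⟨s, a, rfl⟩ := hcov b
    rw [hζ, (hr s).wt, (hr s).wt, (hξ s).wt_inside x y hx₁ hx₂ hxy]
  wt_outside x hx b := by
    obtain ⟨s, a, rfl⟩ := hcov b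
    rw [hζ, (hr s).wt, (hr s).wt, (hξ s).wt_outside x hx]

end Covers

section Subcrystals

variable {k : ℕ} {A B : Type*} {C : CrystalData k B} {r : A → B}

open Classical in
theorem bind_preimage_eq_some_iff (hr : Function.Injective r) {x : Option B} {a : A} :
    (x.bind fun y => if h : ∃ a', r a' = y then some h.choose else none) = some a ↔
      x = some (r a) := by
  rw [Option.bind_eq_some_iff]
  constructor
  · rintro ⟨y, rfl, h⟩
    split_ifs at h with hex
    cases h
    rw [hex.choose_spec]
  · rintro rfl
    have hex : ∃ a', r a' = r a := ⟨a, rfl⟩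
    exact ⟨r a, rfl, by rw [dif_pos hex, hr hex.choose_spec]⟩

theorem pullback_e_iff (C : CrystalData k B) (hr : Function.Injective r) (i : Fin (k - 1))
    (a a' : A) : (pullback C r).e i a = some a' ↔ C.e i (r a) = some (r a') :=
  bind_preimage_eq_some_iff hr

theorem pullback_f_iff (C : CrystalData k B) (hr : Function.Injective r) (i : Fin (k - 1))
    (a a' : A) : (pullback C r).f i a = some a' ↔ C.f i (r a) = some (r a') :=
  bind_preimage_eq_some_iff hr

theorem isStrictMorphism_pullback (hr : Function.Injective r)
    (he : ∀ i a x, C.e i (r a) = some x → x ∈ Set.range r)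
    (hf : ∀ i a x, C.f i (r a) = some x → x ∈ Set.range r) :
    IsStrictMorphism (pullback C r) C r where
  wt _ := rfl
  eps _ _ := rfl
  phi _ _ := rfl
  e i a := by
    ext x
    rw [Option.map_eq_some_iff]
    constructor
    · intro hx
      obtain ⟨a', rfl⟩ := he i a x hx
      exact ⟨a', (pullback_e_iff C hr i a a').2 hx, rfl⟩
    · rintro ⟨a', ha', rfl⟩
      exact (pullback_e_iff C hr i a a').1 ha'
  f i a := by
    ext x
    rw [Option.map_eq_some_iff]
    constructor
    · intro hx
      obtain ⟨a', rfl⟩ := hf i a x hx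
      exact ⟨a', (pullback_f_iff C hr i a a').2 hx, rfl⟩
    · rintro ⟨a', ha', rfl⟩
      exact (pullback_f_iff C hr i a a').1 ha'

end Subcrystals

/-! ## Lowering operators on 0/1-matrices -/

section Extrema

variable {f g : ℕ → ℤ} {d s s' a : ℕ}

/-- `s` is the last position at which `f` attains its maximum over `{0, …, d}`. -/
structure IsLastMax (f : ℕ → ℤ) (d s : ℕ) : Prop where
  le_right : s ≤ d
  le : ∀ t ≤ d, f t ≤ f s
  lt : ∀ t ≤ d, s < t → f t < f s

/-- `s` is the first position at which `f` attains its maximum over `{0, …, d}`. -/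
structure IsFirstMax (f : ℕ → ℤ) (d s : ℕ) : Prop where
  le_right : s ≤ d
  le : ∀ t ≤ d, f t ≤ f s
  lt : ∀ t < s, f t < f s

theorem IsLastMax.unique (h : IsLastMax f d s) (h' : IsLastMax f d s') : s = s' := by
  rcases lt_trichotomy s s' with hs | hs | hs
  · exact absurd (h.lt s' h'.le_right hs) (h'.le s h.le_right).not_gt
  · exact hs
  · exact absurd (h'.lt s h.le_right hs) (h.le s' h'.le_right).not_gt

theorem IsFirstMax.reflect (h : IsFirstMax f d s) {c : ℤ} (hg : ∀ t ≤ d, g t = f (d - t) - c) :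
    IsLastMax g d (d - s) := by
  have hs : g (d - s) = f s - c := by
    rw [hg _ (Nat.sub_le d s), Nat.sub_sub_self h.le_right]
  refine ⟨Nat.sub_le d s, fun t ht => ?_, fun t ht hst => ?_⟩
  · have := h.le (d - t) (Nat.sub_le d t)
    rw [hg t ht, hs]; omega
  · have := h.lt (d - t) (by omega)
    rw [hg t ht, hs]; omega

theorem exists_isLastMax (f : ℕ → ℤ) (d : ℕ) : ∃ s, IsLastMax f d s := by
  induction d with
  | zero => exact ⟨0, by grind [IsLastMax]⟩
  | succ d ih =>
    obtain ⟨s, hs⟩ := ih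
    rcases le_or_gt (f s) (f (d + 1)) with h | h
    · exact ⟨d + 1, by grind [IsLastMax]⟩
    · exact ⟨s, by grind [IsLastMax]⟩

theorem find?_eq_some_iff_of_pairwise {α : Type*} {r : α → α → Prop} [Std.Asymm r] {l : List α}
    (hl : l.Pairwise r) {P : α → Bool} {x : α} :
    l.find? P = some x ↔ x ∈ l ∧ P x = true ∧ ∀ y ∈ l, r y x → P y = false := by
  induction l with
  | nil => simp
  | cons y l ih =>
    have hasymm : ∀ x y, r x y → ¬ r y x := Std.Asymm.asymm
    rw [List.pairwise_cons] at hl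
    specialize ih hl.2
    cases hy : P y <;> grind

theorem find?_finRange_eq_some_iff {P : Fin d → Bool} {x : Fin d} :
    (List.finRange d).find? P = some x ↔ P x = true ∧ ∀ y < x, P y = false := by
  simp [find?_eq_some_iff_of_pairwise (List.pairwise_lt_finRange d)]

theorem find?_finRange_reverse_eq_some_iff {P : Fin d → Bool} {x : Fin d} :
    (List.finRange d).reverse.find? P = some x ↔ P x = true ∧ ∀ y, x < y → P y = false := by
  simp [find?_eq_some_iff_of_pairwise (r := (· > ·))
    (List.pairwise_reverse.2 (List.pairwise_lt_finRange d))]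

end Extrema

/-- Elements of the tensor power `V_k^{⊗ d}`: 0/1-matrices with `d` rows and `k` columns. -/
abbrev Mat (d k : ℕ) : Type := Fin d → Fin k → Bool

variable {d k : ℕ}

theorem toInt_injective : Function.Injective Bool.toInt := by decide

theorem toInt_eq_ite (b : Bool) : b.toInt = if b then 1 else 0 := by cases b <;> rfl

theorem fstIdx_ne_sndIdx (i : Fin (k - 1)) : fstIdx i ≠ sndIdx i := by
  simp [fstIdx, sndIdx, Fin.ext_iff]

theorem root_apply (i : Fin (k - 1)) (x : Fin k) :
    root i x = (if x = fstIdx i then 1 else 0) - if x = sndIdx i then 1 else 0 := by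
  simp [root, Pi.single_apply]

theorem vecCrystal_f_iff {i : Fin (k - 1)} {v w : Fin k → Bool} :
    (vecCrystal k).f i v = some w ↔ ∀ x, (w x).toInt = (v x).toInt - root i x := by
  have hne := fstIdx_ne_sndIdx i
  simp only [vecCrystal, root_apply]
  constructor
  · intro h
    split_ifs at h with hv
    obtain rfl := Option.some_inj.1 h
    intro x
    rcases eq_or_ne x (sndIdx i) with rfl | h₂
    · simp [hv.2, hne.symm]
    · rcases eq_or_ne x (fstIdx i) with rfl | h₁
      · simp [hv.1, hne]
      · simp [h₁, h₂]
  · intro h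
    have h₁ : w (fstIdx i) = false ∧ v (fstIdx i) = true := by
      have := h (fstIdx i)
      cases hw : w (fstIdx i) <;> cases hv : v (fstIdx i) <;> simp [hw, hv, hne] at this ⊢
    have h₂ : w (sndIdx i) = true ∧ v (sndIdx i) = false := by
      have := h (sndIdx i)
      cases hw : w (sndIdx i) <;> cases hv : v (sndIdx i) <;> simp [hw, hv, hne.symm] at this ⊢
    rw [if_pos ⟨h₁.2, h₂.2⟩, Option.some_inj]
    funext x
    rcases eq_or_ne x (sndIdx i) with rfl | hx₂
    · simp [h₂.1]
    · rcases eq_or_ne x (fstIdx i) with rfl | hx₁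
      · simp [h₁.1, hne]
      · exact toInt_injective (by simp [h x, hx₁, hx₂])

theorem vecCrystal_e_iff {i : Fin (k - 1)} {v w : Fin k → Bool} :
    (vecCrystal k).e i v = some w ↔ (vecCrystal k).f i w = some v := by
  have hne := fstIdx_ne_sndIdx i
  simp only [vecCrystal, Option.ite_none_right_eq_some, Option.some_inj]
  constructor <;> rintro ⟨⟨h₁, h₂⟩, rfl⟩ <;> refine ⟨by simp [hne], ?_⟩ <;> funext x <;>
    grind [Function.update_apply]

/-- The number of ones in column `x` in the first `t` rows. -/
def colCount (b : Mat d k) (x : Fin k) (t : ℕ) : ℤ := ∑ s : Fin d with s.1 < t, (b s x).toInt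

/-- The function of `t ∈ {0, …, d}` whose last and first maximum positions determine the rows in
which `f_i` and `e_i` act. -/
def height (b : Mat d k) (i : Fin (k - 1)) (t : ℕ) : ℤ :=
  colCount b (sndIdx i) t - colCount b (fstIdx i) t

@[simp] theorem colCount_zero (b : Mat d k) (x : Fin k) : colCount b x 0 = 0 := by simp [colCount]

theorem colCount_succ (b : Mat d k) (x : Fin k) (s : Fin d) :
    colCount b x (s.1 + 1) = colCount b x s.1 + (b s x).toInt := by
  have : Finset.univ.filter (fun r : Fin d => r.1 < s.1 + 1) =
      insert s (Finset.univ.filter fun r : Fin d => r.1 < s.1) := by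
    ext r; simp [Fin.ext_iff]; omega
  rw [colCount, this, Finset.sum_insert (by simp), add_comm, colCount]

theorem colCount_eq_sum (b : Mat d k) (x : Fin k) : colCount b x d = ∑ s, (b s x).toInt := by
  simp [colCount]

theorem colCount_congr {b b' : Mat d k} {x : Fin k} {t : ℕ}
    (h : ∀ s : Fin d, s.1 < t → b s x = b' s x) : colCount b x t = colCount b' x t :=
  Finset.sum_congr rfl fun s hs => by rw [h s (by simpa using hs)]

@[simp] theorem height_zero (b : Mat d k) (i : Fin (k - 1)) : height b i 0 = 0 := by simp [height]

theorem height_succ (b : Mat d k) (i : Fin (k - 1)) (s : Fin d) :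
    height b i (s.1 + 1) =
      height b i s.1 + (b s (sndIdx i)).toInt - (b s (fstIdx i)).toInt := by
  simp only [height, colCount_succ]; ring

theorem IsLastMax.entries {b : Mat d k} {i : Fin (k - 1)} {s : Fin d}
    (h : IsLastMax (height b i) d s) : b s (fstIdx i) = true ∧ b s (sndIdx i) = false := by
  have := h.lt (s.1 + 1) s.2 (Nat.lt_succ_self _)
  rw [height_succ] at this
  cases hx : b s (fstIdx i) <;> cases hy : b s (sndIdx i) <;> simp [hx, hy] at this ⊢

theorem IsFirstMax.entries {b : Mat d k} {i : Fin (k - 1)} {s : Fin d}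
    (h : IsFirstMax (height b i) d (s + 1)) :
    b s (fstIdx i) = false ∧ b s (sndIdx i) = true := by
  have := h.lt s.1 (Nat.lt_succ_self _)
  rw [height_succ] at this
  cases hx : b s (fstIdx i) <;> cases hy : b s (sndIdx i) <;> simp [hx, hy] at this ⊢
  omega

/-- The lowering operator `f_i` sends `b` to `b'` by moving a one in row `s`. -/
structure LowerAt (i : Fin (k - 1)) (s : Fin d) (b b' : Mat d k) : Prop where
  toInt_eq : ∀ r x, (b' r x).toInt = (b r x).toInt - if r = s then root i x else 0
  isLastMax : IsLastMax (height b i) d s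

/-- The lowering operator `f_i` sends `b` to `b'`. -/
def Lower (i : Fin (k - 1)) (b b' : Mat d k) : Prop := ∃ s, LowerAt i s b b'

theorem colCount_of_toInt_eq {i : Fin (k - 1)} {s : Fin d} {b b' : Mat d k}
    (h : ∀ r x, (b' r x).toInt = (b r x).toInt - if r = s then root i x else 0) (x : Fin k)
    (t : ℕ) : colCount b' x t = colCount b x t - if s.1 < t then root i x else 0 := by
  simp only [colCount, h, Finset.sum_sub_distrib, Finset.sum_ite_eq', Finset.mem_filter,
    Finset.mem_univ, true_and]

theorem height_of_toInt_eq {i : Fin (k - 1)} {s : Fin d} {b b' : Mat d k}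
    (h : ∀ r x, (b' r x).toInt = (b r x).toInt - if r = s then root i x else 0) (t : ℕ) :
    height b' i t = height b i t + if s.1 < t then 2 else 0 := by
  have hne := fstIdx_ne_sndIdx i
  simp only [height, colCount_of_toInt_eq h, root_apply, hne, hne.symm, if_true, if_false]
  split_ifs <;> ring

theorem Lower.colCount_right {i : Fin (k - 1)} {b b' : Mat d k} (h : Lower i b b') (x : Fin k) :
    colCount b' x d = colCount b x d - root i x := by
  obtain ⟨s, h⟩ := h
  rw [colCount_of_toInt_eq h.toInt_eq, if_pos s.2]

namespace LowerAt

variable {i : Fin (k - 1)} {s : Fin d} {b b' : Mat d k}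

theorem height_right (h : LowerAt i s b b') (t : ℕ) :
    height b' i t = height b i t + if s.1 < t then 2 else 0 :=
  height_of_toInt_eq h.toInt_eq t

theorem height_succ_right (h : LowerAt i s b b') :
    height b' i (s.1 + 1) = height b i s.1 + 1 := by
  rw [h.height_right, height_succ, h.isLastMax.entries.1, h.isLastMax.entries.2,
    if_pos (Nat.lt_succ_self _)]
  simp only [Bool.toInt_true, Bool.toInt_false]; ring

theorem isFirstMax (h : LowerAt i s b b') : IsFirstMax (height b' i) d (s + 1) := by
  refine ⟨s.2, fun t ht => ?_, fun t ht => ?_⟩ <;> rw [h.height_succ_right, h.height_right]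
  · have := h.isLastMax.le t ht
    have := h.isLastMax.lt t ht
    split_ifs <;> omega
  · have := h.isLastMax.le t (by omega)
    rw [if_neg (by omega)]; omega

theorem of_isFirstMax
    (h : ∀ r x, (b' r x).toInt = (b r x).toInt - if r = s then root i x else 0)
    (h' : IsFirstMax (height b' i) d (s + 1)) : LowerAt i s b b' := by
  have hsucc : height b' i (s.1 + 1) = height b' i s.1 + 1 := by
    rw [height_succ, h'.entries.1, h'.entries.2]
    simp only [Bool.toInt_true, Bool.toInt_false]; ring
  refine ⟨h, s.2.le, fun t ht => ?_, fun t ht hst => ?_⟩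
  · have := h'.le t ht
    have := h'.lt t
    grind [height_of_toInt_eq h t, height_of_toInt_eq h s.1]
  · have := h'.le t ht
    grind [height_of_toInt_eq h t, height_of_toInt_eq h s.1]

end LowerAt

theorem Lower.unique_right {i : Fin (k - 1)} {b b' b'' : Mat d k} (h : Lower i b b')
    (h' : Lower i b b'') : b' = b'' := by
  obtain ⟨s, h⟩ := h
  obtain ⟨s', h'⟩ := h'
  obtain rfl : s = s' := Fin.ext (h.isLastMax.unique h'.isLastMax)
  funext r x
  exact toInt_injective (by rw [h.toInt_eq, h'.toInt_eq])

theorem toInt_eq_iff_f_update {i : Fin (k - 1)} {s : Fin d} {b b' : Mat d k} :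
    (∀ r x, (b' r x).toInt = (b r x).toInt - if r = s then root i x else 0) ↔
      ∃ w, (vecCrystal k).f i (b s) = some w ∧ Function.update b s w = b' := by
  simp only [vecCrystal_f_iff]
  constructor
  · refine fun h => ⟨b' s, fun x => by rw [h, if_pos rfl], ?_⟩
    funext r x
    by_cases hr : r = s
    · rw [hr, Function.update_self]
    · exact toInt_injective (by rw [Function.update_of_ne hr, h, if_neg hr, sub_zero])
  · rintro ⟨w, hw, rfl⟩ r x
    by_cases hr : r = s
    · rw [hr, Function.update_self, if_pos rfl, hw]
    · rw [Function.update_of_ne hr, if_neg hr, sub_zero]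

theorem toInt_eq_iff_e_update {i : Fin (k - 1)} {s : Fin d} {b b' : Mat d k} :
    (∀ r x, (b r x).toInt = (b' r x).toInt - if r = s then root i x else 0) ↔
      ∃ w, (vecCrystal k).e i (b s) = some w ∧ Function.update b s w = b' := by
  rw [toInt_eq_iff_f_update]
  constructor <;> rintro ⟨w, hw, rfl⟩
  · exact ⟨b' s, by rwa [Function.update_self, vecCrystal_e_iff], by simp⟩
  · exact ⟨b s, by rwa [Function.update_self, ← vecCrystal_e_iff], by simp⟩

theorem exists_lower_of_lt {i : Fin (k - 1)} {b : Mat d k} {t : ℕ} (ht : t ≤ d)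
    (h : height b i d < height b i t) : ∃ b', Lower i b b' := by
  obtain ⟨s, hs⟩ := exists_isLastMax (height b i) d
  have hsd : s < d := hs.le_right.lt_of_ne fun hsd => absurd (hs.le t ht) (hsd ▸ h.not_ge)
  have hs' : IsLastMax (height b i) d (⟨s, hsd⟩ : Fin d) := hs
  have hf : (vecCrystal k).f i (b ⟨s, hsd⟩) = some _ := if_pos hs'.entries
  exact ⟨_, _, toInt_eq_iff_f_update.2 ⟨_, hf, rfl⟩, hs'⟩

/-- The columns of a matrix from right to left, as rows (rotation by a right angle). -/
def quarterTurn (M : Mat d k) : Mat k d := fun j i => M i j.rev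

/-- Rotation by two right angles. -/
def halfTurn (M : Mat d k) : Mat d k := fun s x => M s.rev x.rev

theorem quarterTurn_quarterTurn (M : Mat d k) : quarterTurn (quarterTurn M) = halfTurn M := rfl

theorem quarterTurn_halfTurn (M : Mat d k) :
    quarterTurn (halfTurn M) = halfTurn (quarterTurn M) := rfl

@[simp] theorem halfTurn_halfTurn (M : Mat d k) : halfTurn (halfTurn M) = M := by
  funext s x; simp [halfTurn]

@[simp] theorem quarterTurn_quarterTurn_halfTurn (M : Mat d k) :
    quarterTurn (quarterTurn (halfTurn M)) = M := by
  rw [quarterTurn_quarterTurn, halfTurn_halfTurn]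

@[simp] theorem quarterTurn_halfTurn_quarterTurn (M : Mat d k) :
    quarterTurn (halfTurn (quarterTurn M)) = M := by
  rw [← quarterTurn_halfTurn, quarterTurn_quarterTurn_halfTurn]

theorem quarterTurn_injective : Function.Injective (quarterTurn : Mat d k → Mat k d) :=
  Function.LeftInverse.injective (g := fun M => quarterTurn (halfTurn M))
    quarterTurn_halfTurn_quarterTurn

theorem quarterTurn_surjective : Function.Surjective (quarterTurn : Mat d k → Mat k d) :=
  fun M => ⟨quarterTurn (halfTurn M), by simp⟩

theorem fstIdx_rev (i : Fin (k - 1)) : (fstIdx i).rev = sndIdx i.rev := by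
  ext; simp [fstIdx, sndIdx]; omega

theorem sndIdx_rev (i : Fin (k - 1)) : (sndIdx i).rev = fstIdx i.rev := by
  ext; simp [fstIdx, sndIdx]; omega

theorem root_rev (i : Fin (k - 1)) (x : Fin k) : root i.rev x = -root i x.rev := by
  simp only [root_apply, ← sndIdx_rev, ← fstIdx_rev, Fin.rev_eq_iff]; ring

theorem colCount_halfTurn (b : Mat d k) (x : Fin k) {t : ℕ} (ht : t ≤ d) :
    colCount (halfTurn b) x t = colCount b x.rev d - colCount b x.rev (d - t) := by
  induction t with
  | zero => simp
  | succ t ih =>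
    have h₁ := colCount_succ (halfTurn b) x ⟨t, ht⟩
    have h₂ := colCount_succ b x.rev (Fin.rev ⟨t, ht⟩)
    rw [Fin.val_rev, show d - (t + 1) + 1 = d - t by omega] at h₂
    rw [h₁, ih (by omega), h₂, halfTurn]; ring

theorem height_halfTurn (b : Mat d k) (i : Fin (k - 1)) {t : ℕ} (ht : t ≤ d) :
    height (halfTurn b) i t = height b i.rev (d - t) - height b i.rev d := by
  rw [height, height, height, colCount_halfTurn _ _ ht, colCount_halfTurn _ _ ht, fstIdx_rev,
    sndIdx_rev]
  ring

theorem LowerAt.halfTurn {i : Fin (k - 1)} {s : Fin d} {b b' : Mat d k}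
    (h : LowerAt i s b b') : LowerAt i.rev s.rev (halfTurn b') (halfTurn b) := by
  refine ⟨fun r x => ?_, ?_⟩
  · simp only [GLCrystal.halfTurn, h.toInt_eq, root_rev, Fin.rev_eq_iff]
    split_ifs <;> ring
  · rw [Fin.val_rev]
    exact h.isFirstMax.reflect fun t ht => by rw [height_halfTurn b' i.rev ht, Fin.rev_rev]

theorem lower_halfTurn_iff {i : Fin (k - 1)} {b b' : Mat d k} :
    Lower i.rev (halfTurn b) (halfTurn b') ↔ Lower i b' b := by
  refine ⟨fun ⟨s, h⟩ => ⟨s.rev, ?_⟩, fun ⟨s, h⟩ => ⟨s.rev, h.halfTurn⟩⟩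
  simpa only [halfTurn_halfTurn, Fin.rev_rev] using h.halfTurn

theorem Lower.unique_left {i : Fin (k - 1)} {b b' b'' : Mat d k} (h : Lower i b b'')
    (h' : Lower i b' b'') : b = b' :=
  (Function.LeftInverse.injective halfTurn_halfTurn)
    ((lower_halfTurn_iff.2 h).unique_right (lower_halfTurn_iff.2 h'))

theorem exists_lower_of_pos {i : Fin (k - 1)} {b : Mat d k} {t : ℕ} (ht : t ≤ d)
    (h : 0 < height b i t) : ∃ b', Lower i b' b := by
  obtain ⟨b', hb'⟩ := exists_lower_of_lt (i := i.rev) (b := halfTurn b) (Nat.sub_le d t) <| by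
    rw [height_halfTurn _ _ le_rfl, height_halfTurn _ _ (Nat.sub_le d t), Nat.sub_sub_self ht,
      Fin.rev_rev, Nat.sub_self, height_zero]
    omega
  exact ⟨halfTurn b', lower_halfTurn_iff.1 (by rwa [halfTurn_halfTurn])⟩

/-- A matrix is annihilated by `e_i` iff its rows form a lattice word in the letters `i`, `i+1`. -/
theorem not_lower_left_iff (i : Fin (k - 1)) (b : Mat d k) :
    (∀ b', ¬ Lower i b' b) ↔ ∀ t ≤ d, colCount b (sndIdx i) t ≤ colCount b (fstIdx i) t := by
  constructor
  · intro h t ht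
    by_contra! hlt
    obtain ⟨b', hb'⟩ := exists_lower_of_pos ht (sub_pos.2 hlt)
    exact h b' hb'
  · rintro h b' ⟨s, hs⟩
    have hpos : 0 < height b i (s.1 + 1) := by
      simpa using hs.isFirstMax.lt 0 (Nat.succ_pos _)
    exact absurd (h _ s.2) (sub_pos.1 hpos).not_ge

theorem not_lower_right_iff (i : Fin (k - 1)) (b : Mat d k) :
    (∀ b', ¬ Lower i b b') ↔ ∀ t ≤ d, height b i t ≤ height b i d := by
  constructor
  · intro h t ht
    by_contra! hlt
    obtain ⟨b', hb'⟩ := exists_lower_of_lt ht hlt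
    exact h b' hb'
  · rintro h b' ⟨s, hs⟩
    exact absurd (h s.1 s.2.le) (hs.isLastMax.lt d le_rfl s.2).not_ge

section TensorPow

variable (i : Fin (k - 1)) (b b' : Mat d k)

theorem tensorPow_wt (x : Fin k) : (tensorPow (vecCrystal k) d).wt b x = colCount b x d := by
  simp only [tensorPow, vecCrystal, Finset.sum_apply, colCount_eq_sum, toInt_eq_ite]

theorem sum_wt_lt (s : Fin d) (x : Fin k) :
    (∑ t with t < s, (vecCrystal k).wt (b t)) x = colCount b x s.1 := by
  simp only [vecCrystal, Finset.sum_apply, colCount, toInt_eq_ite, Fin.lt_def]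

theorem sum_wt_gt (s : Fin d) (x : Fin k) :
    (∑ t with s < t, (vecCrystal k).wt (b t)) x = colCount b x d - colCount b x (s.1 + 1) := by
  have h := Finset.sum_filter_add_sum_filter_not Finset.univ (fun t : Fin d => t.1 < s.1 + 1)
    fun t => (b t x).toInt
  rw [Finset.sum_apply, colCount_eq_sum, ← h, colCount, add_sub_cancel_left]
  simp only [vecCrystal, toInt_eq_ite, Fin.lt_def, not_lt, Nat.succ_le_iff]

theorem tensorEpsAt_eq (s : Fin d) :
    tensorEpsAt (vecCrystal k) i b s = max (height b i s.1) (height b i (s.1 + 1)) := by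
  rw [height_succ, tensorEpsAt, corootPairing, sum_wt_lt, sum_wt_lt]
  simp only [vecCrystal, height]
  cases b s (fstIdx i) <;> cases b s (sndIdx i) <;> simp
  ring

theorem tensorPhiAt_eq (s : Fin d) :
    tensorPhiAt (vecCrystal k) i b s =
      max (height b i s.1) (height b i (s.1 + 1)) - height b i d := by
  have h := height_succ b i s
  simp only [height] at h
  rw [tensorPhiAt, corootPairing, sum_wt_gt, sum_wt_gt]
  simp only [vecCrystal, height]
  cases h₁ : b s (fstIdx i) <;> cases h₂ : b s (sndIdx i) <;> simp [h₁, h₂] at h ⊢ <;> omega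

theorem height_le_tensorEps {t : ℕ} (ht : t ≤ d) :
    height b i t ≤ tensorEps (vecCrystal k) i b := by
  rw [tensorEps, Finset.le_fold_max]
  rcases t with _ | t
  · exact Or.inl (height_zero b i).le
  · exact Or.inr ⟨⟨t, ht⟩, Finset.mem_univ _, (tensorEpsAt_eq i b _).symm ▸ le_max_right _ _⟩

theorem tensorEps_nonneg : 0 ≤ tensorEps (vecCrystal k) i b := by
  simpa using height_le_tensorEps i b (Nat.zero_le d)

variable {i b b'}

theorem tensorEps_eq {t : ℕ} (ht : t ≤ d) (h : ∀ t' ≤ d, height b i t' ≤ height b i t) :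
    tensorEps (vecCrystal k) i b = height b i t := by
  refine le_antisymm ?_ (height_le_tensorEps i b ht)
  rw [tensorEps, Finset.fold_max_le]
  refine ⟨by simpa using h 0 (Nat.zero_le d), fun s _ => ?_⟩
  rw [tensorEpsAt_eq]
  exact max_le (h _ s.2.le) (h _ s.2)

theorem IsLastMax.tensorEps_eq {s : ℕ} (h : IsLastMax (height b i) d s) :
    tensorEps (vecCrystal k) i b = height b i s :=
  GLCrystal.tensorEps_eq h.le_right h.le

theorem IsFirstMax.tensorEps_eq {s : ℕ} (h : IsFirstMax (height b i) d s) :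
    tensorEps (vecCrystal k) i b = height b i s :=
  GLCrystal.tensorEps_eq h.le_right h.le

variable (i b)

theorem tensorPhi_eq :
    tensorPhi (vecCrystal k) i b = tensorEps (vecCrystal k) i b - height b i d := by
  apply le_antisymm
  · rw [tensorPhi, Finset.fold_max_le]
    refine ⟨sub_nonneg.2 (height_le_tensorEps i b le_rfl), fun s _ => ?_⟩
    rw [tensorPhiAt_eq]
    exact sub_le_sub_right
      (max_le (height_le_tensorEps i b s.2.le) (height_le_tensorEps i b s.2)) _
  · obtain ⟨s, hs⟩ := exists_isLastMax (height b i) d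
    rw [tensorPhi, Finset.le_fold_max, hs.tensorEps_eq]
    rcases hs.le_right.eq_or_lt with rfl | hsd
    · exact Or.inl (sub_self _).le
    · refine Or.inr ⟨⟨s, hsd⟩, Finset.mem_univ _, ?_⟩
      rw [tensorPhiAt_eq]
      exact sub_le_sub_right (le_max_left _ _) _

theorem tensorPhi_nonneg : 0 ≤ tensorPhi (vecCrystal k) i b := by
  rw [tensorPhi_eq]
  exact sub_nonneg.2 (height_le_tensorEps i b le_rfl)

variable {i b}

theorem Lower.height_right (h : Lower i b b') : height b' i d = height b i d + 2 := by
  obtain ⟨s, h⟩ := h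
  rw [h.height_right, if_pos s.2]

theorem Lower.tensorEps_right (h : Lower i b b') :
    tensorEps (vecCrystal k) i b' = tensorEps (vecCrystal k) i b + 1 := by
  obtain ⟨s, h⟩ := h
  rw [h.isFirstMax.tensorEps_eq, h.isLastMax.tensorEps_eq, h.height_succ_right]

theorem tensorPow_f_iff : (tensorPow (vecCrystal k) d).f i b = some b' ↔ Lower i b b' := by
  simp only [tensorPow, Option.bind_eq_some_iff, find?_finRange_reverse_eq_some_iff,
    Option.map_eq_some_iff, ← toInt_eq_iff_f_update, decide_eq_true_eq, decide_eq_false_iff_not,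
    tensorPhiAt_eq, tensorPhi_eq, sub_left_inj]
  refine exists_congr fun s => ⟨fun ⟨⟨hs, hlt⟩, h⟩ => ⟨h, ?_⟩, fun h => ⟨⟨?_, ?_⟩, h.toInt_eq⟩⟩
  · have hdesc : height b i (s.1 + 1) < height b i s.1 := by
      obtain ⟨w, hw, -⟩ := toInt_eq_iff_f_update.1 h
      have hv : b s (fstIdx i) = true ∧ b s (sndIdx i) = false :=
        (Option.ite_none_right_eq_some.1 hw).1
      rw [height_succ, hv.1, hv.2]; simp
    rw [max_eq_left hdesc.le] at hs
    refine ⟨s.2.le, fun t ht => hs ▸ height_le_tensorEps i b ht, fun t ht hst => ?_⟩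
    refine (hs ▸ height_le_tensorEps i b ht).lt_of_ne fun heq => ?_
    obtain ⟨t, rfl⟩ := Nat.exists_eq_succ_of_ne_zero (Nat.ne_zero_of_lt hst)
    rcases (Nat.lt_succ_iff.1 hst).eq_or_lt with rfl | hst'
    · exact hdesc.ne heq
    · exact hlt ⟨t, ht⟩ hst' ((max_eq_right
        (heq.trans hs ▸ height_le_tensorEps i b (Nat.le_of_succ_le ht))).trans (heq.trans hs))
  · rw [h.isLastMax.tensorEps_eq]
    exact max_eq_left (h.isLastMax.le _ s.2)
  · intro t hst
    rw [h.isLastMax.tensorEps_eq]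
    exact (max_lt (h.isLastMax.lt _ t.2.le hst)
      (h.isLastMax.lt _ t.2 (Nat.lt_succ_of_lt hst))).ne

theorem tensorPow_e_iff : (tensorPow (vecCrystal k) d).e i b = some b' ↔ Lower i b' b := by
  simp only [tensorPow, Option.bind_eq_some_iff, find?_finRange_eq_some_iff,
    Option.map_eq_some_iff, ← toInt_eq_iff_e_update, decide_eq_true_eq, decide_eq_false_iff_not,
    tensorEpsAt_eq]
  refine exists_congr fun s => ⟨fun ⟨⟨hs, hlt⟩, h⟩ => .of_isFirstMax h ?_,
    fun h => ⟨⟨?_, ?_⟩, h.toInt_eq⟩⟩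
  · have hasc : height b i s.1 < height b i (s.1 + 1) := by
      obtain ⟨w, hw, -⟩ := toInt_eq_iff_e_update.1 h
      have hv : b s (fstIdx i) = false ∧ b s (sndIdx i) = true :=
        (Option.ite_none_right_eq_some.1 hw).1
      rw [height_succ, hv.1, hv.2]; simp
    rw [max_eq_right hasc.le] at hs
    refine ⟨s.2, fun t ht => hs ▸ height_le_tensorEps i b ht, fun t hts => ?_⟩
    have hle : height b i t ≤ height b i (s.1 + 1) := hs ▸ height_le_tensorEps i b (by omega)
    refine hle.lt_of_ne fun heq => ?_
    rcases (Nat.lt_succ_iff.1 hts).eq_or_lt with rfl | hts'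
    · exact hasc.ne heq
    · exact hlt ⟨t, hts'.trans s.2⟩ hts' ((max_eq_left
        (heq.trans hs ▸ height_le_tensorEps i b (hts'.trans s.2))).trans (heq.trans hs))
  · rw [h.isFirstMax.tensorEps_eq]
    exact max_eq_right (h.isFirstMax.le _ s.2.le)
  · intro t hts
    rw [h.isFirstMax.tensorEps_eq]
    exact (max_lt (h.isFirstMax.lt _ (Nat.lt_succ_of_lt hts))
      (h.isFirstMax.lt _ (Nat.succ_lt_succ hts))).ne

theorem tensorPow_f_eq_none_iff :
    (tensorPow (vecCrystal k) d).f i b = none ↔ ∀ b', ¬ Lower i b b' := by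
  simp only [Option.eq_none_iff_forall_ne_some, ne_eq, tensorPow_f_iff]

theorem tensorPow_e_eq_none_iff :
    (tensorPow (vecCrystal k) d).e i b = none ↔ ∀ b', ¬ Lower i b' b := by
  simp only [Option.eq_none_iff_forall_ne_some, ne_eq, tensorPow_e_iff]

theorem tensorEps_eq_zero (h : ∀ b', ¬ Lower i b' b) : tensorEps (vecCrystal k) i b = 0 := by
  rw [tensorEps_eq (Nat.zero_le d) fun t ht => ?_, height_zero]
  simpa [height] using (not_lower_left_iff i b).1 h t ht

theorem tensorPhi_eq_zero (h : ∀ b', ¬ Lower i b b') : tensorPhi (vecCrystal k) i b = 0 := by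
  rw [tensorPhi_eq, tensorEps_eq le_rfl ((not_lower_right_iff i b).1 h), sub_self]

theorem Lower.tensorPhi_left (h : Lower i b b') :
    tensorPhi (vecCrystal k) i b = tensorPhi (vecCrystal k) i b' + 1 := by
  rw [tensorPhi_eq, tensorPhi_eq, h.tensorEps_right, h.height_right]; ring

theorem isCrystal_tensorPow (d k : ℕ) : IsCrystal (tensorPow (vecCrystal k) d) where
  finite := inferInstance
  f_iff_e i b c := by rw [tensorPow_f_iff, tensorPow_e_iff]
  wt_e i b c h := by
    funext x
    rw [Pi.add_apply, tensorPow_wt, tensorPow_wt, (tensorPow_e_iff.1 h).colCount_right]; ring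
  wt_f i b c h := by
    funext x
    rw [Pi.sub_apply, tensorPow_wt, tensorPow_wt, (tensorPow_f_iff.1 h).colCount_right]
  eps_max i b := isGreatest_iterate_bind_ne_none (tensorEps_nonneg i)
    (fun _ h => tensorEps_eq_zero (tensorPow_e_eq_none_iff.1 h))
    (fun _ _ h => eq_sub_of_add_eq (tensorPow_e_iff.1 h).tensorEps_right.symm) b
  phi_max i b := isGreatest_iterate_bind_ne_none (tensorPhi_nonneg i)
    (fun _ h => tensorPhi_eq_zero (tensorPow_f_eq_none_iff.1 h))
    (fun _ _ h => eq_sub_of_add_eq (tensorPow_f_iff.1 h).tensorPhi_left.symm) b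
  phi_sub_eps i b := by
    rw [corootPairing, tensorPow_wt, tensorPow_wt]
    change tensorPhi _ i b - tensorEps _ i b = _
    rw [tensorPhi_eq, height]; ring

end TensorPow

/-! ## Row operators commute with column operators -/

section Perturbation

variable {f g : ℕ → ℤ} {d s a : ℕ} {δ : ℤ}

theorem IsLastMax.of_add_nonpos (h : IsLastMax f d s) (hδ : δ ≤ 0) (hs : s ≠ a)
    (hg : ∀ t, g t = f t + if t = a then δ else 0) : IsLastMax g d s :=
  ⟨h.le_right, fun t ht => by grind [h.le t ht], fun t ht hst => by grind [h.lt t ht hst]⟩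

theorem IsLastMax.of_add_one (h : IsLastMax f d s) (hs : s ≠ a) (hs' : s ≠ a + 1) (ha : a + 2 ≤ d)
    (hf : f (a + 1) < max (f a) (f (a + 2)))
    (hg : ∀ t, g t = f t + if t = a + 1 then 1 else 0) : IsLastMax g d s := by
  have h₁ := h.le a (by omega)
  have h₂ := h.lt a (by omega)
  have h₃ := h.le (a + 2) ha
  have h₄ := h.lt (a + 2) ha
  refine ⟨h.le_right, fun t ht => ?_, fun t ht hst => ?_⟩
  · have := h.le t ht
    grind
  · have := h.lt t ht hst
    grind

theorem IsLastMax.succ_of_add_one (h : IsLastMax f d a) (ha : a + 1 ≤ d) (hf : f (a + 1) + 1 = f a)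
    (hg : ∀ t, g t = f t + if t = a + 1 then 1 else 0) : IsLastMax g d (a + 1) := by
  refine ⟨ha, fun t ht => ?_, fun t ht hat => ?_⟩
  · have := h.le t ht
    grind
  · have := h.lt t ht (by omega)
    grind

theorem IsLastMax.pred_of_sub_one (h : IsLastMax f d (a + 1)) (hf : f a = f (a + 1))
    (hg : ∀ t, g t = f t + if t = a + 1 then -1 else 0) : IsLastMax g d a := by
  refine ⟨by grind [h.le_right], fun t ht => ?_, fun t ht hat => ?_⟩
  · have := h.le t ht
    grind
  · have := h.le t ht
    have := h.lt t ht
    grind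

end Perturbation

variable {d k : ℕ}

theorem sum_root_lt (q : Fin (d - 1)) (t : ℕ) :
    ∑ r : Fin d with r.1 < t, root q r = if t = q.1 + 1 then 1 else 0 := by
  simp only [root_apply, Finset.sum_sub_distrib, Finset.sum_ite_eq', Finset.mem_filter,
    Finset.mem_univ, true_and]
  simp only [fstIdx, sndIdx]
  grind

/-- An operator acting on the columns changes the row heights in one place only. -/
theorem height_of_column_toInt_eq {A B : Mat d k} {q : Fin (d - 1)} {c : Fin k}
    (h : ∀ r x, (B r x).toInt = (A r x).toInt - if x = c then root q r else 0)
    (i : Fin (k - 1)) (t : ℕ) :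
    height B i t = height A i t + if t = q.1 + 1 then root i c else 0 := by
  have hcol (x : Fin k) : colCount B x t =
      colCount A x t - if x = c then (if t = q.1 + 1 then 1 else 0) else 0 := by
    rw [← sum_root_lt q t]
    simp only [colCount, h, Finset.sum_sub_distrib]
    split_ifs <;> simp
  rw [height, height, hcol, hcol, root_apply]
  grind

variable {n m : ℕ} {i : Fin (m - 1)} {p : Fin (n - 1)} {M X Y : Mat n m}

theorem height_fstIdx_sndIdx (M : Mat n m) (i : Fin (m - 1)) (p : Fin (n - 1)) :
    height M i (p.1 + 1) = height M i p.1 + (M (fstIdx p) (sndIdx i)).toInt -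
        (M (fstIdx p) (fstIdx i)).toInt ∧
      height M i (p.1 + 2) = height M i (p.1 + 1) + (M (sndIdx p) (sndIdx i)).toInt -
        (M (sndIdx p) (fstIdx i)).toInt :=
  ⟨height_succ M i (fstIdx p), height_succ M i (sndIdx p)⟩

theorem height_quarterTurn_fstIdx_sndIdx (M : Mat n m) (i : Fin (m - 1)) (p : Fin (n - 1)) :
    height (quarterTurn M) p (i.rev.1 + 1) = height (quarterTurn M) p i.rev.1 +
        (M (sndIdx p) (sndIdx i)).toInt - (M (fstIdx p) (sndIdx i)).toInt ∧
      height (quarterTurn M) p (i.rev.1 + 2) = height (quarterTurn M) p (i.rev.1 + 1) +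
        (M (sndIdx p) (fstIdx i)).toInt - (M (fstIdx p) (fstIdx i)).toInt := by
  have h := height_fstIdx_sndIdx (quarterTurn M) p i.rev
  rw [← sndIdx_rev, ← fstIdx_rev] at h
  simpa only [quarterTurn, Fin.rev_rev] using h

section Square

variable {s : Fin n} {u : Fin m}

theorem LowerAt.height_column (S : LowerAt p u (quarterTurn M) (quarterTurn Y)) (t : ℕ) :
    height Y i t = height M i t + if t = p.1 + 1 then root i u.rev else 0 :=
  height_of_column_toInt_eq (fun r x => by
    simpa [quarterTurn, Fin.rev_eq_iff] using S.toInt_eq x.rev r) i t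

theorem LowerAt.height_quarterTurn (T : LowerAt i s M X) (t : ℕ) :
    height (quarterTurn X) p t =
      height (quarterTurn M) p t + if t = i.rev.1 + 1 then -root p s else 0 := by
  have h := height_of_column_toInt_eq (A := quarterTurn X) (B := quarterTurn M) (q := i.rev)
    (c := s) (fun r x => by
      simp only [quarterTurn, T.toInt_eq, root_rev]; split_ifs <;> ring) p t
  rw [h]; split_ifs <;> ring

theorem LowerAt.entries_quarterTurn (S : LowerAt p u (quarterTurn M) (quarterTurn Y)) :
    M (fstIdx p) u.rev = true ∧ M (sndIdx p) u.rev = false :=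
  S.isLastMax.entries

theorem eq_fstIdx_rev (h : u.rev = fstIdx i) : u.1 = i.rev.1 + 1 := by
  rw [← Fin.rev_rev u, h, fstIdx_rev]; rfl

theorem eq_sndIdx_rev (h : u.rev = sndIdx i) : u.1 = i.rev.1 := by
  rw [← Fin.rev_rev u, h, sndIdx_rev]; rfl

variable (T : LowerAt i s M X) (S : LowerAt p u (quarterTurn M) (quarterTurn Y))
include T S

theorem ne_sndIdx_of_rev_eq (h : u.rev = fstIdx i) : s ≠ sndIdx p := by
  rintro rfl
  have := S.entries_quarterTurn.2
  rw [h, T.isLastMax.entries.1] at this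
  cases this

theorem isLastMax_height_column (hs : s = fstIdx p → u.rev ≠ fstIdx i)
    (hs' : s = sndIdx p → u.rev ≠ sndIdx i) : IsLastMax (height Y i) n s := by
  have hY := S.height_column (i := i)
  rw [root_apply] at hY
  by_cases h₁ : u.rev = fstIdx i
  · have hu := eq_fstIdx_rev h₁
    have hne := ne_sndIdx_of_rev_eq T S h₁
    obtain ⟨hA, hC⟩ := h₁ ▸ S.entries_quarterTurn
    obtain ⟨hM, hM'⟩ := height_fstIdx_sndIdx M i p
    have hBD := S.isLastMax.le i.rev.1 (by omega)
    rw [hu, (height_quarterTurn_fstIdx_sndIdx M i p).1] at hBD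
    refine T.isLastMax.of_add_one (a := p.1) (fun h => hs (Fin.ext h) h₁) (fun h => hne (Fin.ext h))
      (by omega) ?_ (by simpa [h₁, fstIdx_ne_sndIdx] using hY)
    rw [hA] at hM
    rw [hC] at hM'
    cases hB : M (fstIdx p) (sndIdx i) <;> cases hD : M (sndIdx p) (sndIdx i) <;>
      simp [hB, hD] at hM hM' hBD ⊢ <;> omega
  · by_cases h₂ : u.rev = sndIdx i
    · exact T.isLastMax.of_add_nonpos (a := p.1 + 1) (δ := -1) (by norm_num)
        (fun h => hs' (Fin.ext h) h₂) (by simpa [h₂, (fstIdx_ne_sndIdx i).symm] using hY)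
    · exact (funext fun t => by simpa [h₁, h₂] using hY t : height Y i = height M i) ▸ T.isLastMax

theorem isLastMax_height_quarterTurn_row (hs : s = fstIdx p → u.rev ≠ fstIdx i)
    (hs' : s = sndIdx p → u.rev ≠ sndIdx i) : IsLastMax (height (quarterTurn X) p) m u := by
  have hX := T.height_quarterTurn (p := p)
  rw [root_apply] at hX
  by_cases h₂ : s = sndIdx p
  · have hne : u.1 ≠ i.rev.1 + 1 := fun h => ne_sndIdx_of_rev_eq T S
      (by rw [Fin.rev_eq_iff, fstIdx_rev]; exact Fin.ext h) h₂
    have hne' : u.1 ≠ i.rev.1 := fun h => hs' h₂ (by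
      rw [Fin.rev_eq_iff, sndIdx_rev]; exact Fin.ext h)
    obtain ⟨hC, hD⟩ := h₂ ▸ T.isLastMax.entries
    obtain ⟨hM, hM'⟩ := height_quarterTurn_fstIdx_sndIdx M i p
    have hAB := T.isLastMax.le p.1 (by omega)
    rw [h₂, show (sndIdx p).1 = p.1 + 1 from rfl, (height_fstIdx_sndIdx M i p).1] at hAB
    refine S.isLastMax.of_add_one (a := i.rev.1) hne' hne (by omega) ?_
      (by simpa [h₂, (fstIdx_ne_sndIdx p).symm] using hX)
    rw [hD] at hM
    rw [hC] at hM'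
    cases hA : M (fstIdx p) (fstIdx i) <;> cases hB : M (fstIdx p) (sndIdx i) <;>
      simp [hA, hB] at hM hM' hAB ⊢ <;> omega
  · by_cases h₁ : s = fstIdx p
    · exact S.isLastMax.of_add_nonpos (a := i.rev.1 + 1) (δ := -1) (by norm_num)
        (fun h => hs h₁ (by rw [Fin.rev_eq_iff, fstIdx_rev]; exact Fin.ext h))
        (by simpa [h₁, fstIdx_ne_sndIdx] using hX)
    · exact (funext fun t => by simpa [h₁, h₂] using hX t :
        height (quarterTurn X) p = height (quarterTurn M) p) ▸ S.isLastMax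

theorem isLastMax_of_eq_fstIdx (hs : s = fstIdx p) (hu : u.rev = fstIdx i) :
    IsLastMax (height Y i) n (sndIdx p).1 ∧
      IsLastMax (height (quarterTurn X) p) m (sndIdx i).rev.1 := by
  subst hs
  have hY := S.height_column (i := i)
  have hX := T.height_quarterTurn (p := p)
  obtain ⟨hM, hM'⟩ := height_fstIdx_sndIdx M i p
  have hN := (height_quarterTurn_fstIdx_sndIdx M i p).1
  obtain ⟨hA, hB⟩ := T.isLastMax.entries
  have hC := hu ▸ S.entries_quarterTurn.2
  have hDlt := T.isLastMax.lt (p.1 + 2) (by omega) (by simp [fstIdx])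
  have hD : M (sndIdx p) (sndIdx i) = false := by
    rw [hM', hM, hA, hB, hC] at hDlt
    cases hD : M (sndIdx p) (sndIdx i) <;> simp [hD, fstIdx] at hDlt ⊢
  constructor
  · refine T.isLastMax.succ_of_add_one (a := p.1) (by omega) ?_ ?_
    · rw [hM, hA, hB]; simp
    · simpa [hu, root_apply, fstIdx_ne_sndIdx] using hY
  · rw [sndIdx_rev]
    refine IsLastMax.pred_of_sub_one (a := i.rev.1) (eq_fstIdx_rev hu ▸ S.isLastMax) ?_ ?_
    · rw [hN, hB, hD]; simp
    · simpa [root_apply, fstIdx_ne_sndIdx] using hX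

theorem isLastMax_of_eq_sndIdx (hs : s = sndIdx p) (hu : u.rev = sndIdx i) :
    IsLastMax (height Y i) n (fstIdx p).1 ∧
      IsLastMax (height (quarterTurn X) p) m (fstIdx i).rev.1 := by
  subst hs
  have hY := S.height_column (i := i)
  have hX := T.height_quarterTurn (p := p)
  have hM := (height_fstIdx_sndIdx M i p).1
  obtain ⟨hN, hN'⟩ := height_quarterTurn_fstIdx_sndIdx M i p
  obtain ⟨hC, hD⟩ := T.isLastMax.entries
  have hB := hu ▸ S.entries_quarterTurn.1
  have hAlt := S.isLastMax.lt (i.rev.1 + 2) (by omega) (by rw [eq_sndIdx_rev hu]; omega)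
  have hA : M (fstIdx p) (fstIdx i) = true := by
    rw [hN', hN, hB, hC, hD, eq_sndIdx_rev hu] at hAlt
    cases hA : M (fstIdx p) (fstIdx i) <;> simp [hA] at hAlt ⊢
  constructor
  · refine IsLastMax.pred_of_sub_one (a := p.1) T.isLastMax ?_ ?_
    · rw [hM, hA, hB]; simp
    · simpa [hu, root_apply, (fstIdx_ne_sndIdx _).symm] using hY
  · rw [fstIdx_rev]
    refine IsLastMax.succ_of_add_one (a := i.rev.1) (eq_sndIdx_rev hu ▸ S.isLastMax)
      (by omega) ?_ ?_
    · rw [hN, hB, hD]; simp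
    · simpa [root_apply, (fstIdx_ne_sndIdx _).symm] using hX

theorem exists_isLastMax_of_square :
    ∃ (s' : Fin n) (u' : Fin m), IsLastMax (height Y i) n s'.1 ∧
      IsLastMax (height (quarterTurn X) p) m u'.1 ∧
      ∀ r x, (if x = u.rev then root p r else 0) + (if r = s' then root i x else 0) =
        (if r = s then root i x else 0) + if x = u'.rev then root p r else 0 := by
  by_cases hfst : s = fstIdx p ∧ u.rev = fstIdx i
  · obtain ⟨hs, hu⟩ := hfst
    obtain ⟨hY, hX⟩ := isLastMax_of_eq_fstIdx T S hs hu
    refine ⟨_, _, hY, hX, fun r x => ?_⟩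
    rw [hs, hu, Fin.rev_rev, root_apply, root_apply]
    grind
  by_cases hsnd : s = sndIdx p ∧ u.rev = sndIdx i
  · obtain ⟨hs, hu⟩ := hsnd
    obtain ⟨hY, hX⟩ := isLastMax_of_eq_sndIdx T S hs hu
    refine ⟨_, _, hY, hX, fun r x => ?_⟩
    rw [hs, hu, Fin.rev_rev, root_apply, root_apply]
    grind
  rw [not_and] at hfst hsnd
  exact ⟨s, u, isLastMax_height_column T S hfst hsnd,
    isLastMax_height_quarterTurn_row T S hfst hsnd, fun r x => add_comm _ _⟩

end Square

/-- The lowering operators on rows and on columns commute where both are defined. -/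
theorem lower_square (hT : Lower i M X) (hS : Lower p (quarterTurn M) (quarterTurn Y)) :
    ∃ W, Lower i Y W ∧ Lower p (quarterTurn X) (quarterTurn W) := by
  obtain ⟨s, T⟩ := hT
  obtain ⟨u, S⟩ := hS
  obtain ⟨s', u', hs, hu, hsu⟩ := exists_isLastMax_of_square T S
  have hf : (vecCrystal m).f i (Y s') = some _ := if_pos hs.entries
  have hW := toInt_eq_iff_f_update.2 ⟨_, hf, rfl⟩
  refine ⟨_, ⟨s', hW, hs⟩, u', fun j r => ?_, hu⟩
  have hY := S.toInt_eq j r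
  simp only [quarterTurn] at hY ⊢
  rw [hW, hY, T.toInt_eq]
  have := hsu r j.rev
  simp only [Fin.rev_inj] at this
  linarith

theorem lower_quarterTurn_quarterTurn_iff :
    Lower i.rev (quarterTurn (quarterTurn M)) (quarterTurn (quarterTurn X)) ↔ Lower i X M := by
  rw [quarterTurn_quarterTurn, quarterTurn_quarterTurn, lower_halfTurn_iff]

-- A right-angle rotation turns `lower_square` into its analogues for raising operators.
theorem lower_square_raise_row (hT : Lower i X M) (hS : Lower p (quarterTurn M) (quarterTurn Y)) :
    ∃ W, Lower i W Y ∧ Lower p (quarterTurn X) (quarterTurn W) := by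
  obtain ⟨W', h₁, h₂⟩ := lower_square hS (lower_quarterTurn_quarterTurn_iff.2 hT)
  obtain ⟨W, rfl⟩ := quarterTurn_surjective W'
  exact ⟨W, lower_quarterTurn_quarterTurn_iff.1 h₂, h₁⟩

theorem lower_square_raise_both (hT : Lower i X M) (hS : Lower p (quarterTurn Y) (quarterTurn M)) :
    ∃ W, Lower i W Y ∧ Lower p (quarterTurn W) (quarterTurn X) := by
  obtain ⟨W', h₁, h₂⟩ := lower_square_raise_row hS (lower_quarterTurn_quarterTurn_iff.2 hT)
  obtain ⟨W, rfl⟩ := quarterTurn_surjective W'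
  exact ⟨W, lower_quarterTurn_quarterTurn_iff.1 h₂, h₁⟩

theorem lower_square_raise_col (hT : Lower i M X) (hS : Lower p (quarterTurn Y) (quarterTurn M)) :
    ∃ W, Lower i Y W ∧ Lower p (quarterTurn W) (quarterTurn X) := by
  obtain ⟨W', h₁, h₂⟩ := lower_square_raise_both hS (lower_quarterTurn_quarterTurn_iff.2 hT)
  obtain ⟨W, rfl⟩ := quarterTurn_surjective W'
  exact ⟨W, lower_quarterTurn_quarterTurn_iff.1 h₂, h₁⟩

/-! ## Double crystals -/

section DoubleCrystals

variable {X I J α β : Type*}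

/-- No arrow ends in `x`: highest weight elements, for lowering arrows. -/
def IsHigh (r : I → X → X → Prop) (x : X) : Prop := ∀ i z, ¬ r i z x

/-- No arrow starts in `x`: lowest weight elements, for lowering arrows. -/
def IsLow (r : I → X → X → Prop) (x : X) : Prop := ∀ i z, ¬ r i x z

/-- Connected components of a coloured graph. -/
def Conn (r : I → X → X → Prop) : X → X → Prop := Relation.EqvGen fun x y => ∃ i, r i x y

/-- Two commuting crystal graphs with lowering arrows `r` (rows) and `c` (columns), in which the
elements that are highest for `r` and lowest for `c` are determined by either of their weights. -/
structure DoubleCrystal (r : I → X → X → Prop) (c : J → X → X → Prop) (wr : X → α) (wc : X → β) :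
    Prop where
  r_fun : ∀ {i x y y'}, r i x y → r i x y' → y = y'
  r_inj : ∀ {i x x' y}, r i x y → r i x' y → x = x'
  c_fun : ∀ {j x y y'}, c j x y → c j x y' → y = y'
  c_inj : ∀ {j x x' y}, c j x y → c j x' y → x = x'
  square : ∀ {i j x y z}, r i x y → c j x z → ∃ w, r i z w ∧ c j y w
  square_raise_row : ∀ {i j x y z}, r i y x → c j x z → ∃ w, r i w z ∧ c j y w
  square_raise_col : ∀ {i j x y z}, r i x y → c j z x → ∃ w, r i z w ∧ c j w y
  square_raise_both : ∀ {i j x y z}, r i y x → c j z x → ∃ w, r i w z ∧ c j w y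
  wellFounded_r : WellFounded fun y x => ∃ i, r i y x
  wellFounded_c : WellFounded fun y x => ∃ j, c j x y
  wc_r : ∀ {i x y}, r i x y → wc x = wc y
  wr_c : ∀ {j x y}, c j x y → wr x = wr y
  ext_c : ∀ {x y}, IsHigh r x → IsLow c x → IsHigh r y → IsLow c y → wc x = wc y → x = y
  ext_r : ∀ {x y}, IsHigh r x → IsLow c x → IsHigh r y → IsLow c y → wr x = wr y → x = y

section Conn

variable {r : I → X → X → Prop} {x y z : X}

theorem Conn.single {i : I} (h : r i x y) : Conn r x y := .rel _ _ ⟨i, h⟩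

theorem Conn.symm (h : Conn r x y) : Conn r y x := Relation.EqvGen.symm _ _ h

theorem Conn.trans (h : Conn r x y) (h' : Conn r y z) : Conn r x z :=
  Relation.EqvGen.trans _ _ _ h h'

theorem conn_flip : Conn (fun i a b => r i b a) x y ↔ Conn r x y :=
  ⟨eqvGen_lift (g := id) fun _ _ ⟨_, h⟩ => (Conn.single h).symm,
    eqvGen_lift (g := id) fun _ _ ⟨_, h⟩ =>
      (Conn.single (r := fun i a b => r i b a) h).symm⟩

theorem Conn.apply_eq {γ : Type*} (h : Conn r x y) {w : X → γ}
    (hw : ∀ i x y, r i x y → w x = w y) : w x = w y :=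
  congrArg (Quot.lift w fun x y ⟨i, h⟩ => hw i x y h) (Quot.eqvGen_sound h)

theorem conn_of_raise (h : Relation.ReflTransGen (fun a b => ∃ i, r i b a) x y) : Conn r x y := by
  induction h with
  | refl => exact .refl _
  | tail _ h ih => obtain ⟨i, h⟩ := h; exact ih.trans (Conn.single h).symm

theorem Conn.exists_of_square {s : X → X → Prop}
    (hr : ∀ i x y z, r i x y → s x z → ∃ w, r i z w ∧ s y w)
    (hr' : ∀ i x y z, r i y x → s x z → ∃ w, r i w z ∧ s y w) (h : Conn r x y) (hs : s x z) :
    ∃ w, Conn r z w ∧ s y w := by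
  rw [Conn, ← Relation.EqvGen.reflTransGen_symmGen] at h
  induction h with
  | refl => exact ⟨z, .refl _, hs⟩
  | tail _ hxy ih =>
    obtain ⟨w, hzw, hw⟩ := ih
    rcases hxy with ⟨i, hxy⟩ | ⟨i, hxy⟩
    · obtain ⟨w', hww', hw'⟩ := hr i _ _ _ hxy hw
      exact ⟨w', hzw.trans (.single hww'), hw'⟩
    · obtain ⟨w', hww', hw'⟩ := hr' i _ _ _ hxy hw
      exact ⟨w', hzw.trans (Conn.single hww').symm, hw'⟩

end Conn

namespace DoubleCrystal

variable {r : I → X → X → Prop} {c : J → X → X → Prop} {wr : X → α} {wc : X → β}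
  (h : DoubleCrystal r c wr wc) {i : I} {j : J} {x y z p q : X}
include h

/-- Exchange the two structures and reverse all arrows. -/
theorem dual : DoubleCrystal (fun j x y => c j y x) (fun i x y => r i y x) wc wr where
  r_fun h₁ h₂ := h.c_inj h₁ h₂
  r_inj h₁ h₂ := h.c_fun h₁ h₂
  c_fun h₁ h₂ := h.r_inj h₁ h₂
  c_inj h₁ h₂ := h.r_fun h₁ h₂
  square h₁ h₂ := by obtain ⟨w, a, b⟩ := h.square_raise_both h₂ h₁; exact ⟨w, b, a⟩
  square_raise_row h₁ h₂ := by obtain ⟨w, a, b⟩ := h.square_raise_row h₂ h₁; exact ⟨w, b, a⟩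
  square_raise_col h₁ h₂ := by obtain ⟨w, a, b⟩ := h.square_raise_col h₂ h₁; exact ⟨w, b, a⟩
  square_raise_both h₁ h₂ := by obtain ⟨w, a, b⟩ := h.square h₂ h₁; exact ⟨w, b, a⟩
  wellFounded_r := h.wellFounded_c
  wellFounded_c := h.wellFounded_r
  wc_r h₁ := (h.wr_c h₁).symm
  wr_c h₁ := (h.wc_r h₁).symm
  ext_c h₁ h₂ h₃ h₄ := h.ext_r h₂ h₁ h₄ h₃
  ext_r h₁ h₂ h₃ h₄ := h.ext_c h₂ h₁ h₄ h₃

theorem exists_lower (hxy : Conn r x y) (hx : c j x z) : ∃ w, Conn r z w ∧ c j y w :=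
  hxy.exists_of_square (fun _ _ _ _ => h.square) (fun _ _ _ _ => h.square_raise_row) hx

theorem exists_raise (hxy : Conn r x y) (hx : c j z x) : ∃ w, Conn r z w ∧ c j w y :=
  hxy.exists_of_square (s := fun x z => c j z x) (fun _ _ _ _ => h.square_raise_col)
    (fun _ _ _ _ => h.square_raise_both) hx

theorem isLow_of_conn (hxy : Conn r x y) (hx : IsLow c x) : IsLow c y := fun j _ hz =>
  let ⟨w, _, hw⟩ := h.exists_lower hxy.symm hz
  hx j w hw

theorem isHigh_of_conn (hxy : Conn c x y) (hx : IsHigh r x) : IsHigh r y :=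
  h.dual.isLow_of_conn (conn_flip.2 hxy) hx

theorem isHigh_col_of_conn (hxy : Conn r x y) (hx : IsHigh c x) : IsHigh c y := fun j _ hz =>
  let ⟨w, _, hw⟩ := h.exists_raise hxy.symm hz
  hx j w hw

theorem wc_conn (hxy : Conn r x y) : wc x = wc y := hxy.apply_eq fun _ _ _ h₁ => h.wc_r h₁

theorem wr_conn (hxy : Conn c x y) : wr x = wr y := hxy.apply_eq fun _ _ _ h₁ => h.wr_c h₁

/-- Lowering columns reduces uniqueness to elements that are lowest for columns. -/
theorem high_unique (hxy : Conn r x y) (hx : IsHigh r x) (hy : IsHigh r y) : x = y := by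
  induction x using h.wellFounded_c.induction generalizing y with
  | _ x ih =>
    by_cases hlow : IsLow c x
    · exact h.ext_c hx hlow hy (h.isLow_of_conn hxy hlow) (h.wc_conn hxy)
    · simp only [IsLow, not_forall, not_not] at hlow
      obtain ⟨j, x', hx'⟩ := hlow
      obtain ⟨y', hxy', hy'⟩ := h.exists_lower hxy hx'
      obtain rfl := ih x' ⟨j, hx'⟩ hxy' (h.isHigh_of_conn (.single hx') hx)
        (h.isHigh_of_conn (.single hy') hy)
      exact h.c_inj hx' hy'

theorem exists_high (x : X) :
    ∃ y, Relation.ReflTransGen (fun a b => ∃ i, r i b a) x y ∧ IsHigh r y := by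
  induction x using h.wellFounded_r.induction with
  | _ x ih =>
    by_cases hx : IsHigh r x
    · exact ⟨x, .refl, hx⟩
    · simp only [IsHigh, not_forall, not_not] at hx
      obtain ⟨i, z, hz⟩ := hx
      obtain ⟨y, hy, hhigh⟩ := ih z ⟨i, hz⟩
      exact ⟨y, .head ⟨i, hz⟩ hy, hhigh⟩

/-- The highest element in the row component of `x`. -/
noncomputable def hi (x : X) : X := (h.exists_high x).choose

theorem raise_hi (x : X) : Relation.ReflTransGen (fun a b => ∃ i, r i b a) x (h.hi x) :=
  (h.exists_high x).choose_spec.1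

theorem isHigh_hi (x : X) : IsHigh r (h.hi x) := (h.exists_high x).choose_spec.2

theorem conn_hi (x : X) : Conn r x (h.hi x) := conn_of_raise (h.raise_hi x)

/-- The lowest element in the column component of `x`. -/
noncomputable def lo (x : X) : X := h.dual.hi x

theorem lower_lo (x : X) : Relation.ReflTransGen (fun a b => ∃ j, c j a b) x (h.lo x) :=
  h.dual.raise_hi x

theorem isLow_lo (x : X) : IsLow c (h.lo x) := h.dual.isHigh_hi x

theorem conn_lo (x : X) : Conn c x (h.lo x) := conn_flip.1 (h.dual.conn_hi x)

theorem hi_eq (hxy : Conn r x y) (hy : IsHigh r y) : h.hi x = y :=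
  h.high_unique ((h.conn_hi x).symm.trans hxy) (h.isHigh_hi x) hy

theorem lo_eq (hxy : Conn c x y) (hy : IsLow c y) : h.lo x = y :=
  h.dual.hi_eq (conn_flip.2 hxy) hy

theorem hi_eq_hi_iff : h.hi x = h.hi y ↔ Conn r x y :=
  ⟨fun hxy => (h.conn_hi x).trans (hxy ▸ (h.conn_hi y).symm),
    fun hxy => h.hi_eq (hxy.trans (h.conn_hi y)) (h.isHigh_hi y)⟩

theorem lo_eq_lo_iff : h.lo x = h.lo y ↔ Conn c x y := h.dual.hi_eq_hi_iff.trans conn_flip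

theorem lo_self (hx : IsLow c x) : h.lo x = x := h.lo_eq (.refl _) hx

theorem c_hi (hxy : c j x y) : c j (h.hi x) (h.hi y) := by
  obtain ⟨z, hyz, hz⟩ := h.exists_lower (h.conn_hi x) hxy
  rwa [h.hi_eq hyz (h.isHigh_of_conn (.single hz) (h.isHigh_hi x))]

theorem r_lo (hxy : r i x y) : r i (h.lo x) (h.lo y) := h.dual.c_hi hxy

theorem conn_hi_hi (hxy : Conn c x y) : Conn c (h.hi x) (h.hi y) :=
  eqvGen_lift (fun _ _ ⟨_, hr⟩ => .rel _ _ ⟨_, h.c_hi hr⟩) hxy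

theorem isLow_hi (hx : IsLow c x) : IsLow c (h.hi x) := h.isLow_of_conn (h.conn_hi x) hx

theorem isHigh_lo (hx : IsHigh r x) : IsHigh r (h.lo x) := h.isHigh_of_conn (h.conn_lo x) hx

theorem lo_hi (x : X) : h.lo (h.hi x) = h.hi (h.lo x) :=
  h.lo_eq (h.conn_hi_hi (h.conn_lo x)) (h.isLow_hi (h.isLow_lo x))

theorem ext_hi_lo (h₁ : h.hi x = h.hi y) (h₂ : h.lo x = h.lo y) : x = y := by
  induction x using h.wellFounded_c.induction generalizing y with
  | _ x ih =>
    have hxy := h.hi_eq_hi_iff.1 h₁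
    by_cases hlow : IsLow c x
    · rw [← h.lo_self hlow, h₂, h.lo_self (h.isLow_of_conn hxy hlow)]
    · simp only [IsLow, not_forall, not_not] at hlow
      obtain ⟨j, x', hx'⟩ := hlow
      obtain ⟨y', hxy', hy'⟩ := h.exists_lower hxy hx'
      obtain rfl := ih x' ⟨j, hx'⟩ (h.hi_eq_hi_iff.2 hxy') (by
        rw [← h.lo_eq_lo_iff.2 (.single hx'), ← h.lo_eq_lo_iff.2 (.single hy'), h₂])
      exact h.c_inj hx' hy'

theorem exists_hi_lo (hp : IsHigh r p) (hq : IsLow c q) (hpq : h.lo p = h.hi q) :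
    ∃ x, h.hi x = p ∧ h.lo x = q := by
  induction p using h.wellFounded_c.induction with
  | _ p ih =>
    by_cases hlow : IsLow c p
    · exact ⟨q, by rw [← hpq, h.lo_self hlow], h.lo_self hq⟩
    · simp only [IsLow, not_forall, not_not] at hlow
      obtain ⟨j, p', hp'⟩ := hlow
      obtain ⟨x', hx₁, hx₂⟩ := ih p' ⟨j, hp'⟩ (h.isHigh_of_conn (.single hp') hp)
        (by rw [← h.lo_eq_lo_iff.2 (.single hp'), hpq])
      obtain ⟨x, hpx, hx⟩ := h.exists_raise (hx₁ ▸ h.conn_hi x' : Conn r x' p').symm hp'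
      exact ⟨x, h.hi_eq hpx.symm hp, by rw [h.lo_eq_lo_iff.2 (.single hx), hx₂]⟩

theorem c_of_hi (h₁ : c j (h.hi x) (h.hi y)) (h₂ : h.lo x = h.lo y) : c j x y := by
  obtain ⟨z, hyz, hz⟩ := h.exists_raise (h.conn_hi y).symm h₁
  have hxz : h.hi z = h.hi x := h.hi_eq hyz.symm (h.isHigh_hi x)
  rwa [← h.ext_hi_lo hxz (by rw [h.lo_eq_lo_iff.2 (.single hz), h₂])]

theorem r_of_lo (h₁ : r i (h.lo x) (h.lo y)) (h₂ : h.hi x = h.hi y) : r i x y :=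
  h.dual.c_of_hi h₁ h₂.symm

end DoubleCrystal

end DoubleCrystals

/-! ## Matrices as a double crystal -/

section MatrixDoubleCrystal

variable {d k n m : ℕ}

theorem antitone_iff_sndIdx_le {α : Type*} [Preorder α] {f : Fin k → α} :
    Antitone f ↔ ∀ i, f (sndIdx i) ≤ f (fstIdx i) := by
  cases k with
  | zero => exact iff_of_true (fun a => a.elim0) fun i => i.elim0
  | succ k => exact Fin.antitone_iff_succ_le

theorem eq_true_iff_lt_sum_of_antitone {f : Fin d → Bool} (hf : Antitone f) (s : Fin d) :
    f s = true ↔ (s.1 : ℤ) < ∑ r, (f r).toInt := by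
  have hsum : ∑ r, (f r).toInt = (Finset.univ.filter fun r => f r = true).card := by
    simp [toInt_eq_ite]
  rw [hsum, Nat.cast_lt]
  constructor
  · intro hs
    have h : Finset.Iic s ⊆ Finset.univ.filter fun r => f r = true := fun r hr =>
      Finset.mem_filter.2 ⟨Finset.mem_univ r, hf (Finset.mem_Iic.1 hr) hs⟩
    simpa only [Fin.card_Iic, Nat.succ_le_iff] using Finset.card_le_card h
  · contrapose!
    intro hs
    have h : Finset.univ.filter (fun r => f r = true) ⊆ Finset.Iio s := fun r hr =>
      Finset.mem_Iio.2 <| not_le.1 fun hsr => hs (hf hsr (Finset.mem_filter.1 hr).2)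
    simpa only [Fin.card_Iio] using Finset.card_le_card h

theorem eq_true_iff_lt_sum_of_monotone {f : Fin d → Bool} (hf : Monotone f) (s : Fin d) :
    f s = true ↔ (s.rev.1 : ℤ) < ∑ r, (f r).toInt := by
  rw [← Equiv.sum_comp Fin.revPerm]
  simpa using eq_true_iff_lt_sum_of_antitone (f := fun r => f r.rev)
    (fun _ _ h => hf (Fin.rev_le_rev.2 h)) s.rev

theorem eq_true_of_colCount_le {b : Mat d k} {x y : Fin k} {r : Fin d}
    (h : ∀ s < r, b s x = true → b s y = true)
    (hle : colCount b y (r.1 + 1) ≤ colCount b x (r.1 + 1)) (hy : b r y = true) :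
    b r x = true := by
  by_contra hx
  rw [Bool.not_eq_true] at hx
  refine hle.not_gt (Finset.sum_lt_sum (fun s hs => ?_) ⟨r, by simp, by simp [hx, hy]⟩)
  have hs : s ≤ r := Fin.le_def.2 (Nat.lt_succ_iff.1 (Finset.mem_filter.1 hs).2)
  rcases hs.eq_or_lt with rfl | hs
  · simp [hx, hy]
  · cases hsx : b s x
    · cases b s y <;> simp
    · simp [h s hs hsx]

/-- The lowering arrows of the column structure. -/
def ColLower (p : Fin (n - 1)) (M X : Mat n m) : Prop := Lower p (quarterTurn M) (quarterTurn X)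

/-- The weight of the row structure. -/
def columnSums (M : Mat n m) (x : Fin m) : ℤ := ∑ r, (M r x).toInt

/-- The weight of the column structure. -/
def rowSums (M : Mat n m) (r : Fin n) : ℤ := ∑ x, (M r x).toInt

theorem colCount_eq_columnSums (M : Mat n m) (x : Fin m) : colCount M x n = columnSums M x :=
  colCount_eq_sum M x

theorem rowSums_quarterTurn (M : Mat n m) (x : Fin m) :
    rowSums (quarterTurn M) x = columnSums M x.rev := rfl

theorem columnSums_quarterTurn (M : Mat n m) (r : Fin n) :
    columnSums (quarterTurn M) r = rowSums M r :=
  Equiv.sum_comp Fin.revPerm fun x => (M r x).toInt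

theorem columnSums_halfTurn (M : Mat n m) (x : Fin m) :
    columnSums (halfTurn M) x = columnSums M x.rev :=
  Equiv.sum_comp Fin.revPerm fun r => (M r x.rev).toInt

theorem rowSums_halfTurn (M : Mat n m) (r : Fin n) :
    rowSums (halfTurn M) r = rowSums M r.rev := by
  rw [← columnSums_quarterTurn, quarterTurn_halfTurn, columnSums_halfTurn, columnSums_quarterTurn]

theorem colCount_quarterTurn (M : Mat n m) (r : Fin n) {t : ℕ} (ht : t ≤ m) :
    colCount (quarterTurn M) r t =
      colCount (Function.swap M) r m - colCount (Function.swap M) r (m - t) := by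
  simpa [halfTurn, quarterTurn, Function.swap, colCount] using
    colCount_halfTurn (fun c y => M y.rev c) r ht

theorem isHigh_lower_iff {M : Mat n m} :
    IsHigh Lower M ↔ ∀ t ≤ n, Antitone fun x => colCount M x t := by
  simp only [IsHigh, not_lower_left_iff, antitone_iff_sndIdx_le]
  exact ⟨fun h t ht i => h i t ht, fun h i t ht => h t ht i⟩

theorem isHigh_colLower_iff {M : Mat n m} :
    IsHigh ColLower M ↔ IsHigh Lower (quarterTurn M) :=
  forall_congr' fun p =>
    (quarterTurn_surjective.forall (p := fun X => ¬ Lower p X (quarterTurn M))).symm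

theorem isLow_colLower_iff {M : Mat n m} : IsLow ColLower M ↔ IsLow Lower (quarterTurn M) :=
  forall_congr' fun p =>
    (quarterTurn_surjective.forall (p := fun X => ¬ Lower p (quarterTurn M) X)).symm

theorem Lower.halfTurn {i : Fin (k - 1)} {b b' : Mat d k} (h : Lower i b b') :
    Lower i.rev (halfTurn b') (halfTurn b) :=
  lower_halfTurn_iff.2 h

theorem ColLower.halfTurn {p : Fin (n - 1)} {M X : Mat n m} (h : ColLower p M X) :
    ColLower p.rev (halfTurn X) (halfTurn M) :=
  Lower.halfTurn h

theorem isHigh_lower_halfTurn_iff {M : Mat n m} : IsHigh Lower (halfTurn M) ↔ IsLow Lower M := by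
  refine ⟨fun h i z hz => h i.rev (halfTurn z) hz.halfTurn, fun h i z hz => ?_⟩
  have hz := hz.halfTurn
  rw [halfTurn_halfTurn] at hz
  exact h i.rev _ hz

theorem isHigh_colLower_halfTurn_iff {M : Mat n m} :
    IsHigh ColLower (halfTurn M) ↔ IsLow ColLower M := by
  rw [isHigh_colLower_iff, isLow_colLower_iff, quarterTurn_halfTurn, isHigh_lower_halfTurn_iff]

theorem isLow_colLower_quarterTurn_iff {M : Mat n m} :
    IsLow ColLower (quarterTurn M) ↔ IsHigh Lower M := by
  rw [isLow_colLower_iff, ← isHigh_lower_halfTurn_iff, quarterTurn_quarterTurn, halfTurn_halfTurn]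

theorem monotone_colCount_swap {M : Mat n m} (h : IsLow ColLower M) {t : ℕ} (ht : t ≤ m) :
    Monotone fun r => colCount (Function.swap M) r t := by
  suffices h : Antitone fun r => -colCount (Function.swap M) r t from
    fun r r' hr => neg_le_neg_iff.1 (h hr)
  refine antitone_iff_sndIdx_le.2 fun p => ?_
  have h₁ := (not_lower_right_iff p (quarterTurn M)).1 (isLow_colLower_iff.1 h p) _ (m.sub_le t)
  simp only [height, colCount_quarterTurn M _ (m.sub_le t), colCount_quarterTurn M _ le_rfl,
    Nat.sub_sub_self ht, Nat.sub_self, colCount_zero] at h₁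
  omega

theorem eq_true_of_bottom_justified {M : Mat n m} (h : IsHigh Lower M) {r : Fin n} {c c' : Fin m}
    (hc : c' ≤ c) (hbot : ∀ s ≤ r, M s c' = true → M r c' = true) (hM : M r c = true) :
    M r c' = true := by
  by_contra hM'
  exact hM' (eq_true_of_colCount_le (fun s hs hsc => absurd (hbot s hs.le hsc) hM')
    (isHigh_lower_iff.1 h _ r.2 hc) hM)

theorem monotone_column {M : Mat n m} (h₁ : IsHigh Lower M) (h₂ : IsLow ColLower M) (c : Fin m) :
    Monotone fun r => M r c := by
  induction c using WellFoundedLT.induction with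
  | _ c ih =>
    refine fun r r' hr hM => eq_true_of_colCount_le (b := Function.swap M) (x := r') (y := r)
      (fun c' hc' _ => ?_) (monotone_colCount_swap h₂ c.2 hr) hM
    exact eq_true_of_bottom_justified h₁ hc'.le (fun s hs => ih c' hc' hs) hM

theorem antitone_row {M : Mat n m} (h₁ : IsHigh Lower M) (h₂ : IsLow ColLower M) (r : Fin n) :
    Antitone (M r) := fun c' _ hc hM =>
  eq_true_of_bottom_justified h₁ hc (fun _ hs => monotone_column h₁ h₂ c' hs) hM

theorem eq_true_of_top_justified {M : Mat n m} (h : IsHigh Lower M) {r : Fin n} {c c' : Fin m}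
    (hc : c' ≤ c) (htop : ∀ s ≤ r, M r c = true → M s c = true) (hM : M r c = true) :
    M r c' = true :=
  eq_true_of_colCount_le (fun s hs _ => htop s hs.le hM) (isHigh_lower_iff.1 h _ r.2 hc) hM

theorem antitone_column {M : Mat n m} (h₁ : IsHigh Lower M) (h₂ : IsHigh ColLower M) (c : Fin m) :
    Antitone fun r => M r c := by
  induction c using WellFoundedGT.induction with
  | _ c ih =>
    intro r' r hr hM
    by_contra hM'
    refine hM' ?_
    have h := eq_true_of_colCount_le (b := quarterTurn M) (x := r') (y := r) (r := c.rev)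
      (fun s hs hsM => absurd (eq_true_of_top_justified h₁ (Fin.lt_rev_iff.1 hs).le
        (fun _ h => ih s.rev (Fin.lt_rev_iff.1 hs) h) hsM) hM')
      (isHigh_lower_iff.1 (isHigh_colLower_iff.1 h₂) _ c.rev.2 hr)
    simpa [quarterTurn, hM] using h

theorem antitone_row_of_isHigh {M : Mat n m} (h₁ : IsHigh Lower M) (h₂ : IsHigh ColLower M)
    (r : Fin n) : Antitone (M r) := fun _ c hc hM =>
  eq_true_of_top_justified h₁ hc (fun _ hs => antitone_column h₁ h₂ c hs) hM

theorem eq_true_iff_lt_rowSums {M : Mat n m} (h₁ : IsHigh Lower M) (h₂ : IsLow ColLower M)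
    (r : Fin n) (c : Fin m) : M r c = true ↔ (c.1 : ℤ) < rowSums M r :=
  eq_true_iff_lt_sum_of_antitone (antitone_row h₁ h₂ r) c

theorem eq_true_iff_lt_columnSums {M : Mat n m} (h₁ : IsHigh Lower M) (h₂ : IsLow ColLower M)
    (r : Fin n) (c : Fin m) : M r c = true ↔ (r.rev.1 : ℤ) < columnSums M c :=
  eq_true_iff_lt_sum_of_monotone (monotone_column h₁ h₂ c) r

theorem Lower.columnSums_right {i : Fin (m - 1)} {M X : Mat n m} (h : Lower i M X) :
    columnSums X = columnSums M - root i :=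
  funext fun x => by
    simpa only [colCount_eq_columnSums, Pi.sub_apply] using h.colCount_right x

theorem Lower.rowSums_right {i : Fin (m - 1)} {M X : Mat n m} (h : Lower i M X) :
    rowSums X = rowSums M := by
  obtain ⟨s, h⟩ := h
  funext r
  simp only [rowSums, h.toInt_eq, Finset.sum_sub_distrib]
  split_ifs <;> simp [root, Finset.sum_sub_distrib]

theorem ColLower.rowSums_right {p : Fin (n - 1)} {M X : Mat n m} (h : ColLower p M X) :
    rowSums X = rowSums M - root p :=
  funext fun r => by
    simpa only [columnSums_quarterTurn, Pi.sub_apply] using congrFun (Lower.columnSums_right h) r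

theorem ColLower.columnSums_right {p : Fin (n - 1)} {M X : Mat n m} (h : ColLower p M X) :
    columnSums X = columnSums M :=
  funext fun x => by
    simpa only [rowSums_quarterTurn, Fin.rev_rev] using congrFun (Lower.rowSums_right h) x.rev

theorem weightMoment_lt_of_eq_sub_root {v w : Fin k → ℤ} {i : Fin (k - 1)} (h : w = v - root i) :
    weightMoment v < weightMoment w := by
  rw [← sub_add_cancel v (root i), ← h, weightMoment_add, weightMoment_root]; omega

theorem doubleCrystal (n m : ℕ) :
    DoubleCrystal (X := Mat n m) Lower ColLower columnSums rowSums where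
  r_fun h₁ h₂ := Lower.unique_right h₁ h₂
  r_inj h₁ h₂ := Lower.unique_left h₁ h₂
  c_fun h₁ h₂ := quarterTurn_injective (Lower.unique_right h₁ h₂)
  c_inj h₁ h₂ := quarterTurn_injective (Lower.unique_left h₁ h₂)
  square h₁ h₂ := lower_square h₁ h₂
  square_raise_row h₁ h₂ := lower_square_raise_row h₁ h₂
  square_raise_col h₁ h₂ := lower_square_raise_col h₁ h₂
  square_raise_both h₁ h₂ := lower_square_raise_both h₁ h₂
  wellFounded_r := wellFounded_of_forall_lt (fun M => weightMoment (columnSums M))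
    fun _ _ ⟨_, h⟩ => weightMoment_lt_of_eq_sub_root h.columnSums_right
  wellFounded_c := wellFounded_of_forall_lt (fun M => -weightMoment (rowSums M))
    fun _ _ ⟨_, h⟩ => neg_lt_neg (weightMoment_lt_of_eq_sub_root h.rowSums_right)
  wc_r h := h.rowSums_right.symm
  wr_c h := h.columnSums_right.symm
  ext_c h₁ h₂ h₃ h₄ h := by
    funext r c
    rw [Bool.eq_iff_iff, eq_true_iff_lt_rowSums h₁ h₂, eq_true_iff_lt_rowSums h₃ h₄, h]
  ext_r h₁ h₂ h₃ h₄ h := by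
    funext r c
    rw [Bool.eq_iff_iff, eq_true_iff_lt_columnSums h₁ h₂, eq_true_iff_lt_columnSums h₃ h₄, h]

theorem conn_lower_halfTurn {M X : Mat n m} (h : Conn Lower M X) :
    Conn Lower (halfTurn M) (halfTurn X) :=
  eqvGen_lift (fun _ _ ⟨_, h⟩ => (Conn.single h.halfTurn).symm) h

theorem conn_colLower_halfTurn {M X : Mat n m} (h : Conn ColLower M X) :
    Conn ColLower (halfTurn M) (halfTurn X) :=
  eqvGen_lift (fun _ _ ⟨_, h⟩ => (Conn.single h.halfTurn).symm) h

/-- The highest weight matrix reached from `M` by row raising operators. -/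
noncomputable def rowHighest (M : Mat n m) : Mat n m := (doubleCrystal n m).hi M

/-- The lowest weight matrix reached from `M` by column lowering operators. -/
noncomputable def colLowest (M : Mat n m) : Mat n m := (doubleCrystal n m).lo M

theorem colLowest_rowHighest (M : Mat n m) :
    colLowest (rowHighest M) = rowHighest (colLowest M) :=
  (doubleCrystal n m).lo_hi M

theorem colLowest_rowHighest_halfTurn_of_extremal {E : Mat n m} (h₁ : IsHigh Lower E)
    (h₂ : IsLow ColLower E) : colLowest (rowHighest (halfTurn E)) = E := by
  have D := doubleCrystal n m
  have hr : IsHigh Lower (rowHighest (halfTurn E)) := D.isHigh_hi _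
  have hc : IsHigh ColLower (rowHighest (halfTurn E)) :=
    D.isHigh_col_of_conn (D.conn_hi _) (isHigh_colLower_halfTurn_iff.2 h₂)
  have hflip : rowHighest (halfTurn E) = fun r => E r.rev := by
    have hw : rowSums (halfTurn E) = rowSums (rowHighest (halfTurn E)) :=
      D.wc_conn (D.conn_hi (halfTurn E))
    funext r c
    rw [Bool.eq_iff_iff, eq_true_iff_lt_sum_of_antitone (antitone_row_of_isHigh hr hc r),
      eq_true_iff_lt_rowSums h₁ h₂, ← rowSums_halfTurn, hw, rowSums]
  refine D.ext_r (D.isHigh_lo hr) (D.isLow_lo _) h₁ h₂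
    ((D.wr_conn (D.conn_lo (rowHighest (halfTurn E)))).symm.trans ?_)
  rw [hflip]
  exact funext fun c => Equiv.sum_comp Fin.revPerm fun r => (E r c).toInt

theorem colLowest_rowHighest_halfTurn (M : Mat n m) :
    colLowest (rowHighest (halfTurn M)) = colLowest (rowHighest M) := by
  have D := doubleCrystal n m
  have h₁ : rowHighest (halfTurn M) = rowHighest (halfTurn (rowHighest M)) :=
    D.hi_eq_hi_iff.2 (conn_lower_halfTurn (D.conn_hi M))
  have h₂ : colLowest (halfTurn (rowHighest M)) =
      colLowest (halfTurn (colLowest (rowHighest M))) :=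
    D.lo_eq_lo_iff.2 (conn_colLower_halfTurn (D.conn_lo _))
  rw [h₁, colLowest_rowHighest, h₂, ← colLowest_rowHighest]
  exact colLowest_rowHighest_halfTurn_of_extremal (D.isHigh_lo (D.isHigh_hi _)) (D.isLow_lo _)

end MatrixDoubleCrystal

/-! ## The Schützenberger involution of a tensor power -/

section TensorPowInvolution

variable {d k n m : ℕ}

theorem eq_of_conn {M X : Mat n m} (h₁ : Conn Lower M X) (h₂ : Conn ColLower M X) : M = X :=
  have D := doubleCrystal n m
  D.ext_hi_lo (D.hi_eq_hi_iff.2 h₁) (D.lo_eq_lo_iff.2 h₂)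

theorem exists_conn_halfTurn (M : Mat n m) :
    ∃ X, Conn Lower M X ∧ Conn ColLower X (halfTurn M) := by
  have D := doubleCrystal n m
  obtain ⟨X, h₁, h₂⟩ := D.exists_hi_lo (D.isHigh_hi M) (D.isLow_lo (halfTurn M))
    ((colLowest_rowHighest_halfTurn M).symm.trans (colLowest_rowHighest (halfTurn M)))
  exact ⟨X, D.hi_eq_hi_iff.1 h₁.symm, D.lo_eq_lo_iff.1 h₂⟩

/-- The Schützenberger involution of the row structure: the unique matrix in the row component
of `M` and in the column component of the half turn of `M`. -/
noncomputable def rowSchutz (M : Mat n m) : Mat n m := (exists_conn_halfTurn M).choose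

theorem conn_lower_rowSchutz (M : Mat n m) : Conn Lower M (rowSchutz M) :=
  (exists_conn_halfTurn M).choose_spec.1

theorem conn_colLower_rowSchutz (M : Mat n m) : Conn ColLower (rowSchutz M) (halfTurn M) :=
  (exists_conn_halfTurn M).choose_spec.2

theorem conn_colLower_rowSchutz_halfTurn (M : Mat n m) :
    Conn ColLower (rowSchutz (halfTurn M)) M := by
  simpa only [halfTurn_halfTurn] using conn_colLower_rowSchutz (halfTurn M)

theorem rowSchutz_rowSchutz : Function.Involutive (rowSchutz : Mat n m → Mat n m) := fun M => by
  refine eq_of_conn ((conn_lower_rowSchutz M).trans (conn_lower_rowSchutz _)).symm ?_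
  simpa only [halfTurn_halfTurn] using
    (conn_colLower_rowSchutz (rowSchutz M)).trans
      (conn_colLower_halfTurn (conn_colLower_rowSchutz M))

theorem Lower.rowSchutz {i : Fin (m - 1)} {M X : Mat n m} (h : Lower i M X) :
    Lower i.rev (rowSchutz X) (rowSchutz M) := by
  have D := doubleCrystal n m
  have hMX : Conn Lower (GLCrystal.rowSchutz X) (GLCrystal.rowSchutz M) :=
    ((conn_lower_rowSchutz X).symm.trans (Conn.single h).symm).trans (conn_lower_rowSchutz M)
  refine D.r_of_lo ?_ (D.hi_eq_hi_iff.2 hMX)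
  rw [D.lo_eq_lo_iff.2 (conn_colLower_rowSchutz X), D.lo_eq_lo_iff.2 (conn_colLower_rowSchutz M)]
  exact D.r_lo h.halfTurn

theorem columnSums_rowSchutz (M : Mat n m) (x : Fin m) :
    columnSums (rowSchutz M) x = columnSums M x.rev := by
  rw [(doubleCrystal n m).wr_conn (conn_colLower_rowSchutz M), columnSums_halfTurn]

theorem rowSchutz_quarterTurn (M : Mat n m) :
    rowSchutz (quarterTurn M) = quarterTurn (rowSchutz (halfTurn M)) := by
  have hcol : Conn Lower (quarterTurn M) (quarterTurn (rowSchutz (halfTurn M))) :=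
    eqvGen_lift (fun _ _ ⟨i, h⟩ => .rel _ _ ⟨i, h⟩) (conn_colLower_rowSchutz_halfTurn M).symm
  have hrow : Conn ColLower (quarterTurn (halfTurn M))
      (quarterTurn (rowSchutz (halfTurn M))) :=
    eqvGen_lift (fun _ _ ⟨i, h⟩ => .symm _ _ (.rel _ _ ⟨i.rev, h.halfTurn⟩))
      (conn_lower_rowSchutz (halfTurn M))
  exact eq_of_conn ((conn_lower_rowSchutz _).symm.trans hcol)
    ((conn_colLower_rowSchutz (quarterTurn M)).trans hrow)

theorem connected_tensorPow_iff {b b' : Mat d k} :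
    Connected (tensorPow (vecCrystal k) d) 0 (k - 1) b b' ↔ Conn Lower b b' := by
  simp only [Connected, Conn, tensorPow_f_iff, Nat.zero_le, Fin.is_lt, true_and]

theorem isHighestWeight_tensorPow_iff {b : Mat d k} :
    IsHighestWeight (tensorPow (vecCrystal k) d) 0 (k - 1) b ↔ IsHigh Lower b := by
  simp only [IsHighestWeight, IsHigh, tensorPow_e_eq_none_iff, Nat.zero_le, Fin.is_lt,
    forall_const]

theorem uniqueHighest_tensorPow (d k : ℕ) :
    UniqueHighest (tensorPow (vecCrystal k) d) 0 (k - 1) := fun _ _ hbc hb hc =>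
  (doubleCrystal d k).high_unique (connected_tensorPow_iff.1 hbc)
    (isHighestWeight_tensorPow_iff.1 hb) (isHighestWeight_tensorPow_iff.1 hc)

theorem isSchutzenberger_rowSchutz (n m : ℕ) :
    IsSchutzenberger (tensorPow (vecCrystal m) n) 0 (m - 1) rowSchutz := by
  refine isSchutzenberger_of_involutive (isCrystal_tensorPow n m)
    (fun M => connected_tensorPow_iff.2 (conn_lower_rowSchutz M)) rowSchutz_rowSchutz
    (fun i j _ _ hij M X h => ?_) (fun x y _ _ hxy M => ?_) (fun x hx M => by omega)
  · obtain rfl : j = i.rev := by ext; rw [Fin.val_rev]; omega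
    rw [tensorPow_f_iff] at h ⊢
    exact h.rowSchutz
  · obtain rfl : y = x.rev := by ext; rw [Fin.val_rev]; omega
    rw [tensorPow_wt, tensorPow_wt, colCount_eq_columnSums, colCount_eq_columnSums,
      columnSums_rowSchutz]

theorem xi_tensorPow (n m : ℕ) : xi (tensorPow (vecCrystal m) n) = rowSchutz :=
  (isSchutzenberger_rowSchutz n m).partialXi_eq (isCrystal_tensorPow n m)
    (uniqueHighest_tensorPow n m) le_rfl

theorem isStrictMorphism_tensorPow_one {B : Type*} {C : CrystalData k B}
    (heps : ∀ i b, 0 ≤ C.eps i b) (hphi : ∀ i b, 0 ≤ C.phi i b) :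
    IsStrictMorphism C (tensorPow C 1) fun b _ => b := by
  have hlt (s t : Fin 1) : ¬ s < t := by omega
  have hepsAt (i b) : tensorEpsAt C i (fun _ : Fin 1 => b) = fun _ => C.eps i b := by
    funext s
    simp [tensorEpsAt, corootPairing, hlt]
  have hphiAt (i b) : tensorPhiAt C i (fun _ : Fin 1 => b) = fun _ => C.phi i b := by
    funext s
    simp [tensorPhiAt, corootPairing, hlt]
  have heps' (i b) : tensorEps C i (fun _ : Fin 1 => b) = C.eps i b := by
    simp [tensorEps, hepsAt, heps]
  have hphi' (i b) : tensorPhi C i (fun _ : Fin 1 => b) = C.phi i b := by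
    simp [tensorPhi, hphiAt, hphi]
  have hupdate (b : B) : Function.update (fun _ : Fin 1 => b) 0 = fun c _ => c := by
    funext c s
    rw [Subsingleton.elim s 0, Function.update_self]
  constructor
  · exact fun b => by simp [tensorPow]
  · exact heps'
  · exact hphi'
  · intro i b
    simp [tensorPow, hepsAt, heps', hupdate, List.finRange_succ]
  · intro i b
    simp [tensorPow, hphiAt, hphi', hupdate, List.finRange_succ]

theorem isStrictMorphism_vecCrystal (k : ℕ) :
    IsStrictMorphism (vecCrystal k) (tensorPow (vecCrystal k) 1) fun v _ => v :=
  isStrictMorphism_tensorPow_one (fun i v => by simp only [vecCrystal]; split_ifs <;> simp)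
    (fun i v => by simp only [vecCrystal]; split_ifs <;> simp)

theorem IsSchutzenberger.vecCrystal_apply {ξ : (Fin k → Bool) → Fin k → Bool}
    (h : IsSchutzenberger (vecCrystal k) 0 (k - 1) ξ) (v : Fin k → Bool) (x : Fin k) :
    ξ v x = v x.rev := by
  have hwt := h.wt_inside x x.rev (Nat.zero_le _) (by omega) (by rw [Fin.val_rev]; omega) v
  simp only [vecCrystal, ← toInt_eq_ite] at hwt
  exact toInt_injective hwt

theorem existsUnique_isSchutzenberger_vecCrystal (k : ℕ) :
    ∃! ξ, IsSchutzenberger (vecCrystal k) 0 (k - 1) ξ := by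
  obtain ⟨ξ, _, hξ⟩ := (isStrictMorphism_vecCrystal k).exists_isSchutzenberger_of_injective
    (Function.const_injective) (isCrystal_tensorPow 1 k) (isSchutzenberger_rowSchutz 1 k)
  exact ⟨ξ, hξ, fun ζ hζ => funext fun v => funext fun x => by
    rw [hζ.vecCrystal_apply, hξ.vecCrystal_apply]⟩

theorem xi_vecCrystal (v : Fin k → Bool) (x : Fin k) : xi (vecCrystal k) v x = v x.rev :=
  (existsUnique_isSchutzenberger_vecCrystal k).exists.choose_spec.partialXi.vecCrystal_apply v x

section Window

variable {K p : ℕ}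

/-- The columns `p, …, p + K - 1` of a matrix. -/
def window (h : p + K ≤ k) (b : Mat d k) : Mat d K := fun s x => b s ⟨p + x.1, by omega⟩

/-- The matrix `b` with its columns `p, …, p + K - 1` replaced by `y`. -/
def replaceWindow (p : ℕ) (b : Mat d k) (y : Mat d K) : Mat d k :=
  fun s x => if h : p ≤ x.1 ∧ x.1 < p + K then y s ⟨x.1 - p, by omega⟩ else b s x

/-- The two matrices agree outside the columns `p, …, p + K - 1`. -/
def AgreeOutside (p K : ℕ) (b b' : Mat d k) : Prop :=
  ∀ s (x : Fin k), (x.1 < p ∨ p + K ≤ x.1) → b' s x = b s x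

theorem AgreeOutside.symm {b b' : Mat d k} (h : AgreeOutside p K b b') : AgreeOutside p K b' b :=
  fun s x hx => (h s x hx).symm

theorem AgreeOutside.trans {b b' b'' : Mat d k} (h : AgreeOutside p K b b')
    (h' : AgreeOutside p K b' b'') : AgreeOutside p K b b'' :=
  fun s x hx => (h' s x hx).trans (h s x hx)

theorem agreeOutside_replaceWindow (b : Mat d k) (y : Mat d K) :
    AgreeOutside p K b (replaceWindow p b y) :=
  fun _ _ _ => dif_neg (by omega)

theorem window_replaceWindow (h : p + K ≤ k) (b : Mat d k) (y : Mat d K) :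
    window h (replaceWindow p b y) = y := by
  funext s x
  simp [window, replaceWindow]

theorem forall_fin_iff_window (h : p + K ≤ k) {P : Fin k → Prop} :
    (∀ x, P x) ↔ (∀ x : Fin K, P ⟨p + x.1, by omega⟩) ∧
      ∀ x : Fin k, (x.1 < p ∨ p + K ≤ x.1) → P x := by
  refine ⟨fun H => ⟨fun x => H _, fun x _ => H x⟩, fun ⟨h₁, h₂⟩ x => ?_⟩
  by_cases hx : p ≤ x.1 ∧ x.1 < p + K
  · simpa only [Nat.add_sub_cancel' hx.1] using h₁ ⟨x.1 - p, by omega⟩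
  · exact h₂ x (by omega)

theorem eq_of_window_eq (h : p + K ≤ k) {b b' : Mat d k} (h₁ : window h b = window h b')
    (h₂ : AgreeOutside p K b b') : b = b' := funext fun s => funext <|
  (forall_fin_iff_window h).2 ⟨congrFun (congrFun h₁ s), fun x hx => (h₂ s x hx).symm⟩

theorem replaceWindow_window (h : p + K ≤ k) (b : Mat d k) :
    replaceWindow p b (window h b) = b :=
  eq_of_window_eq h (window_replaceWindow h _ _) (agreeOutside_replaceWindow _ _).symm

theorem replaceWindow_replaceWindow (b : Mat d k) (y z : Mat d K) :
    replaceWindow p (replaceWindow p b y) z = replaceWindow p b z := by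
  funext s x
  simp only [replaceWindow]
  split_ifs <;> rfl

theorem fstIdx_window (h : p + K ≤ k) {i : Fin (k - 1)} {i' : Fin (K - 1)}
    (hi : i.1 = p + i'.1) : fstIdx i = ⟨p + (fstIdx i').1, by omega⟩ := Fin.ext hi

theorem sndIdx_window (h : p + K ≤ k) {i : Fin (k - 1)} {i' : Fin (K - 1)}
    (hi : i.1 = p + i'.1) : sndIdx i = ⟨p + (sndIdx i').1, by omega⟩ :=
  Fin.ext (congrArg (· + 1) hi)

theorem height_window (h : p + K ≤ k) (b : Mat d k) {i : Fin (k - 1)} {i' : Fin (K - 1)}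
    (hi : i.1 = p + i'.1) : height (window h b) i' = height b i := by
  funext t
  rw [height, height, fstIdx_window h hi, sndIdx_window h hi]
  rfl

theorem lower_iff_window (h : p + K ≤ k) {b b' : Mat d k} {i : Fin (k - 1)} {i' : Fin (K - 1)}
    (hi : i.1 = p + i'.1) :
    Lower i b b' ↔ Lower i' (window h b) (window h b') ∧ AgreeOutside p K b b' := by
  have hroot_in (x : Fin K) : root i ⟨p + x.1, by omega⟩ = root i' x := by
    simp only [root_apply, fstIdx_window h hi, sndIdx_window h hi, Fin.ext_iff,
      Nat.add_left_cancel_iff]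
  have hroot_out (x : Fin k) (hx : x.1 < p ∨ p + K ≤ x.1) : root i x = 0 := by
    have := i'.2
    rw [root_apply, if_neg, if_neg, sub_zero] <;> rintro rfl
    · simp only [sndIdx] at hx; omega
    · simp only [fstIdx] at hx; omega
  constructor
  · rintro ⟨s, H⟩
    refine ⟨⟨s, fun r x => ?_, height_window h b hi ▸ H.isLastMax⟩,
      fun r x hx => toInt_injective ?_⟩
    · rw [← hroot_in]
      exact H.toInt_eq r _
    · rw [H.toInt_eq, hroot_out x hx, ite_self, sub_zero]
  · rintro ⟨⟨s, H⟩, hagree⟩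
    refine ⟨s, fun r => (forall_fin_iff_window h).2 ⟨fun x => ?_, fun x hx => ?_⟩,
      height_window h b hi ▸ H.isLastMax⟩
    · rw [hroot_in]
      exact H.toInt_eq r x
    · rw [hagree r x hx, hroot_out x hx, ite_self, sub_zero]

theorem conn_window_and_agreeOutside (h : p + K ≤ k) {b b' : Mat d k}
    (hc : Connected (tensorPow (vecCrystal k) d) p (p + K - 1) b b') :
    Conn Lower (window h b) (window h b') ∧ AgreeOutside p K b b' := by
  induction hc with
  | refl x => exact ⟨.refl _, fun _ _ _ => rfl⟩
  | symm x y _ ih => exact ⟨ih.1.symm, ih.2.symm⟩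
  | trans x y z _ _ ih₁ ih₂ => exact ⟨ih₁.1.trans ih₂.1, ih₁.2.trans ih₂.2⟩
  | rel x y hxy =>
    obtain ⟨i, hi₁, hi₂, hi⟩ := hxy
    obtain ⟨hlower, hagree⟩ :=
      (lower_iff_window h (i' := ⟨i.1 - p, by omega⟩) (Nat.add_sub_cancel' hi₁).symm).1
        (tensorPow_f_iff.1 hi)
    exact ⟨.single hlower, hagree⟩

theorem lower_replaceWindow (h : p + K ≤ k) (b : Mat d k) {i : Fin (K - 1)} {y y' : Mat d K}
    (hy : Lower i y y') :
    Lower (⟨p + i.1, by omega⟩ : Fin (k - 1)) (replaceWindow p b y) (replaceWindow p b y') := by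
  rw [lower_iff_window h (i' := i) rfl, window_replaceWindow, window_replaceWindow]
  exact ⟨hy, (agreeOutside_replaceWindow _ _).symm.trans (agreeOutside_replaceWindow _ _)⟩

theorem connected_replaceWindow (h : p + K ≤ k) (b : Mat d k) {y y' : Mat d K}
    (hc : Conn Lower y y') :
    Connected (tensorPow (vecCrystal k) d) p (p + K - 1) (replaceWindow p b y)
      (replaceWindow p b y') :=
  eqvGen_lift (fun _ _ ⟨i, hi⟩ => .rel _ _ ⟨⟨p + i.1, by omega⟩, Nat.le_add_right _ _,
    by simp only; omega, tensorPow_f_iff.2 (lower_replaceWindow h b hi)⟩) hc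

theorem isHigh_window (h : p + K ≤ k) {b : Mat d k}
    (hb : IsHighestWeight (tensorPow (vecCrystal k) d) p (p + K - 1) b) :
    IsHigh Lower (window h b) := by
  intro i z hz
  refine tensorPow_e_eq_none_iff.1
    (hb ⟨p + i.1, by omega⟩ (Nat.le_add_right _ _) (by simp only; omega)) (replaceWindow p b z) ?_
  simpa only [replaceWindow_window] using lower_replaceWindow h b hz

theorem uniqueHighest_tensorPow_window (h : p + K ≤ k) :
    UniqueHighest (tensorPow (vecCrystal k) d) p (p + K - 1) := fun b c hbc hb hc => by
  obtain ⟨hconn, hagree⟩ := conn_window_and_agreeOutside h hbc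
  exact eq_of_window_eq h
    ((doubleCrystal d K).high_unique hconn (isHigh_window h hb) (isHigh_window h hc)) hagree

theorem isSchutzenberger_replaceWindow (h : p + K ≤ k) (hK : 0 < K) :
    IsSchutzenberger (tensorPow (vecCrystal k) d) p (p + K - 1)
      (fun b => replaceWindow p b (rowSchutz (window h b))) := by
  refine isSchutzenberger_of_involutive (isCrystal_tensorPow d k) (fun b => ?_) (fun b => ?_)
    (fun i j hi₁ hi₂ hij b c hbc => ?_) (fun x y hx₁ hx₂ hxy b => ?_) (fun x hx b => ?_)
  · simpa only [replaceWindow_window] using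
      connected_replaceWindow h b (conn_lower_rowSchutz (window h b))
  · simp only [window_replaceWindow, replaceWindow_replaceWindow, rowSchutz_rowSchutz _,
      replaceWindow_window]
  · rw [tensorPow_f_iff, lower_iff_window h (i' := ⟨i.1 - p, by omega⟩) (by simp only; omega)]
      at hbc
    rw [tensorPow_f_iff, lower_iff_window h (i' := Fin.rev ⟨i.1 - p, by omega⟩)
      (by simp only [Fin.val_rev]; omega), window_replaceWindow, window_replaceWindow]
    exact ⟨hbc.1.rowSchutz, ((agreeOutside_replaceWindow _ _).symm.trans hbc.2.symm).trans
      (agreeOutside_replaceWindow _ _)⟩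
  · obtain ⟨x', rfl⟩ : ∃ x' : Fin K, x = ⟨p + x'.1, (Nat.add_lt_add_left x'.2 p).trans_le h⟩ :=
      ⟨⟨x.1 - p, by omega⟩, Fin.ext (by simp only; omega)⟩
    obtain rfl : y = ⟨p + x'.rev.1, (Nat.add_lt_add_left x'.rev.2 p).trans_le h⟩ := by
      have := x'.2
      simp only at hxy
      exact Fin.ext (by simp only [Fin.val_rev]; omega)
    rw [tensorPow_wt, tensorPow_wt, colCount_eq_columnSums, colCount_eq_columnSums]
    change columnSums (window h (replaceWindow p b _)) x' = columnSums (window h b) x'.rev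
    rw [window_replaceWindow, columnSums_rowSchutz]
  · rw [tensorPow_wt, tensorPow_wt]
    exact colCount_congr fun s _ => agreeOutside_replaceWindow b _ s x (by omega)

end Window

end TensorPowInvolution

/-! ## Tableaux as highest weight matrices -/

section Tableaux

variable {d k n m : ℕ} {μ : YoungDiagram}

theorem lt_of_mem_of_rowLen_le {i j : ℕ} (hij : (i, j) ∈ μ) (hm : μ.rowLen 0 ≤ m) : j < m :=
  (YoungDiagram.mem_iff_lt_rowLen.1 hij).trans_le ((μ.rowLen_anti 0 i (Nat.zero_le _)).trans hm)

theorem colLen_eq_zero_of_rowLen_le (hm : μ.rowLen 0 ≤ m) {j : ℕ} (hj : m ≤ j) :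
    μ.colLen j = 0 :=
  Nat.eq_zero_of_not_pos fun h =>
    (lt_of_mem_of_rowLen_le (YoungDiagram.mem_iff_lt_colLen.2 h) hm).not_ge hj

theorem youngDiagram_ext_colLen {μ ν : YoungDiagram} (h : ∀ j, μ.colLen j = ν.colLen j) :
    μ = ν := by
  ext ⟨i, j⟩
  rw [YoungDiagram.mem_cells, YoungDiagram.mem_cells, YoungDiagram.mem_iff_lt_colLen,
    YoungDiagram.mem_iff_lt_colLen, h]

theorem card_eq_sum_colLen (hm : μ.rowLen 0 ≤ m) : μ.card = ∑ j : Fin m, μ.colLen j := by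
  rw [Fin.sum_univ_eq_sum_range, YoungDiagram.card,
    Finset.card_eq_sum_card_fiberwise (f := Prod.snd) (t := Finset.range m)
      fun x hx => Finset.mem_coe.2 (Finset.mem_range.2 (lt_of_mem_of_rowLen_le (i := x.1) hx hm))]
  exact Finset.sum_congr rfl fun j _ => μ.colLen_eq_card.symm

theorem exists_youngDiagram_colLen_eq {f : ℕ → ℕ} (hf : Antitone f) (hm : f m = 0) :
    ∃ μ : YoungDiagram, ∀ j, μ.colLen j = f j := by
  obtain ⟨cells, hcells⟩ : ∃ s : Finset (ℕ × ℕ), ∀ x, x ∈ s ↔ x.1 < f x.2 := by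
    refine ⟨(Finset.range (f 0) ×ˢ Finset.range m).filter fun x => x.1 < f x.2, fun x => ?_⟩
    simp only [Finset.mem_filter, Finset.mem_product, Finset.mem_range, and_iff_right_iff_imp]
    exact fun h => ⟨h.trans_le (hf (Nat.zero_le _)),
      not_le.1 fun hx => (hm ▸ h.trans_le (hf hx)).not_ge (Nat.zero_le _)⟩
  have hlower : IsLowerSet (cells : Set (ℕ × ℕ)) := fun x y hyx hx =>
    (hcells y).2 ((hyx.1.trans_lt ((hcells x).1 hx)).trans_le (hf hyx.2))
  refine ⟨⟨cells, hlower⟩, fun j => eq_of_forall_lt_iff fun i => ?_⟩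
  rw [← YoungDiagram.mem_iff_lt_colLen]
  exact hcells (i, j)

namespace Tableau

open Classical in
theorem count_inCol (T : Tableau n μ) (j t : ℕ) :
    Nat.count (T.InCol j) t = ((Finset.range (μ.colLen j)).filter fun i => T.1 i j < t).card := by
  have hmono : StrictMonoOn (fun i => T.1 i j) (Finset.range (μ.colLen j)) :=
    fun i _ i' hi' hii' =>
      T.1.col_strict hii' (YoungDiagram.mem_iff_lt_colLen.2 (Finset.mem_range.1 hi'))
  have himage : (Finset.range t).filter (T.InCol j) =
      ((Finset.range (μ.colLen j)).filter fun i => T.1 i j < t).image fun i => T.1 i j := by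
    ext a
    simp only [Finset.mem_filter, Finset.mem_range, Finset.mem_image, InCol,
      YoungDiagram.mem_iff_lt_colLen]
    constructor
    · rintro ⟨ha, i, hi, rfl⟩
      exact ⟨i, ⟨hi, ha⟩, rfl⟩
    · rintro ⟨i, ⟨hi, ha⟩, rfl⟩
      exact ⟨ha, i, hi, rfl⟩
  rw [Nat.count_eq_card_filter_range, himage, Finset.card_image_of_injOn
    (hmono.injOn.mono (Finset.coe_subset.2 (Finset.filter_subset _ _)))]

open Classical in
theorem count_inCol_entry (T : Tableau n μ) {i j : ℕ} (hij : (i, j) ∈ μ) :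
    Nat.count (T.InCol j) (T.1 i j) = i := by
  have hi := YoungDiagram.mem_iff_lt_colLen.1 hij
  have hfilter : (Finset.range (μ.colLen j)).filter (fun i' => T.1 i' j < T.1 i j) =
      Finset.range i := by
    ext i'
    simp only [Finset.mem_filter, Finset.mem_range]
    refine ⟨fun ⟨hi', hlt⟩ => ?_, fun hlt => ⟨hlt.trans hi, T.1.col_strict hlt hij⟩⟩
    by_contra! hle
    exact hlt.not_ge (T.1.col_weak hle (YoungDiagram.mem_iff_lt_colLen.2 hi'))
  rw [count_inCol, hfilter, Finset.card_range]

open Classical in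
theorem count_inCol_eq_colLen (T : Tableau n μ) (j : ℕ) :
    Nat.count (T.InCol j) n = μ.colLen j := by
  rw [count_inCol, Finset.filter_true_of_mem fun i hi => T.2 i j
    (YoungDiagram.mem_iff_lt_colLen.2 (Finset.mem_range.1 hi)), Finset.card_range]

open Classical in
theorem antitone_count_inCol (T : Tableau n μ) (t : ℕ) :
    Antitone fun j => Nat.count (T.InCol j) t := fun j j' hjj' => by
  simp only [count_inCol]
  refine Finset.card_le_card fun i hi => ?_
  simp only [Finset.mem_filter, Finset.mem_range] at hi ⊢
  exact ⟨hi.1.trans_le (μ.colLen_anti _ _ hjj'), (T.1.row_weak_of_le hjj'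
    (YoungDiagram.mem_iff_lt_colLen.2 hi.1)).trans_lt hi.2⟩

theorem colLen_zero_le (T : Tableau n μ) : μ.colLen 0 ≤ n := by
  classical exact (T.count_inCol_eq_colLen 0).symm.trans_le (Nat.count_le _)

theorem InCol.lt {T : Tableau n μ} {j a : ℕ} : T.InCol j a → a < n := by
  rintro ⟨i, hij, rfl⟩
  exact T.2 i j hij

theorem lt_of_mem (T : Tableau n μ) {i j : ℕ} (hij : (i, j) ∈ μ) : i < n :=
  ((YoungDiagram.mem_iff_lt_colLen.1 hij).trans_le (μ.colLen_anti 0 j (Nat.zero_le _))).trans_le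
    T.colLen_zero_le

theorem ext_inCol {T T' : Tableau n μ} (h : ∀ j a, T.InCol j a ↔ T'.InCol j a) : T = T' := by
  classical
  refine Subtype.ext (SemistandardYoungTableau.ext fun i j => ?_)
  by_cases hij : (i, j) ∈ μ
  · have hcount : Nat.count (T.InCol j) (T'.1 i j) = i :=
      (congrArg (Nat.count · (T'.1 i j)) (funext fun a => propext (h j a))).trans
        (T'.count_inCol_entry hij)
    exact Nat.count_injective ⟨i, hij, rfl⟩ ((h j _).2 ⟨i, hij, rfl⟩)
      ((T.count_inCol_entry hij).trans hcount.symm)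
  · rw [T.1.zeros hij, T'.1.zeros hij]

end Tableau

open Classical in
/-- The entry in row `i` of a column is the letter preceded by `i` letters of that column. -/
theorem exists_tableau_inCol_iff {P : ℕ → ℕ → Prop} (hn : ∀ j a, P j a → a < n)
    (hμ : ∀ j, μ.colLen j = Nat.count (P j) n)
    (hP : ∀ t ≤ n, Antitone fun j => Nat.count (P j) t) :
    ∃ T : Tableau n μ, ∀ j a, T.InCol j a ↔ P j a := by
  have hcard {i j : ℕ} (hij : (i, j) ∈ μ) (hf : (Set.ofPred (P j)).Finite) :
      i < hf.toFinset.card :=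
    ((hμ j ▸ YoungDiagram.mem_iff_lt_colLen.1 hij).trans_le (Nat.count_le_card hf n))
  have hnth {i j : ℕ} (hij : (i, j) ∈ μ) : P j (Nat.nth (P j) i) := Nat.nth_mem i (hcard hij)
  let T : SemistandardYoungTableau μ :=
    { entry := fun i j => if (i, j) ∈ μ then Nat.nth (P j) i else 0
      row_weak' := fun {i j j'} hjj' hij' => by
        rw [if_pos hij', if_pos (μ.up_left_mem le_rfl hjj'.le hij')]
        refine Nat.lt_succ_iff.1 (Nat.nth_lt_of_lt_count
          (lt_of_lt_of_le ?_ (hP _ (hn _ _ (hnth hij')) hjj'.le)))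
        simp only [Nat.succ_eq_add_one, Nat.count_nth_succ (hcard hij'), Nat.lt_add_one]
      col_strict' := fun {i i' j} hii' hi'j => by
        rw [if_pos hi'j, if_pos (μ.up_left_mem hii'.le le_rfl hi'j)]
        exact Nat.nth_lt_nth' hii' (hcard hi'j)
      zeros' := fun h => if_neg h }
  have hT {i j : ℕ} (hij : (i, j) ∈ μ) : T i j = Nat.nth (P j) i := if_pos hij
  refine ⟨⟨T, fun i j hij => hn j _ (hT hij ▸ hnth hij)⟩, fun j a => ⟨?_, fun ha => ?_⟩⟩
  · rintro ⟨i, hij, rfl⟩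
    exact (hT hij).symm ▸ hnth hij
  · have hmem : (Nat.count (P j) a, j) ∈ μ :=
      YoungDiagram.mem_iff_lt_colLen.2 (hμ j ▸ Nat.count_strict_mono ha (hn j a ha))
    exact ⟨_, hmem, (hT hmem).trans (Nat.nth_count ha)⟩

theorem colCount_eq_count {b : Mat d k} {x : Fin k} {P : ℕ → Prop} [DecidablePred P]
    (hP : ∀ s : Fin d, b s x = true ↔ P s) {t : ℕ} (ht : t ≤ d) :
    colCount b x t = Nat.count P t := by
  induction t with
  | zero => rw [colCount_zero, Nat.count_zero, Nat.cast_zero]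
  | succ t ih =>
    rw [colCount_succ b x ⟨t, ht⟩, ih (Nat.le_of_succ_le ht), Nat.count_succ, Nat.cast_add,
      toInt_eq_ite]
    simp only [hP, Nat.cast_ite, Nat.cast_one, Nat.cast_zero]

open Classical in
/-- The `0/1`-matrix whose column `j` is the indicator vector of column `j` of the tableau `T`, for
`j < m`; it loses no information if `T` has at most `m` columns. -/
noncomputable def Tableau.toMat (T : Tableau n μ) (m : ℕ) : Mat n m :=
  fun a j => decide (T.InCol j.1 a.1)

namespace Tableau

theorem toMat_eq_true_iff {T : Tableau n μ} {a : Fin n} {j : Fin m} :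
    T.toMat m a j = true ↔ T.InCol j.1 a.1 := by
  simp only [toMat, decide_eq_true_eq]

open Classical in
theorem colCount_toMat (T : Tableau n μ) (j : Fin m) {t : ℕ} (ht : t ≤ n) :
    colCount (T.toMat m) j t = Nat.count (T.InCol j.1) t :=
  colCount_eq_count (fun _ => toMat_eq_true_iff) ht

theorem isHigh_toMat (T : Tableau n μ) : IsHigh Lower (T.toMat m) := by
  refine isHigh_lower_iff.2 fun t ht j j' hjj' => ?_
  simp only [colCount_toMat T _ ht, Nat.cast_le]
  exact T.antitone_count_inCol t hjj'

theorem columnSums_toMat (T : Tableau n μ) (j : Fin m) :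
    columnSums (T.toMat m) j = μ.colLen j.1 := by
  rw [← colCount_eq_columnSums, colCount_toMat T j le_rfl, count_inCol_eq_colLen]

theorem shape_eq_of_columnSums {μ ν : YoungDiagram} (hμ : μ.rowLen 0 ≤ m) (hν : ν.rowLen 0 ≤ m)
    (T : Tableau n μ) (T' : Tableau n ν) (h : columnSums (T.toMat m) = columnSums (T'.toMat m)) :
    μ = ν := by
  refine youngDiagram_ext_colLen fun j => ?_
  rcases lt_or_ge j m with hj | hj
  · simpa only [columnSums_toMat, Nat.cast_inj] using congrFun h ⟨j, hj⟩
  · rw [colLen_eq_zero_of_rowLen_le hμ hj, colLen_eq_zero_of_rowLen_le hν hj]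

theorem toMat_injective (hm : μ.rowLen 0 ≤ m) :
    Function.Injective fun T : Tableau n μ => T.toMat m := by
  intro T T' h
  have himp {S S' : Tableau n μ} (h : S.toMat m = S'.toMat m) {j a : ℕ} (ha : S.InCol j a) :
      S'.InCol j a := by
    obtain ⟨i, hij, _⟩ := id ha
    have hentry := congrFun (congrFun h ⟨a, ha.lt⟩) ⟨j, lt_of_mem_of_rowLen_le hij hm⟩
    exact toMat_eq_true_iff.1 (hentry ▸ toMat_eq_true_iff.2 ha)
  exact ext_inCol fun j a => ⟨himp h, himp h.symm⟩

end Tableau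

theorem exists_toMat_eq {M : Mat n m} (hM : IsHigh Lower M) :
    ∃ (μ : YoungDiagram) (T : Tableau n μ), μ.rowLen 0 ≤ m ∧ T.toMat m = M := by
  classical
  obtain ⟨P, hlt, hPM⟩ : ∃ P : ℕ → ℕ → Prop, (∀ j a, P j a → a < n ∧ j < m) ∧
      ∀ (a : Fin n) (j : Fin m), M a j = true ↔ P j a := by
    refine ⟨fun j a => ∃ (ha : a < n) (hj : j < m), M ⟨a, ha⟩ ⟨j, hj⟩ = true, ?_, fun a j => ?_⟩
    · rintro j a ⟨ha, hj, -⟩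
      exact ⟨ha, hj⟩
    · exact ⟨fun h => ⟨a.2, j.2, h⟩, fun ⟨_, _, h⟩ => h⟩
  have hzero (t j : ℕ) (hj : m ≤ j) : Nat.count (P j) t = 0 :=
    Nat.count_iff_forall_not.2 fun a _ h => hj.not_gt (hlt j a h).2
  have hanti (t : ℕ) (ht : t ≤ n) : Antitone fun j => Nat.count (P j) t := fun j j' hjj' => by
    rcases le_or_gt m j' with hj' | hj'
    · simp only [hzero t j' hj', Nat.zero_le]
    · have hle : (⟨j, hjj'.trans_lt hj'⟩ : Fin m) ≤ ⟨j', hj'⟩ := hjj'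
      simpa only [colCount_eq_count (fun a => hPM a _) ht, Nat.cast_le] using
        isHigh_lower_iff.1 hM t ht hle
  obtain ⟨μ, hμ⟩ := exists_youngDiagram_colLen_eq (hanti n le_rfl) (hzero n m le_rfl)
  obtain ⟨T, hT⟩ := exists_tableau_inCol_iff (fun j a h => (hlt j a h).1) hμ hanti
  refine ⟨μ, T, ?_, ?_⟩
  · by_contra! hlt
    have hmem := YoungDiagram.mem_iff_lt_colLen.1 (YoungDiagram.mem_iff_lt_rowLen.2 hlt)
    rw [hμ, hzero n m le_rfl] at hmem
    exact absurd hmem (Nat.not_lt_zero _)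
  · funext a j
    rw [Bool.eq_iff_iff, Tableau.toMat_eq_true_iff, hT, hPM]

/-- The number of ones in a matrix, as in the definition of `LambdaB`. -/
def ones (M : Mat n m) : ℕ := (Finset.univ.filter fun x : Fin n × Fin m => M x.1 x.2).card

theorem ones_eq_sum_rowSums (M : Mat n m) : (ones M : ℤ) = ∑ r, rowSums M r := by
  rw [ones, Finset.card_filter, Nat.cast_sum, Fintype.sum_prod_type]
  simp only [rowSums, toInt_eq_ite, Nat.cast_ite, Nat.cast_one, Nat.cast_zero]

theorem ones_eq_sum_columnSums (M : Mat n m) : (ones M : ℤ) = ∑ c, columnSums M c := by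
  rw [ones_eq_sum_rowSums]
  exact Finset.sum_comm

theorem Tableau.ones_toMat (T : Tableau n μ) (hm : μ.rowLen 0 ≤ m) : ones (T.toMat m) = μ.card := by
  rw [← Nat.cast_inj (R := ℤ), ones_eq_sum_columnSums, card_eq_sum_colLen hm, Nat.cast_sum]
  simp only [columnSums_toMat]

theorem exists_toMat_eq_of_conn (hm : μ.rowLen 0 ≤ m) (T : Tableau n μ) {X : Mat n m}
    (h : Conn ColLower (T.toMat m) X) : ∃ T' : Tableau n μ, T'.toMat m = X := by
  have D := doubleCrystal n m
  obtain ⟨ν, T', hν, rfl⟩ := exists_toMat_eq (D.isHigh_of_conn h T.isHigh_toMat)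
  obtain rfl := Tableau.shape_eq_of_columnSums hm hν T T' (D.wr_conn h)
  exact ⟨T', rfl⟩

theorem isStrictMorphism_tabCrystal (n : ℕ) (μ : YoungDiagram) :
    IsStrictMorphism (tabCrystal n μ) (tensorPow (vecCrystal n) (μ.rowLen 0))
      fun T => quarterTurn (T.toMat (μ.rowLen 0)) := by
  refine isStrictMorphism_pullback (quarterTurn_injective.comp (Tableau.toMat_injective le_rfl))
    (fun i T x h => ?_) (fun i T x h => ?_) <;> obtain ⟨X, rfl⟩ := quarterTurn_surjective x
  · obtain ⟨T', rfl⟩ := exists_toMat_eq_of_conn le_rfl T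
      (Conn.single (r := ColLower) (tensorPow_e_iff.1 h)).symm
    exact ⟨T', rfl⟩
  · obtain ⟨T', rfl⟩ := exists_toMat_eq_of_conn le_rfl T
      (Conn.single (r := ColLower) (tensorPow_f_iff.1 h))
    exact ⟨T', rfl⟩

theorem isCrystal_tabCrystal (n : ℕ) (μ : YoungDiagram) : IsCrystal (tabCrystal n μ) :=
  (isStrictMorphism_tabCrystal n μ).isCrystal_of_injective
    (quarterTurn_injective.comp (Tableau.toMat_injective le_rfl)) (isCrystal_tensorPow _ _)

-- `tabCrystal n μ` reads a tableau with `μ.rowLen 0` columns; a matrix in `LambdaB N n m` has `m`.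
theorem colCount_cons_false (b : Mat d k) (x : Fin k) {t : ℕ} (ht : t ≤ d) :
    colCount (Fin.cons (fun _ => false) b : Mat (d + 1) k) x (t + 1) = colCount b x t := by
  induction t with
  | zero => rw [colCount_zero, ← Fin.val_zero (d + 1), colCount_succ]; simp
  | succ t ih =>
    rw [colCount_succ _ x ⟨t, ht⟩, ← ih (Nat.le_of_succ_le ht)]
    exact colCount_succ _ x (Fin.succ ⟨t, ht⟩)

theorem height_cons_false (b : Mat d k) (i : Fin (k - 1)) {t : ℕ} (ht : t ≤ d) :
    height (Fin.cons (fun _ => false) b : Mat (d + 1) k) i (t + 1) = height b i t := by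
  rw [height, height, colCount_cons_false b _ ht, colCount_cons_false b _ ht]

theorem isLastMax_cons_false_iff {b : Mat d k} {i : Fin (k - 1)} {s : ℕ} :
    IsLastMax (height (Fin.cons (fun _ => false) b : Mat (d + 1) k) i) (d + 1) (s + 1) ↔
      IsLastMax (height b i) d s := by
  have hcons {t : ℕ} (ht : t ≤ d) := height_cons_false b i ht
  constructor
  · intro h
    have hs : s ≤ d := Nat.le_of_succ_le_succ h.le_right
    exact ⟨hs, fun t ht => by simpa only [hcons, ht, hs] using h.le (t + 1) (Nat.succ_le_succ ht),
      fun t ht hst => by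
        simpa only [hcons, ht, hs] using h.lt (t + 1) (Nat.succ_le_succ ht) (Nat.succ_lt_succ hst)⟩
  · intro h
    refine ⟨Nat.succ_le_succ h.le_right, fun t ht => ?_, fun t ht hst => ?_⟩
    · rw [hcons h.le_right]
      rcases t with _ | t
      · simpa only [height_zero] using h.le 0 (Nat.zero_le _)
      · exact (hcons (Nat.le_of_succ_le_succ ht)).trans_le (h.le t (Nat.le_of_succ_le_succ ht))
    · obtain ⟨t, rfl⟩ := Nat.exists_eq_succ_of_ne_zero (Nat.ne_zero_of_lt hst)
      rw [hcons h.le_right, Nat.succ_eq_add_one, hcons (Nat.le_of_succ_le_succ ht)]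
      exact h.lt t (Nat.le_of_succ_le_succ ht) (Nat.lt_of_succ_lt_succ hst)

theorem lower_cons_false_iff {i : Fin (k - 1)} {b b' : Mat d k} :
    Lower i (Fin.cons (fun _ => false) b : Mat (d + 1) k) (Fin.cons (fun _ => false) b') ↔
      Lower i b b' := by
  constructor
  · rintro ⟨s, h⟩
    obtain ⟨s, rfl⟩ : ∃ s' : Fin d, s = s'.succ := by
      refine Fin.exists_succ_eq.2 (fun hs => ?_) |>.imp fun _ h => h.symm
      simpa [hs] using h.isLastMax.entries.1
    exact ⟨s, fun r x => by simpa using h.toInt_eq r.succ x, isLastMax_cons_false_iff.1 h.isLastMax⟩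
  · rintro ⟨s, h⟩
    refine ⟨s.succ, fun r x => ?_, isLastMax_cons_false_iff.2 h.isLastMax⟩
    cases r using Fin.cases with
    | zero => simp [(Fin.succ_ne_zero s).symm]
    | succ r => simpa using h.toInt_eq r x

theorem quarterTurn_toMat_succ (T : Tableau n μ) (hm : μ.rowLen 0 ≤ m) :
    quarterTurn (T.toMat (m + 1)) = Fin.cons (fun _ => false) (quarterTurn (T.toMat m)) := by
  funext j a
  cases j using Fin.cases with
  | zero =>
    simp only [quarterTurn, Fin.cons_zero, ← Bool.not_eq_true, Tableau.toMat_eq_true_iff]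
    rintro ⟨i, hij, -⟩
    simpa using lt_of_mem_of_rowLen_le hij hm
  | succ j =>
    rw [Fin.cons_succ, Bool.eq_iff_iff, quarterTurn, quarterTurn, Tableau.toMat_eq_true_iff,
      Tableau.toMat_eq_true_iff, Fin.rev_succ, Fin.val_castSucc]

theorem tabCrystal_f_iff (hm : μ.rowLen 0 ≤ m) (i : Fin (n - 1)) (T T' : Tableau n μ) :
    (tabCrystal n μ).f i T = some T' ↔ ColLower i (T.toMat m) (T'.toMat m) := by
  induction m, hm using Nat.le_induction with
  | base => exact (pullback_f_iff _ (quarterTurn_injective.comp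
      (Tableau.toMat_injective le_rfl)) i T T').trans tensorPow_f_iff
  | succ m hm ih => rw [ih, ColLower, ColLower, quarterTurn_toMat_succ T hm,
      quarterTurn_toMat_succ T' hm, lower_cons_false_iff]

theorem tabCrystal_e_iff (hm : μ.rowLen 0 ≤ m) (i : Fin (n - 1)) (T T' : Tableau n μ) :
    (tabCrystal n μ).e i T = some T' ↔ ColLower i (T'.toMat m) (T.toMat m) := by
  rw [← (isCrystal_tabCrystal n μ).f_iff_e, tabCrystal_f_iff hm]

theorem tabCrystal_wt (hm : μ.rowLen 0 ≤ m) (T : Tableau n μ) :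
    (tabCrystal n μ).wt T = rowSums (T.toMat m) := by
  funext x
  rw [← columnSums_quarterTurn, ← colCount_eq_columnSums]
  induction m, hm using Nat.le_induction with
  | base => exact tensorPow_wt _ x
  | succ m hm ih => rw [ih, quarterTurn_toMat_succ T hm, colCount_cons_false _ _ le_rfl]

end Tableaux

/-! ## Matrices with a fixed number of ones -/

section FixedOnes

variable {N n m k : ℕ}

theorem ones_eq_of_conn_lower {M X : Mat n m} (h : Conn Lower M X) : ones X = ones M := by
  rw [← Nat.cast_inj (R := ℤ), ones_eq_sum_rowSums, ones_eq_sum_rowSums,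
    (doubleCrystal n m).wc_conn h]

theorem ones_eq_of_conn_colLower {M X : Mat n m} (h : Conn ColLower M X) : ones X = ones M := by
  rw [← Nat.cast_inj (R := ℤ), ones_eq_sum_columnSums, ones_eq_sum_columnSums,
    (doubleCrystal n m).wr_conn h]

theorem val_injective : Function.Injective fun M : LambdaB N n m => (M.1 : Mat n m) :=
  Subtype.val_injective

theorem isStrictMorphism_rowCrystal (N n m : ℕ) :
    IsStrictMorphism (rowCrystal N n m) (tensorPow (vecCrystal m) n) fun M => M.1 := by
  refine isStrictMorphism_pullback val_injective (fun i M x h => ?_) (fun i M x h => ?_)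
  · exact ⟨⟨x, (ones_eq_of_conn_lower (.symm (.single (tensorPow_e_iff.1 h)))).trans M.2⟩, rfl⟩
  · exact ⟨⟨x, (ones_eq_of_conn_lower (.single (tensorPow_f_iff.1 h))).trans M.2⟩, rfl⟩

theorem quarterTurn_val_injective :
    Function.Injective fun M : LambdaB N n m => quarterTurn (M.1 : Mat n m) :=
  quarterTurn_injective.comp val_injective

theorem isStrictMorphism_colCrystal (N n m : ℕ) :
    IsStrictMorphism (colCrystal N n m) (tensorPow (vecCrystal n) m)
      fun M => quarterTurn M.1 := by
  refine isStrictMorphism_pullback quarterTurn_val_injective (fun i M x h => ?_)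
    (fun i M x h => ?_) <;> obtain ⟨X, rfl⟩ := quarterTurn_surjective x
  · have hX : ColLower i X M.1 := tensorPow_e_iff.1 h
    exact ⟨⟨X, (ones_eq_of_conn_colLower (.symm (.single hX))).trans M.2⟩, rfl⟩
  · have hX : ColLower i M.1 X := tensorPow_f_iff.1 h
    exact ⟨⟨X, (ones_eq_of_conn_colLower (.single hX)).trans M.2⟩, rfl⟩

theorem isCrystal_rowCrystal (N n m : ℕ) : IsCrystal (rowCrystal N n m) :=
  (isStrictMorphism_rowCrystal N n m).isCrystal_of_injective val_injective
    (isCrystal_tensorPow _ _)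

theorem isCrystal_colCrystal (N n m : ℕ) : IsCrystal (colCrystal N n m) :=
  (isStrictMorphism_colCrystal N n m).isCrystal_of_injective quarterTurn_val_injective
    (isCrystal_tensorPow _ _)

theorem rowCrystal_e_iff {i : Fin (m - 1)} {M M' : LambdaB N n m} :
    (rowCrystal N n m).e i M = some M' ↔ Lower i (M'.1 : Mat n m) M.1 :=
  (pullback_e_iff _ val_injective i M M').trans tensorPow_e_iff

theorem colCrystal_e_iff {i : Fin (n - 1)} {M M' : LambdaB N n m} :
    (colCrystal N n m).e i M = some M' ↔ ColLower i (M'.1 : Mat n m) M.1 :=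
  (pullback_e_iff _ quarterTurn_val_injective i M M').trans tensorPow_e_iff

theorem colCrystal_f_iff {i : Fin (n - 1)} {M M' : LambdaB N n m} :
    (colCrystal N n m).f i M = some M' ↔ ColLower i (M.1 : Mat n m) M'.1 :=
  (pullback_f_iff _ quarterTurn_val_injective i M M').trans tensorPow_f_iff

/-! ## The outer map is the partial Schützenberger involution -/

theorem uniqueHighest_tensorPow_partial (d : ℕ) {p q : Fin n} (hpq : p < q) :
    UniqueHighest (tensorPow (vecCrystal n) d) p.1 q.1 := by
  have h := uniqueHighest_tensorPow_window (d := d) (p := p.1) (K := q.1 - p.1 + 1) (k := n)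
    (by omega)
  rwa [show p.1 + (q.1 - p.1 + 1) - 1 = q.1 by omega] at h

theorem halfTurn_rows_eq_xi {p q : Fin n} (hpq : p < q) (M : Mat n m) :
    halfTurn (fun j : Fin (q.1 - p.1 + 1) => M ⟨p.1 + j.1, by omega⟩) =
      fun j => xi (vecCrystal m) (M ⟨q.1 - j.1, by omega⟩) := by
  funext j x
  have hrow : (⟨p.1 + j.rev.1, by omega⟩ : Fin n) = ⟨q.1 - j.1, by omega⟩ :=
    Fin.ext (by simp only [Fin.val_rev]; omega)
  rw [xi_vecCrystal, ← hrow, halfTurn]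

theorem quarterTurn_sOuter {p q : Fin n} (hpq : p < q) (h : p.1 + (q.1 - p.1 + 1) ≤ n)
    (M : Mat n m) : quarterTurn (sOuter p q M) =
      replaceWindow p.1 (quarterTurn M) (rowSchutz (window h (quarterTurn M))) := by
  have hwindow : window h (quarterTurn M) =
      quarterTurn fun j : Fin (q.1 - p.1 + 1) => M ⟨p.1 + j.1, by omega⟩ := rfl
  rw [hwindow, rowSchutz_quarterTurn, halfTurn_rows_eq_xi hpq]
  funext s x
  simp only [quarterTurn, sOuter, tensorOuter, replaceWindow, xi_tensorPow]
  have hiff : p ≤ x ∧ x ≤ q ↔ p.1 ≤ x.1 ∧ x.1 < p.1 + (q.1 - p.1 + 1) := by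
    rw [Fin.le_def, Fin.le_def]
    omega
  by_cases hx : p ≤ x ∧ x ≤ q
  · rw [dif_pos hx, dif_pos (hiff.1 hx)]
  · rw [dif_neg hx, dif_neg fun hx' => hx (hiff.2 hx')]

theorem isSchutzenberger_sOuter (m : ℕ) {p q : Fin n} (hpq : p < q) :
    IsSchutzenberger (tensorPow (vecCrystal n) m) p.1 q.1
      fun b => quarterTurn (sOuter p q (quarterTurn (halfTurn b))) := by
  have hwindow : p.1 + (q.1 - p.1 + 1) ≤ n := by omega
  have h := isSchutzenberger_replaceWindow (d := m) hwindow (Nat.succ_pos _)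
  rw [show p.1 + (q.1 - p.1 + 1) - 1 = q.1 by omega] at h
  convert h using 2 with b
  rw [quarterTurn_sOuter hpq hwindow, quarterTurn_quarterTurn_halfTurn]

theorem uniqueHighest_colCrystal {p q : Fin n} (hpq : p < q) :
    UniqueHighest (colCrystal N n m) p.1 q.1 :=
  (isStrictMorphism_colCrystal N n m).uniqueHighest_of_injective quarterTurn_val_injective
    (uniqueHighest_tensorPow_partial m hpq)

theorem exists_isSchutzenberger_colCrystal {p q : Fin n} (hpq : p < q) :
    ∃ ξ, (∀ M : LambdaB N n m, (ξ M).1 = sOuter p q M.1) ∧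
      IsSchutzenberger (colCrystal N n m) p.1 q.1 ξ := by
  obtain ⟨ξ, hcompat, hξ⟩ :=
    (isStrictMorphism_colCrystal N n m).exists_isSchutzenberger_of_injective
      quarterTurn_val_injective (isCrystal_tensorPow _ _) (isSchutzenberger_sOuter m hpq)
  refine ⟨ξ, fun M => quarterTurn_injective ?_, hξ⟩
  exact (hcompat M).trans (congrArg (fun X : Mat n m => quarterTurn (sOuter p q X))
    (quarterTurn_halfTurn_quarterTurn (M.1 : Mat n m)))

theorem isSchutzenberger_sInner {p q : Fin n} (hpq : p < q) :
    IsSchutzenberger (colCrystal N n m) p.1 q.1 (sInner p q) := by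
  obtain ⟨ξ, -, hξ⟩ := exists_isSchutzenberger_colCrystal (N := N) (m := m) hpq
  exact hξ.partialXi

theorem sOuter_eq_sInner {p q : Fin n} (hpq : p < q) (M : LambdaB N n m) :
    sOuter p q M.1 = (sInner p q M).1 := by
  obtain ⟨ξ, hval, hξ⟩ := exists_isSchutzenberger_colCrystal (N := N) (m := m) hpq
  rw [sInner, hξ.partialXi_eq (isCrystal_colCrystal N n m) (uniqueHighest_colCrystal hpq)
    (Nat.le_pred_of_lt q.2), hval]

theorem sInner_sInner {p q : Fin n} (hpq : p < q) :
    Function.Involutive (sInner (N := N) (m := m) p q) :=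
  (isSchutzenberger_sInner hpq).involutive (isCrystal_colCrystal N n m)
    (uniqueHighest_colCrystal hpq) (Nat.le_pred_of_lt q.2)

theorem existsUnique_isSchutzenberger_colCrystal {p q : Fin n} (hpq : p < q) :
    ∃! ξ, IsSchutzenberger (colCrystal N n m) p.1 q.1 ξ :=
  (isSchutzenberger_sInner hpq).existsUnique (isCrystal_colCrystal N n m)
    (uniqueHighest_colCrystal hpq) (Nat.le_pred_of_lt q.2)

theorem existsUnique_isSchutzenberger_tabCrystal (μ : YoungDiagram) {p q : Fin n} (hpq : p < q) :
    ∃! ξ, IsSchutzenberger (tabCrystal n μ) p.1 q.1 ξ := by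
  have hr := isStrictMorphism_tabCrystal n μ
  have hinj := quarterTurn_injective.comp (Tableau.toMat_injective (n := n) (le_refl (μ.rowLen 0)))
  obtain ⟨ξ, -, hξ⟩ := hr.exists_isSchutzenberger_of_injective hinj (isCrystal_tensorPow _ _)
    (isSchutzenberger_sOuter _ hpq)
  exact hξ.existsUnique (isCrystal_tabCrystal n μ)
    (hr.uniqueHighest_of_injective hinj (uniqueHighest_tensorPow_partial _ hpq))
    (Nat.le_pred_of_lt q.2)

/-! ## The action of the cactus group -/

section TensorOuter

variable {B : Type*} (C : CrystalData k B) {p q p' q' : Fin n} {b c : Fin n → B}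

theorem tensorOuter_congr (h : ∀ r, p ≤ r → r ≤ q → b r = c r) {r : Fin n}
    (hr : p ≤ r ∧ r ≤ q) : tensorOuter C p q b r = tensorOuter C p q c r := by
  have hpq : p.1 ≤ q.1 := hr.1.trans hr.2
  have hbc : (fun j : Fin (q.1 - p.1 + 1) => xi C (b ⟨q.1 - j.1, by omega⟩)) =
      fun j => xi C (c ⟨q.1 - j.1, by omega⟩) := by
    funext j
    rw [h]
    · exact Fin.le_def.2 (by simp only; omega)
    · exact Fin.le_def.2 (Nat.sub_le _ _)
  simp only [tensorOuter, dif_pos hr]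
  rw [hbc]

theorem tensorOuter_of_not {r : Fin n} (hr : ¬ (p ≤ r ∧ r ≤ q)) : tensorOuter C p q b r = b r :=
  dif_neg hr

theorem tensorOuter_comm (h : q < p') : tensorOuter C p q (tensorOuter C p' q' b) =
    tensorOuter C p' q' (tensorOuter C p q b) := by
  have hleft {s : Fin n} (hs : s ≤ q) : ¬ (p' ≤ s ∧ s ≤ q') := fun hs' =>
    (hs.trans_lt h).not_ge hs'.1
  have hright {s : Fin n} (hs : p' ≤ s) : ¬ (p ≤ s ∧ s ≤ q) := fun hs' =>
    (hs'.2.trans_lt h).not_ge hs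
  funext r
  by_cases h₁ : p ≤ r ∧ r ≤ q
  · rw [tensorOuter_of_not C (hleft h₁.2)]
    exact tensorOuter_congr C (fun s _ hs => tensorOuter_of_not C (hleft hs)) h₁
  · rw [tensorOuter_of_not C h₁]
    by_cases h₂ : p' ≤ r ∧ r ≤ q'
    · exact tensorOuter_congr C (fun s hs _ => (tensorOuter_of_not C (hright hs)).symm) h₂
    · rw [tensorOuter_of_not C h₂, tensorOuter_of_not C h₂, tensorOuter_of_not C h₁]

end TensorOuter

theorem sInner_comm {p q p' q' : Fin n} (hpq : p < q) (hpq' : p' < q') (h : q < p')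
    (M : LambdaB N n m) :
    sInner p q (sInner p' q' M) = sInner p' q' (sInner p q M) := by
  apply Subtype.ext
  rw [← sOuter_eq_sInner hpq, ← sOuter_eq_sInner hpq', ← sOuter_eq_sInner hpq',
    ← sOuter_eq_sInner hpq]
  exact tensorOuter_comm (vecCrystal m) h

theorem sInner_nested {p q p' q' p'' q'' : Fin n} (hpq : p < q) (hpq' : p' < q')
    (hpq'' : p'' < q'') (h₁ : p ≤ p') (h₂ : q' ≤ q) (h₃ : p'.1 + q''.1 = p.1 + q.1)
    (h₄ : q'.1 + p''.1 = p.1 + q.1) (M : LambdaB N n m) :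
    sInner p q (sInner p' q' M) = sInner p'' q'' (sInner p q M) := by
  have hC := isCrystal_colCrystal N n m
  have hconj := (isSchutzenberger_sInner hpq).conj (isSchutzenberger_sInner hpq') hC
    (uniqueHighest_colCrystal hpq) (Nat.le_pred_of_lt q.2) h₁ h₂ h₃ h₄ hpq'.le
  have heq := (isSchutzenberger_sInner hpq'').unique hconj hC
    (uniqueHighest_colCrystal hpq'') (Nat.le_pred_of_lt q''.2)
  rw [congrFun heq (sInner p q M), sInner_sInner hpq]

/-- The permutation `s^i_{p,q}` of `Λ^N B_{n,m}` attached to the generator `s_{p,q}` of the cactus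
group. -/
noncomputable def cactusPerm (N m : ℕ) (a : CactusGen n) : Equiv.Perm (LambdaB N n m) :=
  Function.Involutive.toPerm (sInner a.1.1 a.1.2) (sInner_sInner a.2)

theorem lift_cactusPerm (r : FreeGroup (CactusGen n)) (hr : CactusRel n r) :
    FreeGroup.lift (cactusPerm N m) r = 1 := by
  cases hr with
  | invol a =>
    rw [map_mul, FreeGroup.lift_apply_of]
    exact Equiv.ext (sInner_sInner a.2)
  | nested a b c h₁ h₂ h₃ h₄ =>
    rw [map_mul, map_inv, mul_inv_eq_one, map_mul, map_mul, FreeGroup.lift_apply_of,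
      FreeGroup.lift_apply_of, FreeGroup.lift_apply_of]
    exact Equiv.ext (sInner_nested a.2 b.2 c.2 h₁ h₂ h₃ h₄)
  | disjoint a b h =>
    rw [map_mul, map_inv, mul_inv_eq_one, map_mul, map_mul, FreeGroup.lift_apply_of,
      FreeGroup.lift_apply_of]
    exact Equiv.ext (sInner_comm a.2 b.2 h)

/-- The inner action of the cactus group on `Λ^N B_{n,m}`. -/
noncomputable def cactusAction (N n m : ℕ) : CactusGroup n →* Equiv.Perm (LambdaB N n m) :=
  PresentedGroup.toGroup lift_cactusPerm

theorem cactusAction_cactusS {p q : Fin n} (h : p < q) (M : LambdaB N n m) :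
    cactusAction N n m (cactusS p q h) M = sInner p q M :=
  congrArg (fun g : Equiv.Perm (LambdaB N n m) => g M)
    (PresentedGroup.toGroup.of lift_cactusPerm (x := (⟨(p, q), h⟩ : CactusGen n)))

end FixedOnes

/-! ## Crystal skew Howe duality -/

section HoweDuality

variable {N n m : ℕ}

/-- The inclusion `B_μ → B_μ ⊗ B_{μᵗʳ}`, `T ↦ T ⊗ T'`, with `s = ⟨μ, T'⟩`. -/
def inFst (s : Σ μ : BoxPartition N n m, Tableau m μ.1.transpose) (T : Tableau n s.1.1) :
    Howe N n m := ⟨s.1, T, s.2⟩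

/-- The inclusion `B_{μᵗʳ} → B_μ ⊗ B_{μᵗʳ}`, `T' ↦ T ⊗ T'`, with `s = ⟨μ, T⟩`. -/
def inSnd (s : Σ μ : BoxPartition N n m, Tableau n μ.1) (T' : Tableau m s.1.1.transpose) :
    Howe N n m := ⟨s.1, s.2, T'⟩

theorem isStrictMorphism_inFst (s : Σ μ : BoxPartition N n m, Tableau m μ.1.transpose) :
    IsStrictMorphism (tabCrystal n s.1.1) (howeFst N n m) (inFst s) :=
  ⟨fun _ => rfl, fun _ _ => rfl, fun _ _ => rfl, fun _ _ => rfl, fun _ _ => rfl⟩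

theorem isStrictMorphism_inSnd (s : Σ μ : BoxPartition N n m, Tableau n μ.1) :
    IsStrictMorphism (tabCrystal m s.1.1.transpose) (howeSnd N n m) (inSnd s) :=
  ⟨fun _ => rfl, fun _ _ => rfl, fun _ _ => rfl, fun _ _ => rfl, fun _ _ => rfl⟩

theorem exists_inFst_eq (x : Howe N n m) : ∃ s T, inFst s T = x := ⟨⟨x.1, x.2.2⟩, x.2.1, rfl⟩

theorem exists_inSnd_eq (x : Howe N n m) : ∃ s T, inSnd s T = x := ⟨⟨x.1, x.2.1⟩, x.2.2, rfl⟩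

theorem isSchutzenberger_howeInner {p q : Fin n} (hpq : p < q) :
    IsSchutzenberger (howeFst N n m) p.1 q.1 (howeInner p q) := by
  refine isSchutzenberger_of_cover isStrictMorphism_inFst exists_inFst_eq
    (ξ := fun s => partialXi (tabCrystal n s.1.1) p.1 q.1) (fun _ _ => rfl) fun s => ?_
  obtain ⟨ξ, hξ⟩ := (existsUnique_isSchutzenberger_tabCrystal s.1.1 hpq).exists
  exact hξ.partialXi

/-- The matrix `P` read off the first tableau: `P_{a,j} = 1` iff `a` lies in column `j`. -/
noncomputable def matP (x : Howe N n m) : Mat n m := x.2.1.toMat m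

/-- The matrix `Q` read off the second tableau: `Q_{n+1-j,a} = 1` iff `a` lies in column `j`. -/
noncomputable def matQ (x : Howe N n m) : Mat n m := quarterTurn (x.2.2.toMat n)

theorem rowLen_transpose_le (μ : BoxPartition N n m) : μ.1.transpose.rowLen 0 ≤ n := by
  rw [YoungDiagram.rowLen_transpose]; exact μ.2.1

theorem isHigh_matP (x : Howe N n m) : IsHigh Lower (matP x) := x.2.1.isHigh_toMat

theorem isLow_matQ (x : Howe N n m) : IsLow ColLower (matQ x) :=
  isLow_colLower_quarterTurn_iff.2 x.2.2.isHigh_toMat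

theorem colLowest_toMat_eq_true_iff {μ : YoungDiagram} (T : Tableau n μ) (r : Fin n) (c : Fin m) :
    colLowest (T.toMat m) r c = true ↔ (r.rev.1, c.1) ∈ μ := by
  have D := doubleCrystal n m
  have h : columnSums (T.toMat m) = columnSums (colLowest (T.toMat m)) :=
    D.wr_conn (D.conn_lo (T.toMat m))
  rw [eq_true_iff_lt_columnSums (M := colLowest (T.toMat m)) (D.isHigh_lo T.isHigh_toMat)
    (D.isLow_lo _), ← h, Tableau.columnSums_toMat, Nat.cast_lt, YoungDiagram.mem_iff_lt_colLen]

theorem rowHighest_quarterTurn_toMat_eq_true_iff {ν : YoungDiagram} (T : Tableau m ν)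
    (r : Fin n) (c : Fin m) :
    rowHighest (quarterTurn (T.toMat n)) r c = true ↔ (c.1, r.rev.1) ∈ ν := by
  have D := doubleCrystal n m
  have h : rowSums (quarterTurn (T.toMat n)) = rowSums (rowHighest (quarterTurn (T.toMat n))) :=
    D.wc_conn (D.conn_hi (quarterTurn (T.toMat n)))
  rw [eq_true_iff_lt_rowSums (M := rowHighest (quarterTurn (T.toMat n))) (D.isHigh_hi _)
    (D.isLow_hi (isLow_colLower_quarterTurn_iff.2 T.isHigh_toMat)), ← h, rowSums_quarterTurn,
    Tableau.columnSums_toMat, Nat.cast_lt, YoungDiagram.mem_iff_lt_colLen]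

theorem colLowest_matP (x : Howe N n m) : colLowest (matP x) = rowHighest (matQ x) := by
  funext r c
  rw [Bool.eq_iff_iff, matP, matQ, colLowest_toMat_eq_true_iff,
    rowHighest_quarterTurn_toMat_eq_true_iff, YoungDiagram.mem_transpose]
  rfl

theorem eq_transpose_of_colLowest_eq {μ ν : YoungDiagram} (hμ : μ.rowLen 0 ≤ m)
    (hν : ν.rowLen 0 ≤ n) (T : Tableau n μ) (T' : Tableau m ν)
    (h : colLowest (T.toMat m) = rowHighest (quarterTurn (T'.toMat n))) : ν = μ.transpose := by
  have hbox : ∀ i j : ℕ, i < n → j < m → ((i, j) ∈ μ ↔ (j, i) ∈ ν) := by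
    intro i j hi hj
    have hiff := colLowest_toMat_eq_true_iff T (Fin.rev ⟨i, hi⟩) (⟨j, hj⟩ : Fin m)
    rw [h, rowHighest_quarterTurn_toMat_eq_true_iff, Fin.rev_rev] at hiff
    exact hiff.symm
  ext ⟨j, i⟩
  rw [YoungDiagram.mem_cells, YoungDiagram.mem_cells, YoungDiagram.mem_transpose]
  constructor
  · intro hji
    exact (hbox i j (lt_of_mem_of_rowLen_le hji hν) (T'.lt_of_mem hji)).2 hji
  · intro hij
    exact (hbox i j (T.lt_of_mem hij) (lt_of_mem_of_rowLen_le hij hμ)).1 hij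

theorem exists_matP_matQ_eq (M : LambdaB N n m) :
    ∃ x : Howe N n m, matP x = rowHighest M.1 ∧ matQ x = colLowest M.1 := by
  have D := doubleCrystal n m
  obtain ⟨μ, T, hμ, hT⟩ := exists_toMat_eq (M := rowHighest M.1) (D.isHigh_hi M.1)
  obtain ⟨Z, hZ⟩ := quarterTurn_surjective (colLowest (M.1 : Mat n m))
  have hlow : IsLow ColLower (colLowest (M.1 : Mat n m)) := D.isLow_lo M.1
  rw [← hZ, isLow_colLower_quarterTurn_iff] at hlow
  obtain ⟨ν, T', hν, hT'⟩ := exists_toMat_eq hlow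
  obtain rfl := eq_transpose_of_colLowest_eq hμ hν T T'
    (by rw [hT, hT', hZ]; exact colLowest_rowHighest (M.1 : Mat n m))
  have hcard : μ.card = N := by
    rw [← T.ones_toMat hμ, hT]
    exact (ones_eq_of_conn_lower (D.conn_hi M.1)).trans M.2
  exact ⟨⟨⟨μ, T.colLen_zero_le, hμ, hcard⟩, T, T'⟩, hT, (congrArg quarterTurn hT').trans hZ⟩

theorem howe_ext {x y : Howe N n m} (hP : matP x = matP y) (hQ : matQ x = matQ y) : x = y := by
  obtain ⟨⟨μ, hμ⟩, T, T'⟩ := x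
  obtain ⟨⟨ν, hν⟩, S, S'⟩ := y
  obtain rfl : μ = ν :=
    Tableau.shape_eq_of_columnSums hμ.2.1 hν.2.1 T S (congrArg columnSums hP)
  obtain rfl : T = S := Tableau.toMat_injective hμ.2.1 hP
  obtain rfl : T' = S' :=
    Tableau.toMat_injective (rowLen_transpose_le ⟨μ, hμ⟩) (quarterTurn_injective hQ)
  rfl

theorem exists_rowHighest_colLowest_eq (x : Howe N n m) :
    ∃ M : LambdaB N n m, rowHighest M.1 = matP x ∧ colLowest M.1 = matQ x := by
  have D := doubleCrystal n m
  obtain ⟨M, hP, hQ⟩ := D.exists_hi_lo (isHigh_matP x) (isLow_matQ x) (colLowest_matP x)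
  have hconn : Conn Lower M (matP x) := hP ▸ D.conn_hi M
  refine ⟨⟨M, ?_⟩, hP, hQ⟩
  exact (ones_eq_of_conn_lower hconn).symm.trans ((x.2.1.ones_toMat x.1.2.2.1).trans x.1.2.2.2)

/-- The pair `T_P ⊗ T_Q` of tableaux of a matrix, characterised by its matrices `P` and `Q`. -/
noncomputable def toHowe (M : LambdaB N n m) : Howe N n m := (exists_matP_matQ_eq M).choose

theorem matP_toHowe (M : LambdaB N n m) : matP (toHowe M) = rowHighest M.1 :=
  (exists_matP_matQ_eq M).choose_spec.1

theorem matQ_toHowe (M : LambdaB N n m) : matQ (toHowe M) = colLowest M.1 :=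
  (exists_matP_matQ_eq M).choose_spec.2

theorem toHowe_bijective : Function.Bijective (toHowe : LambdaB N n m → Howe N n m) := by
  constructor
  · intro M M' h
    refine Subtype.ext ((doubleCrystal n m).ext_hi_lo ?_ ?_)
    · exact (matP_toHowe M).symm.trans ((congrArg matP h).trans (matP_toHowe M'))
    · exact (matQ_toHowe M).symm.trans ((congrArg matQ h).trans (matQ_toHowe M'))
  · intro x
    obtain ⟨M, hP, hQ⟩ := exists_rowHighest_colLowest_eq x
    exact ⟨M, howe_ext ((matP_toHowe M).trans hP) ((matQ_toHowe M).trans hQ)⟩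

/-- The bijection `M ↦ T_P ⊗ T_Q` of crystal skew Howe duality. -/
noncomputable def howeEquiv (N n m : ℕ) : LambdaB N n m ≃ Howe N n m :=
  Equiv.ofBijective toHowe toHowe_bijective

theorem matP_howeEquiv (M : LambdaB N n m) : matP (howeEquiv N n m M) = rowHighest M.1 :=
  matP_toHowe M

theorem matQ_howeEquiv (M : LambdaB N n m) : matQ (howeEquiv N n m M) = colLowest M.1 :=
  matQ_toHowe M

theorem finite_howe (N n m : ℕ) : Finite (Howe N n m) :=
  haveI := (isCrystal_colCrystal N n m).finite
  Finite.of_equiv _ (howeEquiv N n m)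

theorem isCrystal_howeFst (N n m : ℕ) : IsCrystal (howeFst N n m) :=
  haveI := finite_howe N n m
  isCrystal_of_cover (fun _ => isCrystal_tabCrystal n _) isStrictMorphism_inFst exists_inFst_eq

theorem isCrystal_howeSnd (N n m : ℕ) : IsCrystal (howeSnd N n m) :=
  haveI := finite_howe N n m
  isCrystal_of_cover (fun _ => isCrystal_tabCrystal m _) isStrictMorphism_inSnd exists_inSnd_eq

theorem howeFst_e_iff {i : Fin (n - 1)} {x y : Howe N n m} :
    (howeFst N n m).e i x = some y ↔ ColLower i (matP y) (matP x) ∧ matQ y = matQ x := by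
  constructor
  · intro h
    obtain ⟨T, hT, rfl⟩ := Option.map_eq_some_iff.1 h
    exact ⟨(tabCrystal_e_iff x.1.2.2.1 i _ _).1 hT, rfl⟩
  · rintro ⟨hP, hQ⟩
    obtain ⟨⟨μ, hμ⟩, T, T'⟩ := x
    obtain ⟨⟨ν, hν⟩, S, S'⟩ := y
    obtain rfl : ν = μ :=
      Tableau.shape_eq_of_columnSums hν.2.1 hμ.2.1 S T hP.columnSums_right.symm
    obtain rfl : S' = T' :=
      Tableau.toMat_injective (rowLen_transpose_le ⟨ν, hν⟩) (quarterTurn_injective hQ)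
    exact Option.map_eq_some_iff.2 ⟨S, (tabCrystal_e_iff hν.2.1 i _ _).2 hP, rfl⟩

theorem howeSnd_e_iff {i : Fin (m - 1)} {x y : Howe N n m} :
    (howeSnd N n m).e i x = some y ↔ Lower i (matQ y) (matQ x) ∧ matP y = matP x := by
  constructor
  · intro h
    obtain ⟨T, hT, rfl⟩ := Option.map_eq_some_iff.1 h
    exact ⟨(tabCrystal_e_iff (rowLen_transpose_le x.1) i _ _).1 hT, rfl⟩
  · rintro ⟨hQ, hP⟩
    obtain ⟨⟨μ, hμ⟩, T, T'⟩ := x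
    obtain ⟨⟨ν, hν⟩, S, S'⟩ := y
    obtain rfl : ν = μ :=
      Tableau.shape_eq_of_columnSums hν.2.1 hμ.2.1 S T (congrArg columnSums hP)
    obtain rfl : S = T := Tableau.toMat_injective hν.2.1 hP
    exact Option.map_eq_some_iff.2
      ⟨S', (tabCrystal_e_iff (rowLen_transpose_le ⟨ν, hν⟩) i _ _).2 hQ, rfl⟩

theorem colCrystal_wt (M : LambdaB N n m) : (colCrystal N n m).wt M = rowSums M.1 :=
  funext fun x => (tensorPow_wt (quarterTurn M.1) x).trans
    ((colCount_eq_columnSums _ x).trans (columnSums_quarterTurn (M.1 : Mat n m) x))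

theorem rowCrystal_wt (M : LambdaB N n m) : (rowCrystal N n m).wt M = columnSums M.1 :=
  funext fun x => (tensorPow_wt (M.1 : Mat n m) x).trans (colCount_eq_columnSums M.1 x)

theorem isCrystalIso_howeFst (N n m : ℕ) :
    IsCrystalIso (colCrystal N n m) (howeFst N n m) (howeEquiv N n m) := by
  have D := doubleCrystal n m
  refine isCrystalIso_of_e (isCrystal_colCrystal N n m) (isCrystal_howeFst N n m) (fun M => ?_)
    fun i M => ?_
  · have h : (howeFst N n m).wt (howeEquiv N n m M) = rowSums (matP (howeEquiv N n m M)) :=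
      tabCrystal_wt (howeEquiv N n m M).1.2.2.1 _
    rw [h, matP_howeEquiv, colCrystal_wt]
    exact (D.wc_conn (D.conn_hi M.1)).symm
  · ext y
    obtain ⟨M', rfl⟩ := (howeEquiv N n m).surjective y
    rw [howeFst_e_iff, matP_howeEquiv, matP_howeEquiv, matQ_howeEquiv, matQ_howeEquiv,
      Option.map_eq_some_iff]
    simp only [EmbeddingLike.apply_eq_iff_eq, exists_eq_right, colCrystal_e_iff]
    exact ⟨fun h => D.c_of_hi h.1 h.2, fun h => ⟨D.c_hi h, D.lo_eq_lo_iff.2 (.single h)⟩⟩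

theorem isCrystalIso_howeSnd (N n m : ℕ) :
    IsCrystalIso (rowCrystal N n m) (howeSnd N n m) (howeEquiv N n m) := by
  have D := doubleCrystal n m
  refine isCrystalIso_of_e (isCrystal_rowCrystal N n m) (isCrystal_howeSnd N n m) (fun M => ?_)
    fun i M => ?_
  · have h : (howeSnd N n m).wt (howeEquiv N n m M) = columnSums (matQ (howeEquiv N n m M)) :=
      (tabCrystal_wt (rowLen_transpose_le (howeEquiv N n m M).1) _).trans
        (funext fun x => (columnSums_quarterTurn _ x).symm)
    rw [h, matQ_howeEquiv, rowCrystal_wt]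
    exact (D.wr_conn (D.conn_lo M.1)).symm
  · ext y
    obtain ⟨M', rfl⟩ := (howeEquiv N n m).surjective y
    rw [howeSnd_e_iff, matP_howeEquiv, matP_howeEquiv, matQ_howeEquiv, matQ_howeEquiv,
      Option.map_eq_some_iff]
    simp only [EmbeddingLike.apply_eq_iff_eq, exists_eq_right, rowCrystal_e_iff]
    exact ⟨fun h => D.r_of_lo h.1 h.2, fun h => ⟨D.r_lo h, D.hi_eq_hi_iff.2 (.single h)⟩⟩

theorem exists_reflTransGen_lift {A X : Type*} {v : A → X} {s : A → A → Prop} {t : X → X → Prop}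
    (hlift : ∀ a y, t (v a) y → ∃ b, s a b ∧ v b = y) {a : A} {x : X}
    (hx : Relation.ReflTransGen t (v a) x) : ∃ b, Relation.ReflTransGen s a b ∧ v b = x := by
  induction hx with
  | refl => exact ⟨a, .refl, rfl⟩
  | tail _ hyz ih =>
    obtain ⟨b, hab, rfl⟩ := ih
    obtain ⟨c, hbc, rfl⟩ := hlift b _ hyz
    exact ⟨c, hab.tail hbc, rfl⟩

theorem exists_isEMax (M : LambdaB N n m) :
    ∃ P : LambdaB N n m, IsEMax (rowCrystal N n m) M P ∧ P.1 = rowHighest M.1 := by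
  have D := doubleCrystal n m
  obtain ⟨P, hMP, hP⟩ := exists_reflTransGen_lift (A := LambdaB N n m) (v := Subtype.val)
    (s := fun x y => ∃ i, (rowCrystal N n m).e i x = some y)
    (fun X Z ⟨i, h⟩ => ⟨⟨Z, (ones_eq_of_conn_lower (Conn.single h).symm).trans X.2⟩,
      ⟨i, rowCrystal_e_iff.2 h⟩, rfl⟩) (D.raise_hi M.1)
  refine ⟨P, ⟨hMP, fun i => Option.eq_none_iff_forall_ne_some.2 fun P' h => ?_⟩, hP⟩
  exact D.isHigh_hi M.1 i P'.1 (hP ▸ rowCrystal_e_iff.1 h)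

theorem exists_isFMax (M : LambdaB N n m) :
    ∃ Q : LambdaB N n m, IsFMax (colCrystal N n m) M Q ∧ Q.1 = colLowest M.1 := by
  have D := doubleCrystal n m
  obtain ⟨Q, hMQ, hQ⟩ := exists_reflTransGen_lift (A := LambdaB N n m) (v := Subtype.val)
    (s := fun x y => ∃ i, (colCrystal N n m).f i x = some y)
    (fun X Z ⟨i, h⟩ => ⟨⟨Z, (ones_eq_of_conn_colLower (Conn.single h)).trans X.2⟩,
      ⟨i, colCrystal_f_iff.2 h⟩, rfl⟩) (D.lower_lo M.1)
  refine ⟨Q, ⟨hMQ, fun i => Option.eq_none_iff_forall_ne_some.2 fun Q' h => ?_⟩, hQ⟩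
  exact D.isLow_lo M.1 i Q'.1 (hQ ▸ colCrystal_f_iff.1 h)

theorem isSkewHoweDuality_howeEquiv (N n m : ℕ) : IsSkewHoweDuality (howeEquiv N n m) where
  iso_fst := isCrystalIso_howeFst N n m
  iso_snd := isCrystalIso_howeSnd N n m
  exists_P M := by
    obtain ⟨P, hMP, hP⟩ := exists_isEMax M
    refine ⟨P, hMP, fun a j => ?_⟩
    rw [show P.1 = matP (howeEquiv N n m M) from hP.trans (matP_howeEquiv M).symm]
    exact Tableau.toMat_eq_true_iff
  exists_Q M := by
    obtain ⟨Q, hMQ, hQ⟩ := exists_isFMax M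
    refine ⟨Q, hMQ, fun a j => ?_⟩
    rw [show Q.1 = matQ (howeEquiv N n m M) from hQ.trans (matQ_howeEquiv M).symm, matQ,
      quarterTurn, Fin.rev_rev]
    exact Tableau.toMat_eq_true_iff

theorem howeEquiv_sInner {p q : Fin n} (hpq : p < q) (M : LambdaB N n m) :
    howeEquiv N n m (sInner p q M) = howeInner p q (howeEquiv N n m M) := by
  obtain ⟨ξ, hcompat, hξ⟩ :=
    (isCrystalIso_howeFst N n m).isStrictMorphism.exists_isSchutzenberger_of_injective
      (howeEquiv N n m).injective (isCrystal_howeFst N n m) (isSchutzenberger_howeInner hpq)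
  rw [← hcompat, (isSchutzenberger_sInner hpq).unique hξ (isCrystal_colCrystal N n m)
    (uniqueHighest_colCrystal hpq) (Nat.le_pred_of_lt q.2)]

end HoweDuality

end GLCrystal

/-- On the `gl_n × gl_m`-crystal `Λ^N B_{n,m}` of 0/1-matrices the Schützenberger involutions involved
exist and are unique, the outer and the inner maps define actions of the cactus group `C_n`, these
actions agree, and under crystal skew Howe duality they become `b ⊗ c ↦ ξ_{p,q}(b) ⊗ c`. -/
theorem mainTheorem1 (N n m : ℕ) :
    -- the two crystal structures
    GLCrystal.IsCrystal (GLCrystal.colCrystal N n m) ∧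
    GLCrystal.IsCrystal (GLCrystal.rowCrystal N n m) ∧
    -- the Schützenberger involutions in the definitions of the two actions are well defined
    (∃! ξ, GLCrystal.IsSchutzenberger (GLCrystal.vecCrystal m) 0 (m - 1) ξ) ∧
    (∀ d : ℕ, ∃! ξ, GLCrystal.IsSchutzenberger
      (GLCrystal.tensorPow (GLCrystal.vecCrystal m) d) 0 (m - 1) ξ) ∧
    (∀ p q : Fin n, p < q →
      ∃! ξ, GLCrystal.IsSchutzenberger (GLCrystal.colCrystal N n m) p.1 q.1 ξ) ∧
    (∀ (μ : GLCrystal.BoxPartition N n m) (p q : Fin n), p < q →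
      ∃! ξ, GLCrystal.IsSchutzenberger (GLCrystal.tabCrystal n μ.1) p.1 q.1 ξ) ∧
    -- the outer and the inner map agree
    (∀ (p q : Fin n), p < q → ∀ M : GLCrystal.LambdaB N n m,
      GLCrystal.sOuter p q M.1 = (GLCrystal.sInner p q M).1) ∧
    -- both define actions of the cactus group, and these coincide
    (∃ ρo ρi : GLCrystal.CactusGroup n →* Equiv.Perm (GLCrystal.LambdaB N n m),
      (∀ (p q : Fin n) (h : p < q) (M : GLCrystal.LambdaB N n m),
        (ρo (GLCrystal.cactusS p q h) M).1 = GLCrystal.sOuter p q M.1) ∧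
      (∀ (p q : Fin n) (h : p < q) (M : GLCrystal.LambdaB N n m),
        ρi (GLCrystal.cactusS p q h) M = GLCrystal.sInner p q M) ∧
      ρo = ρi ∧
      -- compatibility with crystal skew Howe duality
      ∃ F : GLCrystal.LambdaB N n m ≃ GLCrystal.Howe N n m,
        GLCrystal.IsSkewHoweDuality F ∧
        ∀ (p q : Fin n) (h : p < q) (M : GLCrystal.LambdaB N n m),
          F (ρo (GLCrystal.cactusS p q h) M) = GLCrystal.howeInner p q (F M)) := by
  open GLCrystal in
  refine ⟨isCrystal_colCrystal N n m, isCrystal_rowCrystal N n m,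
    existsUnique_isSchutzenberger_vecCrystal m,
    fun d => (isSchutzenberger_rowSchutz d m).existsUnique (isCrystal_tensorPow d m)
      (uniqueHighest_tensorPow d m) le_rfl,
    fun p q h => existsUnique_isSchutzenberger_colCrystal h,
    fun μ p q h => existsUnique_isSchutzenberger_tabCrystal μ.1 h,
    fun p q h M => sOuter_eq_sInner h M,
    cactusAction N n m, cactusAction N n m, fun p q h M => ?_,
    fun p q h M => cactusAction_cactusS h M, rfl,
    howeEquiv N n m, isSkewHoweDuality_howeEquiv N n m, fun p q h M => ?_⟩
  · rw [cactusAction_cactusS, sOuter_eq_sInner h]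
  · rw [cactusAction_cactusS, howeEquiv_sInner h]
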